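/- For a partition $\lambda$ let $s_\lambda=\sum_\alpha K_{\lambda,\alpha}x^\alpha$ be its Schur function, where $K_{\lambda,\alpha}$ is the number of semistandard Young tableaux (SSYTs) of shape $\lambda$ and type $\alpha$. The Littlewood--Richardson coefficients $c^\lambda_{\mu\nu}$ are defined by $s_\mu s_\nu=\sum_\lambda c^\lambda_{\mu\nu}s_\lambda$. Let $\lambda/\mu$ be the Young diagram of $\lambda$ with the cells of $\mu$ removed, and let $f^{\lambda/\mu}$ be the number of standard Young tableaux of shape $\lambda/\mu$, that is, of SSYTs of this shape with type $(1,\dots,1)$, with one $1$ for each cell. An algorithm is a program for a unit-cost random access machine with addition, subtraction, indirect addressing, conditionals and loops; its input is the triple $(\lambda,\mu,\nu)$, given by the lists of parts, and its running time is the number of elementary steps. It generates a set of tableaux if it outputs each element of the set exactly once, and nothing else, by placing the list of entries of the tableau (row by row from the top, each row from left to right) in an output array and then executing an output instruction, which counts as one step. (1) There is an absolute constant $C$ with the following property. For every algorithm $G$ there is an algorithm $P$ such that, for all partitions $\lambda,\mu,\nu$ with $|\lambda|=|\mu|+|\nu|=n\ge 1$ and every $t$: if $G$ on input $(\lambda,\mu,\nu)$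 generates all SSYTs of shape $\lambda/\mu$ and type $\nu$ and halts within $t$ steps, then $P$ on input $(\lambda,\mu,\nu)$ computes $c^\lambda_{\mu\nu}$ and halts within $C\,t\,n^2$ steps. (2) There are a constant $C$ and an algorithm which, on input of any partitions $\lambda,\mu,\nu$ with $|\lambda|=|\mu|+|\nu|=n\ge 1$, computes $c^\lambda_{\mu\nu}$ and halts within $C\,f^{\lambda/\mu}\,n^3$ steps. -/

import Mathlib

/-! Conventions: partitions are Mathlib's Young diagrams (the parts of `lam` are
`lam.rowLen 0 ≥ lam.rowLen 1 ≥ ⋯`, its size is `lam.card`).  Rows, columns, tableau entries and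
variables are all numbered from `0` instead of from `1`. -/

/-! ### Tableaux -/

/-- The number of cells of a filled shape whose entry is `k`. -/
def entryCount (cells : Finset (ℕ × ℕ)) (T : ℕ → ℕ → ℕ) (k : ℕ) : ℕ :=
  (cells.filter fun c => T c.1 c.2 = k).card

/-- The skew shape `lam/mu`: the diagram of `lam` with the diagram of `mu` removed. -/
def skewCells (lam mu : YoungDiagram) : Finset (ℕ × ℕ) := lam.cells \ mu.cells

/-- Semistandard Young tableaux of skew shape `lam/mu` (entries outside the shape are set to `0`,
so that a tableau is determined by its entries in the shape). -/
@[ext]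
structure SkewSSYT (lam mu : YoungDiagram) where
  entry : ℕ → ℕ → ℕ
  row_weak : ∀ i j₁ j₂, j₁ < j₂ → (i, j₁) ∈ skewCells lam mu → (i, j₂) ∈ skewCells lam mu →
    entry i j₁ ≤ entry i j₂
  col_strict : ∀ i₁ i₂ j, i₁ < i₂ → (i₁, j) ∈ skewCells lam mu → (i₂, j) ∈ skewCells lam mu →
    entry i₁ j < entry i₂ j
  zeros : ∀ i j, (i, j) ∉ skewCells lam mu → entry i j = 0

/-- `T` has type `α`: for every `k`, exactly `α k` entries of `T` are equal to `k`. -/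
def SkewSSYT.HasType {lam mu : YoungDiagram} (T : SkewSSYT lam mu) (α : ℕ → ℕ) : Prop :=
  ∀ k, entryCount (skewCells lam mu) T.entry k = α k

/-- The set of SSYTs of shape `lam/mu` and type `nu`, for a partition `nu`. -/
abbrev SkewSSYTOfType (lam mu nu : YoungDiagram) : Type :=
  {T : SkewSSYT lam mu // T.HasType nu.rowLen}

/-- `f^{lam/mu}`: the number of standard Young tableaux of shape `lam/mu`, that is, of SSYTs of
type `(1, …, 1)`, with one `1` for each cell. -/
noncomputable def numSkewSYT (lam mu : YoungDiagram) : ℕ :=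
  Nat.card {T : SkewSSYT lam mu // T.HasType fun k => if k < (skewCells lam mu).card then 1 else 0}

/-! ### Schur functions and Littlewood–Richardson coefficients -/

/-- The Kostka number `K_{lam,α}`: the number of SSYTs of shape `lam` and type `α`. -/
noncomputable def kostka (lam : YoungDiagram) (α : ℕ →₀ ℕ) : ℕ :=
  Nat.card {T : SemistandardYoungTableau lam // ∀ k, entryCount lam.cells (fun i j => T i j) k = α k}

/-- The Schur function `s_lam(x₀, x₁, …)`, the generating function of the SSYTs of shape `lam`: the
formal power series in which the monomial `x^α` has the coefficient `K_{lam,α}`. -/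
noncomputable def schur (lam : YoungDiagram) : MvPowerSeries ℕ ℚ := fun α => (kostka lam α : ℚ)

/-- `a` is the Littlewood–Richardson coefficient `c^lam_{mu nu}`: the product `s_mu s_nu` has exactly
one expansion as a finite linear combination of Schur functions, and `a` is the coefficient of
`s_lam` in it. -/
def IsLRCoeff (lam mu nu : YoungDiagram) (a : ℚ) : Prop :=
  ∃ c : YoungDiagram →₀ ℚ, c lam = a ∧
    ∀ d : YoungDiagram →₀ ℚ, (d.sum fun kap x => x • schur kap) = schur mu * schur nu ↔ d = c

/-! ### Algorithms: structured programs for a unit-cost random access machine -/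

namespace RAM

/-- The memory: finitely many arrays are accessible to a program; `m a i` is the natural number that
array `a` holds at index `i`. -/
abbrev Mem : Type := ℕ → ℕ → ℕ

/-- Arithmetic expressions: constants, array access `a[e]` (with computed index), sums and
truncated differences. -/
inductive Expr : Type
  | const (k : ℕ)
  | read (a : ℕ) (e : Expr)
  | add (e₁ e₂ : Expr)
  | sub (e₁ e₂ : Expr)

/-- The value of an expression. -/
def Expr.eval (m : Mem) : Expr → ℕ
  | .const k => k
  | .read a e => m a (e.eval m)
  | .add e₁ e₂ => e₁.eval m + e₂.eval m
  | .sub e₁ e₂ => e₁.eval m - e₂.eval m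

/-- The number of elementary steps for evaluating an expression: one for each operation in it. -/
def Expr.cost : Expr → ℕ
  | .const _ => 1
  | .read _ e => 1 + e.cost
  | .add e₁ e₂ => 1 + e₁.cost + e₂.cost
  | .sub e₁ e₂ => 1 + e₁.cost + e₂.cost

/-- Programs.  `write a i e` is the assignment `a[i] := e`; `emit` releases the current contents of
the output array as an output; `loop e p` is "while `e`, do `p`"; conditions count as true when they are
nonzero. -/
inductive Prog : Type
  | skip
  | write (a : ℕ) (i e : Expr)
  | emit
  | seq (p q : Prog)
  | ite (e : Expr) (p q : Prog)
  | loop (e : Expr) (p : Prog)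

/-- The number of the output array (the arrays `0`, `1`, `2` hold the input). -/
def outArr : ℕ := 3

/-- The memory after the assignment `a[i] := v`. -/
def Mem.set (m : Mem) (a i v : ℕ) : Mem :=
  fun a' i' => if a' = a ∧ i' = i then v else m a' i'

/-- `Run p m out t m'`: started in memory `m`, the program `p` halts after exactly `t` elementary
steps in memory `m'`, having emitted the list `out` of contents of the output array. -/
inductive Run : Prog → Mem → List (ℕ → ℕ) → ℕ → Mem → Prop
  | skip (m : Mem) : Run .skip m [] 1 m
  | write (m : Mem) (a : ℕ) (i e : Expr) :
      Run (.write a i e) m [] (1 + i.cost + e.cost) (m.set a (i.eval m) (e.eval m))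
  | emit (m : Mem) : Run .emit m [m outArr] 1 m
  | seq {p q : Prog} {m₁ m₂ m₃ : Mem} {out₁ out₂ : List (ℕ → ℕ)} {t₁ t₂ : ℕ} :
      Run p m₁ out₁ t₁ m₂ → Run q m₂ out₂ t₂ m₃ →
      Run (.seq p q) m₁ (out₁ ++ out₂) (t₁ + t₂) m₃
  | ite_true {e : Expr} {p q : Prog} {m m' : Mem} {out : List (ℕ → ℕ)} {t : ℕ} :
      e.eval m ≠ 0 → Run p m out t m' → Run (.ite e p q) m out (1 + e.cost + t) m'
  | ite_false {e : Expr} {p q : Prog} {m m' : Mem} {out : List (ℕ → ℕ)} {t : ℕ} :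
      e.eval m = 0 → Run q m out t m' → Run (.ite e p q) m out (1 + e.cost + t) m'
  | loop_false {e : Expr} {p : Prog} {m : Mem} :
      e.eval m = 0 → Run (.loop e p) m [] (1 + e.cost) m
  | loop_true {e : Expr} {p : Prog} {m₁ m₂ m₃ : Mem} {out₁ out₂ : List (ℕ → ℕ)} {t₁ t₂ : ℕ} :
      e.eval m₁ ≠ 0 → Run p m₁ out₁ t₁ m₂ → Run (.loop e p) m₂ out₂ t₂ m₃ →
      Run (.loop e p) m₁ (out₁ ++ out₂) (1 + e.cost + t₁ + t₂) m₃

/-- The initial memory for the instance `(lam, mu, nu)`: the arrays `0`, `1`, `2` hold the parts of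
the three partitions, followed by zeros, and all the other arrays hold zeros. -/
def input (lam mu nu : YoungDiagram) : Mem := fun a =>
  if a = 0 then lam.rowLen else if a = 1 then mu.rowLen else if a = 2 then nu.rowLen else fun _ => 0

/-- An array `v` represents a tableau of shape `lam/mu` by the list of its entries, row by row from
the top, each row from left to right: the entry of cell `(i, j)` stands at the index
`∑_{k < i} (lam_k - mu_k) + (j - mu_i)`. -/
def Represents {lam mu : YoungDiagram} (v : ℕ → ℕ) (T : SkewSSYT lam mu) : Prop :=
  ∀ i j, (i, j) ∈ skewCells lam mu →
    v ((∑ k ∈ Finset.range i, (lam.rowLen k - mu.rowLen k)) + (j - mu.rowLen i)) = T.entry i j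

/-- On input `(lam, mu, nu)`, the program `G` halts within `t` steps and generates all SSYTs of shape
`lam/mu` and type `nu`: it emits (representations of) these tableaux, each exactly once, in some
order, and nothing else. -/
def GeneratesSSYT (G : Prog) (lam mu nu : YoungDiagram) (t : ℕ) : Prop :=
  ∃ (out : List (ℕ → ℕ)) (s : ℕ) (m : Mem) (L : List (SkewSSYTOfType lam mu nu)),
    Run G (input lam mu nu) out s m ∧ s ≤ t ∧
    L.Nodup ∧ (∀ T, T ∈ L) ∧ List.Forall₂ (fun v T => Represents v T.1) out L

/-- On input `(lam, mu, nu)`, the program `P` halts within `t` steps and computes `c^lam_{mu nu}`: at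
the end, this number is the first entry of the output array. -/
def ComputesLR (P : Prog) (lam mu nu : YoungDiagram) (t : ℕ) : Prop :=
  ∃ (out : List (ℕ → ℕ)) (s : ℕ) (m : Mem),
    Run P (input lam mu nu) out s m ∧ s ≤ t ∧ IsLRCoeff lam mu nu (m outArr 0 : ℚ)

end RAM

/-! Both claims rest on the Littlewood–Richardson rule `isLRCoeff_card`: the coefficient is the
number of SSYTs of shape λ/μ and type ν that satisfy the ballot condition `SkewSSYT.IsYamanouchi`.
This condition compares numbers of letters at row ends only, so it can be tested on an output array
in O(n²) steps.

For the rule, a tableau is encoded as a chain of partitions whose successive differences are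
horizontal strips. Schur polynomials are symmetric by the Bender–Knuth involutions, hence the
alternant a_{μ+ρ} times s_ν is the sum of a_{μ+ρ+content(T)} over the tableaux T of shape ν
(`alternant_mul_schurPoly`). If T violates the ballot condition relative to μ, a Bender–Knuth move
restricted to the cells left of the first violation in its row and to the rows below interchanges
two neighbouring exponents. The alternant changes sign, and all these terms cancel
(`sum_alternant_eq_sum_filter`). For μ = ∅ only one term survives, which is the bialternant formula.
Cancelling the Vandermonde factor then expands s_μ s_ν over the surviving T, and the coefficient of
s_λ counts those with content λ - μ. Transposing the matrix of the numbers of letters k in row i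
(`companion`) turns them into the required tableaux of shape λ/μ (`card_companion_chains`).
Uniqueness of the expansion is the triangularity of the Kostka numbers with respect to dominance
(`linearIndependent_schur`).

For (1), `countOutputs` replaces each output instruction of G by the test and a counter in arrays
that G does not use (`does_replaceEmit`). There are at most t outputs, each tested in O(n²) steps.

For (2), a tableau is described by the word of rows into which its letters are inserted: letters in
increasing order, equal letters from left to right. All the partial words are built level by level.
Without its letters, a partial word is an initial piece of a standard tableau, so every level has at
most f^{λ/μ} words (`card_words_le`), although many of them may not extend to a tableau of type ν.
With at most n extension rounds and O(n²) steps per word, generation takes O(f n³) steps. Testing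
the at most f outputs adds only O(f n²) and lower-order terms. -/

/-! ### Chains of horizontal strips and toggles -/

/-- Consecutive rows of `g` interlace: `g (k + 1) / g k` is a horizontal strip for all `k`. -/
def Interlaced (g : ℕ → ℕ → ℕ) : Prop :=
  ∀ k i, g k i ≤ g (k + 1) i ∧ g (k + 1) (i + 1) ≤ g k i

/-- Replace the `k + 1`-st term of a chain, in the rows from `I` on, by its reflection in the interval
of values allowed by the neighbouring terms, the upper bound in row `I` being lowered to `j`. -/
def toggle (k I j : ℕ) (g : ℕ → ℕ → ℕ) : ℕ → ℕ → ℕ :=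
  Function.update g (k + 1) fun i =>
    if i < I then g (k + 1) i
    else (if i = I then j else min (g (k + 2) i) (g k (i - 1)))
      + max (g k i) (g (k + 2) (i + 1)) - g (k + 1) i

/-- The cap `j` lies between the present value in row `I` and the usual upper bound, so the
reflection at the lowered bound stays within the interlacing conditions. For `I = 0` there is no
previous row and the last field is vacuous. -/
structure CanToggle (k I j : ℕ) (g : ℕ → ℕ → ℕ) : Prop where
  le_cap : g (k + 1) I ≤ j
  cap_le : j ≤ g (k + 2) I
  cap_le_prev : ∀ i, i + 1 = I → j ≤ g k i

theorem toggle_of_ne {k I j l : ℕ} (g : ℕ → ℕ → ℕ) (h : l ≠ k + 1) : toggle k I j g l = g l := by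
  simp [toggle, h]

theorem toggle_lt {k I j i : ℕ} (g : ℕ → ℕ → ℕ) (h : i < I) :
    toggle k I j g (k + 1) i = g (k + 1) i := by
  simp [toggle, h]

theorem toggle_eq {k I j : ℕ} (g : ℕ → ℕ → ℕ) :
    toggle k I j g (k + 1) I = j + max (g k I) (g (k + 2) (I + 1)) - g (k + 1) I := by
  simp [toggle]

theorem toggle_gt {k I j i : ℕ} (g : ℕ → ℕ → ℕ) (h : I ≤ i) :
    toggle k I j g (k + 1) (i + 1) =
      min (g (k + 2) (i + 1)) (g k i) + max (g k (i + 1)) (g (k + 2) (i + 2)) - g (k + 1) (i + 1) := by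
  have h1 : ¬ i + 1 < I := by omega
  have h2 : ¬ i + 1 = I := by omega
  simp [toggle, h1, h2]

/-- A reflection keeps a value inside its interval, and the bounds come from the neighbouring terms,
which do not move. The only delicate place is the seam between the fixed row `I - 1` and row `I`,
where `cap_le_prev` is used. -/
theorem toggle_mid {k I j : ℕ} {g : ℕ → ℕ → ℕ} (hg : Interlaced g) (hc : CanToggle k I j g) (i : ℕ) :
    g k i ≤ toggle k I j g (k + 1) i ∧ toggle k I j g (k + 1) (i + 1) ≤ g k i ∧
    toggle k I j g (k + 1) i ≤ g (k + 2) i ∧ g (k + 2) (i + 1) ≤ toggle k I j g (k + 1) i := by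
  obtain ⟨h1, h2, h3⟩ := hc
  have a := hg k i
  have b := hg (k + 1) i
  have a' := hg k (i + 1)
  have b' := hg (k + 1) (i + 1)
  simp only [show k + 1 + 1 = k + 2 from rfl, show i + 1 + 1 = i + 2 from rfl] at a b a' b'
  rcases lt_trichotomy i I with h | h | h
  · rw [toggle_lt g h]
    rcases lt_or_eq_of_le (show i + 1 ≤ I from h) with h' | h'
    · rw [toggle_lt g h']; omega
    · have h4 := h3 i h'
      subst h'
      rw [toggle_eq]
      simp only [show i + 1 + 1 = i + 2 from rfl] at *
      omega
  · subst h
    rw [toggle_eq, toggle_gt g le_rfl]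
    omega
  · obtain ⟨i, rfl⟩ : ∃ i', i = i' + 1 := ⟨i - 1, by omega⟩
    have a'' := hg k i
    have b'' := hg (k + 1) i
    rw [toggle_gt g (by omega), toggle_gt g (by omega)]
    simp only [show k + 1 + 1 = k + 2 from rfl, show i + 1 + 1 = i + 2 from rfl,
      show i + 1 + 2 = i + 3 from rfl] at *
    omega

theorem Interlaced.toggle {k I j : ℕ} {g : ℕ → ℕ → ℕ} (hg : Interlaced g) (hc : CanToggle k I j g) :
    Interlaced (toggle k I j g) := by
  intro l i
  have h := toggle_mid hg hc i
  by_cases h1 : l = k + 1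
  · subst h1
    rw [toggle_of_ne g (show k + 1 + 1 ≠ k + 1 by omega)]
    exact ⟨h.2.2.1, h.2.2.2⟩
  · by_cases h2 : l = k
    · subst h2
      rw [toggle_of_ne g h1]
      exact ⟨h.1, h.2.1⟩
    · rw [toggle_of_ne g h1, toggle_of_ne g (by omega)]
      exact hg l i

theorem CanToggle.toggle {k I j : ℕ} {g : ℕ → ℕ → ℕ} (hg : Interlaced g) (hc : CanToggle k I j g) :
    CanToggle k I j (toggle k I j g) := by
  obtain ⟨h1, h2, h3⟩ := hc
  refine ⟨?_, ?_, ?_⟩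
  · rw [toggle_eq]
    have a := (hg k I).1
    have b := (hg (k + 1) I).2
    simp only [show k + 1 + 1 = k + 2 from rfl] at b
    omega
  · rw [toggle_of_ne g (by omega)]; exact h2
  · rw [toggle_of_ne g (by omega)]; exact h3

theorem toggle_toggle {k I j : ℕ} {g : ℕ → ℕ → ℕ} (hg : Interlaced g) (hc : CanToggle k I j g) :
    toggle k I j (toggle k I j g) = g := by
  funext l i
  by_cases h : l = k + 1
  · subst h
    obtain ⟨h1, h2, h3⟩ := hc
    have e0 := toggle_of_ne (k := k) (I := I) (j := j) g (show k ≠ k + 1 by omega)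
    have e2 := toggle_of_ne (k := k) (I := I) (j := j) g (show k + 2 ≠ k + 1 by omega)
    rcases lt_trichotomy i I with h | h | h
    · rw [toggle_lt _ h, toggle_lt _ h]
    · subst h
      rw [toggle_eq, e0, e2, toggle_eq]; omega
    · obtain ⟨i, rfl⟩ : ∃ i', i = i' + 1 := ⟨i - 1, by omega⟩
      rw [toggle_gt _ (by omega), e0, e2, toggle_gt _ (by omega)]
      have a := hg k i
      have b := hg (k + 1) (i + 1)
      have a' := hg k (i + 1)
      simp only [show k + 1 + 1 = k + 2 from rfl, show i + 1 + 1 = i + 2 from rfl] at *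
      omega
  · rw [toggle_of_ne _ h, toggle_of_ne _ h]

/-- The sum of the rows `< M` of the term `k`. -/
def rowSum (M : ℕ) (g : ℕ → ℕ → ℕ) (k : ℕ) : ℕ := ∑ i ∈ Finset.range M, g k i

theorem rowSum_toggle_of_ne {M k I j l : ℕ} (g : ℕ → ℕ → ℕ) (h : l ≠ k + 1) :
    rowSum M (toggle k I j g) l = rowSum M g l := by
  simp [rowSum, toggle_of_ne g h]

/-- In each row the old and the new value add up to upper plus lower bound. The upper bound of a row
is the minimum, and the lower bound of the row above is the maximum, of the same two numbers, so the
sum telescopes. Only the cap and the last lower bound remain. -/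
theorem sum_toggle_add {k I j : ℕ} {g : ℕ → ℕ → ℕ} (hg : Interlaced g) (hc : CanToggle k I j g)
    (n : ℕ) :
    ∑ i ∈ Finset.range (n + 1), (toggle k I j g (k + 1) (I + i) + g (k + 1) (I + i)) =
      j + ∑ i ∈ Finset.range n, (g k (I + i) + g (k + 2) (I + i + 1))
        + max (g k (I + n)) (g (k + 2) (I + n + 1)) := by
  induction n with
  | zero =>
    have a := (hg k I).1
    have := hc.le_cap
    simp [toggle_eq]
    omega
  | succ n ih =>
    rw [Finset.sum_range_succ, ih, Finset.sum_range_succ]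
    rw [show I + (n + 1) = I + n + 1 by ring, toggle_gt g (by omega)]
    have a := hg k (I + n)
    have b := hg (k + 1) (I + n)
    have b' := hg (k + 1) (I + n + 1)
    have a' := hg k (I + n + 1)
    simp only [show k + 1 + 1 = k + 2 from rfl, show I + n + 1 + 1 = I + n + 2 from rfl] at *
    omega

/-- This is the telescoped sum continued to rows where everything vanishes, in a form without
truncated subtraction. The rows `< I` do not move and enter with twice their old sum. -/
theorem rowSum_toggle_add {k I j M : ℕ} {g : ℕ → ℕ → ℕ} (hg : Interlaced g)
    (hc : CanToggle k I j g) (hI : I ≤ M) (hM : ∀ i, M ≤ i → g (k + 2) i = 0) :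
    rowSum M (toggle k I j g) (k + 1) + rowSum M g (k + 1) + (∑ i ∈ Finset.range I, g k i)
        + g (k + 2) I + (∑ i ∈ Finset.range I, g (k + 2) i) =
      j + rowSum M g k + rowSum M g (k + 2) + 2 * ∑ i ∈ Finset.range I, g (k + 1) i := by
  obtain ⟨n, rfl⟩ := Nat.exists_eq_add_of_le hI
  have key := sum_toggle_add hg hc n
  have z1 : ∀ i, I + n ≤ i → g (k + 1) i = 0 := fun i hi => by
    have := (hg (k + 1) i).1; have := hM i hi; simp only [show k + 1 + 1 = k + 2 from rfl] at *; omega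
  have z0 : ∀ i, I + n ≤ i → g k i = 0 := fun i hi => by
    have := (hg k i).1; have := z1 i hi; omega
  have zt : toggle k I j g (k + 1) (I + n) = 0 := by
    have := (toggle_mid hg hc (I + n)).2.2.1; rw [hM _ le_rfl] at this; omega
  rw [Finset.sum_range_succ, zt, z1 _ le_rfl, z0 _ le_rfl, hM (I + n + 1) (by omega),
    Finset.sum_add_distrib, Finset.sum_add_distrib] at key
  have e2 : ∑ i ∈ Finset.range (n + 1), g (k + 2) (I + i) = ∑ i ∈ Finset.range n, g (k + 2) (I + i) := by
    rw [Finset.sum_range_succ, hM _ le_rfl, add_zero]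
  rw [Finset.sum_range_succ'] at e2
  simp only [rowSum, Finset.sum_range_add]
  have e3 : ∑ i ∈ Finset.range I, toggle k I j g (k + 1) i = ∑ i ∈ Finset.range I, g (k + 1) i :=
    Finset.sum_congr rfl fun i hi => toggle_lt g (Finset.mem_range.mp hi)
  rw [e3]
  simp only [add_zero, max_self, ← add_assoc] at *
  omega


/-! ### Companions and the sign-reversing involution -/

theorem Interlaced.mono {g : ℕ → ℕ → ℕ} (hg : Interlaced g) {k l : ℕ} (h : k ≤ l) (i : ℕ) :
    g k i ≤ g l i :=
  monotone_nat_of_le_succ (f := fun k => g k i) (fun k => (hg k i).1) h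

/-- The companion of a chain `g`: its entry `I k` is `a k`, increased by the number of letters `k` in
the rows `< I` of the tableau that corresponds to `g`. -/
def companion (a : ℕ → ℕ) (g : ℕ → ℕ → ℕ) : ℕ → ℕ → ℕ :=
  fun I k => a k + ∑ i ∈ Finset.range I, (g (k + 1) i - g k i)

/-- The content of a chain with at most `M` nonzero rows. -/
def content (M : ℕ) (g : ℕ → ℕ → ℕ) (k : ℕ) : ℕ := rowSum M g (k + 1) - rowSum M g k

theorem rowSum_mono {M : ℕ} {g : ℕ → ℕ → ℕ} (hg : Interlaced g) {k l : ℕ} (h : k ≤ l) :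
    rowSum M g k ≤ rowSum M g l :=
  Finset.sum_le_sum fun i _ => hg.mono h i

theorem content_add {M : ℕ} {g : ℕ → ℕ → ℕ} (hg : Interlaced g) (k : ℕ) :
    content M g k + rowSum M g k = rowSum M g (k + 1) :=
  Nat.sub_add_cancel (rowSum_mono hg (Nat.le_succ k))

theorem companion_zero (a : ℕ → ℕ) (g : ℕ → ℕ → ℕ) : companion a g 0 = a := by
  funext k; simp [companion]

theorem companion_succ (a : ℕ → ℕ) (g : ℕ → ℕ → ℕ) (I k : ℕ) :
    companion a g (I + 1) k = companion a g I k + (g (k + 1) I - g k I) := by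
  simp [companion, Finset.sum_range_succ, add_assoc]

theorem companion_add {a : ℕ → ℕ} {g : ℕ → ℕ → ℕ} (hg : Interlaced g) (I k : ℕ) :
    companion a g I k + rowSum I g k = a k + rowSum I g (k + 1) := by
  rw [companion, rowSum, rowSum, add_assoc, ← Finset.sum_add_distrib]
  congr 1
  exact Finset.sum_congr rfl fun i _ => Nat.sub_add_cancel (hg k i).1

theorem companion_eq_content {a : ℕ → ℕ} {g : ℕ → ℕ → ℕ} (hg : Interlaced g) (M k : ℕ) :
    companion a g M k = a k + content M g k := by
  have h1 := companion_add (a := a) hg M k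
  have h2 := content_add (M := M) hg k
  omega

/-- The increments of the companion are those of `g` with rows and letters interchanged. Transposing
twice restores them, and `b` restores the initial term. -/
theorem companion_companion {a b : ℕ → ℕ} {g : ℕ → ℕ → ℕ} (h0 : g 0 = b) (hg : Interlaced g) :
    companion b (companion a g) = g := by
  funext K i
  have e : ∀ k, companion a g (i + 1) k - companion a g i k = g (k + 1) i - g k i := fun k => by
    rw [companion_succ, Nat.add_sub_cancel_left]
  induction K with
  | zero => rw [companion_zero, h0]
  | succ K ih => rw [companion_succ, ih, e]; have := (hg K i).1; omega

/-- Chains of horizontal strips from `a` to `b` with `N` steps. -/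
structure StripChain (N : ℕ) (a b : ℕ → ℕ) (g : ℕ → ℕ → ℕ) : Prop where
  bot : g 0 = a
  top : ∀ k, N ≤ k → g k = b
  lace : Interlaced g

theorem StripChain.le {N : ℕ} {a b : ℕ → ℕ} {g : ℕ → ℕ → ℕ} (h : StripChain N a b g) (k i : ℕ) :
    g k i ≤ b i := by
  rw [← h.top (max k N) (le_max_right _ _)]
  exact h.lace.mono (le_max_left _ _) i

/-- Such a chain is determined by its values in the box `k < N`, `i < M`, which are bounded by the
sum of `b`. -/
theorem finite_stripChain (N M : ℕ) (a b : ℕ → ℕ) (hb : ∀ i, M ≤ i → b i = 0) :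
    {g | StripChain N a b g}.Finite := by
  classical
  let B := ∑ i ∈ Finset.range M, b i
  let f : (ℕ → ℕ → ℕ) → (Fin N × Fin M → Fin (B + 1)) := fun g p =>
    Fin.ofNat (B + 1) (g p.1 p.2)
  refine Set.Finite.of_finite_image (f := f) (Set.toFinite _) ?_
  intro g hg g' hg' he
  funext k i
  by_cases hk : N ≤ k
  · rw [hg.top k hk, hg'.top k hk]
  by_cases hi : M ≤ i
  · have h1 := hg.le k i
    have h2 := hg'.le k i
    rw [hb i hi] at h1 h2
    omega
  · push Not at hk hi
    have := congrFun he (⟨k, hk⟩, ⟨i, hi⟩)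
    have hB : b i ≤ B := Finset.single_le_sum (f := b) (fun _ _ => Nat.zero_le _)
      (Finset.mem_range.mpr hi)
    have h1 := hg.le k i
    have h2 := hg'.le k i
    simp only [f, Fin.ofNat, Fin.mk.injEq] at this
    rwa [Nat.mod_eq_of_lt (by omega), Nat.mod_eq_of_lt (by omega)] at this

/-! ### First violations of the ballot condition and the restricted Bender–Knuth move. -/

/-- The companion violates interlacing at row `I`, letters `k` and `k + 1`. -/
def Fails (a : ℕ → ℕ) (g : ℕ → ℕ → ℕ) (I k : ℕ) : Prop :=
  companion a g I k < companion a g (I + 1) (k + 1)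

/-- Companions grow with the row automatically, so only the second half of interlacing can fail. -/
theorem interlaced_companion_iff {a : ℕ → ℕ} {g : ℕ → ℕ → ℕ} :
    Interlaced (companion a g) ↔ ∀ I k, ¬ Fails a g I k := by
  simp only [Fails, not_lt]
  refine ⟨fun h I k => (h I k).2, fun h I k => ⟨?_, h I k⟩⟩
  rw [companion_succ]; omega

/-- The first violation: in the least possible row, with the largest possible letter. -/
structure FirstFail (a : ℕ → ℕ) (g : ℕ → ℕ → ℕ) (I k : ℕ) : Prop where
  fails : Fails a g I k
  row_min : ∀ I' < I, ∀ k', ¬ Fails a g I' k'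
  letter_max : ∀ k', k < k' → ¬ Fails a g I k'

theorem FirstFail.unique {a : ℕ → ℕ} {g : ℕ → ℕ → ℕ} {I k I' k' : ℕ} (h : FirstFail a g I k)
    (h' : FirstFail a g I' k') : I = I' ∧ k = k' := by
  have e : I = I' := by
    rcases lt_trichotomy I I' with hlt | rfl | hlt
    · exact absurd h.fails (h'.row_min I hlt k)
    · rfl
    · exact absurd h'.fails (h.row_min I' hlt k')
  subst e
  refine ⟨rfl, ?_⟩
  rcases lt_trichotomy k k' with hlt | rfl | hlt
  · exact absurd h'.fails (h.letter_max k' hlt)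
  · rfl
  · exact absurd h.fails (h'.letter_max k hlt)

/-- Letters `≥ N` do not occur, and `a` itself is antitone. Hence the toggle at a violation never
touches the constant end of the chain, and a last failing letter exists. -/
theorem StripChain.lt_of_fails {N : ℕ} {a b c : ℕ → ℕ} {g : ℕ → ℕ → ℕ} (hg : StripChain N c b g)
    (ha : Antitone a) {I k : ℕ} (h : Fails a g I k) : k + 1 < N := by
  by_contra hN
  push Not at hN
  have e : companion a g (I + 1) (k + 1) = a (k + 1) := by
    simp [companion, hg.top (k + 1) hN, hg.top (k + 1 + 1) (by omega)]
  have := ha (Nat.le_succ k)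
  have : a k ≤ companion a g I k := Nat.le_add_right _ _
  simp only [Fails, e] at h
  simp only [Nat.succ_eq_add_one] at *
  omega

theorem exists_firstFail {N : ℕ} {a b c : ℕ → ℕ} {g : ℕ → ℕ → ℕ} (hg : StripChain N c b g)
    (ha : Antitone a) (h : ¬ Interlaced (companion a g)) : ∃ I k, FirstFail a g I k := by
  classical
  rw [interlaced_companion_iff] at h
  push Not at h
  obtain ⟨k₀, h₀⟩ := Nat.find_spec h
  have hle : k₀ ≤ N := by have := hg.lt_of_fails ha h₀; omega
  refine ⟨Nat.find h, Nat.findGreatest (Fails a g (Nat.find h)) N, ?_, ?_, ?_⟩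
  · exact Nat.findGreatest_spec (P := Fails a g (Nat.find h)) hle h₀
  · intro I' hI' k' hf
    exact Nat.find_min h hI' ⟨k', hf⟩
  · intro k' hk' hf
    have := hg.lt_of_fails ha hf
    exact Nat.findGreatest_is_greatest hk' (by omega) hf

/-- The number of columns left of the cell of a first violation. -/
def failCap (a : ℕ → ℕ) (g : ℕ → ℕ → ℕ) (I k : ℕ) : ℕ :=
  g (k + 2) I + companion a g I (k + 1) - companion a g I k - 1

/-- Up to the failing row the weight is still weakly decreasing: in row `0` because `a` is antitone,
later because the row before does not fail. -/
theorem FirstFail.companion_le {a : ℕ → ℕ} {g : ℕ → ℕ → ℕ} {I k : ℕ}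
    (ha : Antitone a) (h : FirstFail a g I k) : companion a g I (k + 1) ≤ companion a g I k := by
  cases I with
  | zero => simp only [companion_zero]; exact ha (Nat.le_succ k)
  | succ I =>
    have := h.row_min I (Nat.lt_succ_self I) k
    simp only [Fails, not_lt] at this
    rw [companion_succ a g I k]; omega

/-- Read row `I` from the right: the letters `k + 1` first outnumber what the ballot condition
allows in the column `failCap`. The failure puts this column among those of the letters `k + 1`.
That row `I - 1` does not fail bounds it by the end of the letters `< k` in that row. -/
theorem FirstFail.canToggle {a : ℕ → ℕ} {g : ℕ → ℕ → ℕ} {I k : ℕ} (hg : Interlaced g)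
    (ha : Antitone a) (h : FirstFail a g I k) : CanToggle k I (failCap a g I k) g := by
  have h1 := h.fails
  have h2 := h.companion_le ha
  have h3 := (hg (k + 1) I).1
  simp only [Fails, companion_succ, show k + 1 + 1 = k + 2 from rfl] at h1 h3
  refine ⟨?_, ?_, ?_⟩
  · unfold failCap; omega
  · unfold failCap; omega
  · rintro I' rfl
    have h4 := h.row_min I' (Nat.lt_succ_self I') k
    have h5 := (hg k I').1
    have h6 := (hg (k + 1) I').2
    simp only [Fails, not_lt, show k + 1 + 1 = k + 2 from rfl] at h4 h6
    unfold failCap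
    rw [companion_succ a g I' k]
    omega

theorem companion_toggle_of_le {a : ℕ → ℕ} {g : ℕ → ℕ → ℕ} {I k j I' : ℕ} (h : I' ≤ I) :
    companion a (toggle k I j g) I' = companion a g I' := by
  have e : ∀ l i, i < I → toggle k I j g l i = g l i := fun l i hi => by
    by_cases hl : l = k + 1
    · subst hl; exact toggle_lt g hi
    · rw [toggle_of_ne g hl]
  funext k'
  simp only [companion]
  congr 1
  refine Finset.sum_congr rfl fun i hi => ?_
  have : i < I := by have := Finset.mem_range.mp hi; omega
  rw [e _ _ this, e _ _ this]

/-- The letters `k + 1` from the cap on are frozen, so the violation persists. The rows above are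
untouched. A violation at a larger letter of row `I` would only involve terms of the chain after `k
+ 1`, which do not change; this is why the largest failing letter is chosen. -/
theorem FirstFail.toggle {a : ℕ → ℕ} {g : ℕ → ℕ → ℕ} {I k : ℕ} (hg : Interlaced g)
    (ha : Antitone a) (h : FirstFail a g I k) :
    FirstFail a (toggle k I (failCap a g I k) g) I k := by
  have hc := h.canToggle hg ha
  have hle := h.companion_le ha
  refine ⟨?_, ?_, ?_⟩
  · have h1 := h.fails
    have h2 := (hc.toggle hg).le_cap
    have h3 := hc.cap_le
    simp only [Fails, companion_succ _ _ I, companion_toggle_of_le le_rfl] at h1 ⊢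
    rw [toggle_of_ne g (show k + 1 + 1 ≠ k + 1 by omega)]
    simp only [failCap, show k + 1 + 1 = k + 2 from rfl] at *
    omega
  · intro I' hI' k'
    simp only [Fails, companion_toggle_of_le hI'.le, companion_toggle_of_le (show I' + 1 ≤ I from hI')]
    exact h.row_min I' hI' k'
  · intro k' hk'
    have := h.letter_max k' hk'
    simp only [Fails, companion_succ _ _ I, companion_toggle_of_le le_rfl] at this ⊢
    rwa [toggle_of_ne g (by omega), toggle_of_ne g (by omega)]

/-- The cap depends only on the rows `< I` and on the term `k + 2`, which the toggle fixes. So a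
second application uses the same cap and undoes the first. -/
theorem failCap_toggle (a : ℕ → ℕ) (g : ℕ → ℕ → ℕ) (I k j : ℕ) :
    failCap a (toggle k I j g) I k = failCap a g I k := by
  rw [failCap, companion_toggle_of_le le_rfl, toggle_of_ne g (show k + 2 ≠ k + 1 by omega), failCap]

theorem StripChain.toggle {N : ℕ} {a b : ℕ → ℕ} {g : ℕ → ℕ → ℕ} (hg : StripChain N a b g)
    {k I j : ℕ} (hc : CanToggle k I j g) (hk : k + 1 < N) : StripChain N a b (toggle k I j g) := by
  refine ⟨?_, ?_, hg.lace.toggle hc⟩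
  · rw [toggle_of_ne g (by omega), hg.bot]
  · intro l hl
    rw [toggle_of_ne g (by omega), hg.top l hl]

theorem rowSum_eq_of_le {M M' : ℕ} {f : ℕ → ℕ → ℕ} {k : ℕ} (h : M ≤ M') (hf : ∀ i, M ≤ i → f k i = 0) :
    rowSum M' f k = rowSum M f k := by
  rw [rowSum, rowSum]
  refine (Finset.sum_subset (Finset.range_mono h) fun i _ hi => hf i ?_).symm
  simpa using hi

/-- The effect of the involution on the weight `a + content`. -/
theorem FirstFail.content_toggle {N M : ℕ} {a b c : ℕ → ℕ} {g : ℕ → ℕ → ℕ} {I k : ℕ}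
    (hg : StripChain N c b g) (ha : Antitone a) (hb : ∀ i, M ≤ i → b i = 0) (h : FirstFail a g I k) :
    (a k + content M (_root_.toggle k I (failCap a g I k) g) k + 1 = a (k + 1) + content M g (k + 1)) ∧
    (a (k + 1) + content M (_root_.toggle k I (failCap a g I k) g) (k + 1)
      = a k + content M g k + 1) ∧
    ∀ l, l ≠ k → l ≠ k + 1 → content M (_root_.toggle k I (failCap a g I k) g) l = content M g l := by
  have hz : ∀ l i, M ≤ i → g l i = 0 := fun l i hi => by
    have := hg.le l i; rw [hb i hi] at this; omega
  have hIM : I ≤ M := by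
    by_contra hlt
    push Not at hlt
    have hf := h.fails
    have hle := h.companion_le ha
    simp only [Fails, companion_succ, hz _ I hlt.le] at hf
    omega
  have hc := h.canToggle hg.lace ha
  have key := rowSum_toggle_add hg.lace hc hIM (hz (k + 2))
  have c1 := companion_add (a := a) hg.lace I k
  have c2 := companion_add (a := a) hg.lace I (k + 1)
  have hf := h.fails
  have hi := (hg.lace (k + 1) I).1
  have hg' := hg.lace.toggle hc
  have d1 := content_add (M := M) hg.lace k
  have d2 := content_add (M := M) hg.lace (k + 1)
  have d1' := content_add (M := M) hg' k
  have d2' := content_add (M := M) hg' (k + 1)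
  rw [rowSum_toggle_of_ne g (show k ≠ k + 1 by omega)] at d1'
  rw [rowSum_toggle_of_ne g (show k + 1 + 1 ≠ k + 1 by omega)] at d2'
  have hj : failCap a g I k + companion a g I k + 1 = g (k + 2) I + companion a g I (k + 1) := by
    simp only [Fails, companion_succ, show k + 1 + 1 = k + 2 from rfl] at hf hi
    unfold failCap; omega
  refine ⟨?_, ?_, ?_⟩
  · simp only [rowSum, show k + 1 + 1 = k + 2 from rfl] at *
    omega
  · simp only [rowSum, show k + 1 + 1 = k + 2 from rfl] at *
    omega
  · intro l h1 h2
    rw [content, content, rowSum_toggle_of_ne g (by omega), rowSum_toggle_of_ne g (by omega)]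

open Classical in
/-- Toggle a chain at its first violation. -/
noncomputable def flipFail (a : ℕ → ℕ) (g : ℕ → ℕ → ℕ) : ℕ → ℕ → ℕ :=
  if h : ∃ p : ℕ × ℕ, FirstFail a g p.1 p.2 then
    toggle h.choose.2 h.choose.1 (failCap a g h.choose.1 h.choose.2) g
  else g

theorem FirstFail.flipFail_eq {a : ℕ → ℕ} {g : ℕ → ℕ → ℕ} {I k : ℕ} (h : FirstFail a g I k) :
    flipFail a g = _root_.toggle k I (failCap a g I k) g := by
  have hex : ∃ p : ℕ × ℕ, FirstFail a g p.1 p.2 := ⟨(I, k), h⟩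
  have hu := hex.choose_spec.unique h
  rw [flipFail, dif_pos hex, hu.1, hu.2]

theorem FirstFail.flipFail_flipFail {a : ℕ → ℕ} {g : ℕ → ℕ → ℕ} {I k : ℕ} (hg : Interlaced g)
    (ha : Antitone a) (h : FirstFail a g I k) : flipFail a (flipFail a g) = g := by
  rw [h.flipFail_eq, (h.toggle hg ha).flipFail_eq, failCap_toggle, toggle_toggle hg (h.canToggle hg ha)]

theorem FirstFail.not_interlaced {a : ℕ → ℕ} {g : ℕ → ℕ → ℕ} {I k : ℕ} (h : FirstFail a g I k) :
    ¬ Interlaced (companion a g) := fun hi => interlaced_companion_iff.mp hi I k h.fails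

/-- The Bender–Knuth involution swaps two neighbouring multiplicities. -/
theorem content_benderKnuth {N M : ℕ} {a b : ℕ → ℕ} {g : ℕ → ℕ → ℕ} (hg : StripChain N a b g)
    (hb : ∀ i, M ≤ i → b i = 0) (k : ℕ) :
    content M (toggle k 0 (g (k + 2) 0) g) k = content M g (k + 1) ∧
    content M (toggle k 0 (g (k + 2) 0) g) (k + 1) = content M g k ∧
    ∀ l, l ≠ k → l ≠ k + 1 → content M (toggle k 0 (g (k + 2) 0) g) l = content M g l := by
  have hc : CanToggle k 0 (g (k + 2) 0) g :=
    ⟨(hg.lace (k + 1) 0).1, le_rfl, fun i hi => absurd hi (by omega)⟩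
  have key := rowSum_toggle_add hg.lace hc (Nat.zero_le M) (fun i hi => by
    have := hg.le (k + 2) i; rw [hb i hi] at this; omega)
  have hg' := hg.lace.toggle hc
  have d1 := content_add (M := M) hg.lace k
  have d2 := content_add (M := M) hg.lace (k + 1)
  have d1' := content_add (M := M) hg' k
  have d2' := content_add (M := M) hg' (k + 1)
  rw [rowSum_toggle_of_ne g (show k ≠ k + 1 by omega)] at d1'
  rw [rowSum_toggle_of_ne g (show k + 1 + 1 ≠ k + 1 by omega)] at d2'
  simp only [Finset.range_zero, Finset.sum_empty, show k + 1 + 1 = k + 2 from rfl] at *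
  refine ⟨by omega, by omega, ?_⟩
  intro l h1 h2
  rw [content, content, rowSum_toggle_of_ne g (by omega), rowSum_toggle_of_ne g (by omega)]


/-! ### Schur polynomials and alternants -/

theorem YoungDiagram.rowLen_eq_zero {la : YoungDiagram} {i : ℕ} (h : la.card ≤ i) :
    la.rowLen i = 0 := by
  by_contra h0
  have hmem : (i, 0) ∈ la := YoungDiagram.mem_iff_lt_rowLen.mpr (Nat.pos_of_ne_zero h0)
  have : (Finset.range (i + 1)).image (fun k => (k, 0)) ⊆ la.cells := by
    intro c hc
    obtain ⟨k, hk, rfl⟩ := Finset.mem_image.mp hc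
    exact la.up_left_mem (by have := Finset.mem_range.mp hk; omega) le_rfl hmem
  have h2 := Finset.card_le_card this
  rw [Finset.card_image_of_injective _ (fun x y h => by simpa using h), Finset.card_range] at h2
  change i + 1 ≤ la.card at h2
  omega

theorem YoungDiagram.antitone_rowLen (la : YoungDiagram) : Antitone la.rowLen :=
  fun i j h => la.rowLen_anti i j h

theorem YoungDiagram.sum_rowLen {la : YoungDiagram} {M : ℕ} (h : la.card ≤ M) :
    ∑ i ∈ Finset.range M, la.rowLen i = la.card := by
  have : la.cells = ((Finset.range M).sigma fun i => Finset.range (la.rowLen i)).map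
      ⟨fun p => (p.1, p.2), fun p q h => by simpa [Sigma.ext_iff] using h⟩ := by
    ext ⟨i, j⟩
    simp only [YoungDiagram.mem_cells, YoungDiagram.mem_iff_lt_rowLen, Finset.mem_map,
      Finset.mem_sigma, Finset.mem_range, Sigma.exists]
    constructor
    · intro hj
      refine ⟨i, j, ⟨?_, hj⟩, rfl⟩
      by_contra hi
      rw [YoungDiagram.rowLen_eq_zero (by omega)] at hj
      omega
    · rintro ⟨i', j', ⟨-, h⟩, he⟩
      obtain ⟨rfl, rfl⟩ := Prod.mk.inj he
      exact h
  change _ = la.cells.card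
  rw [this, Finset.card_map, Finset.card_sigma]
  simp

theorem YoungDiagram.ext_rowLen {la ka : YoungDiagram} (h : la.rowLen = ka.rowLen) : la = ka := by
  ext ⟨i, j⟩
  simp only [YoungDiagram.mem_cells, YoungDiagram.mem_iff_lt_rowLen, h]

theorem YoungDiagram.exists_rowLen_eq {f : ℕ → ℕ} (hf : Antitone f) {M : ℕ}
    (hM : ∀ i, M ≤ i → f i = 0) : ∃ la : YoungDiagram, la.rowLen = f := by
  let la : YoungDiagram :=
    { cells := (Finset.range M ×ˢ Finset.range (f 0)).filter fun c => c.2 < f c.1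
      isLowerSet := by
        rintro ⟨i, j⟩ ⟨i', j'⟩ ⟨h1, h2⟩ hm
        simp only [Finset.coe_filter, Finset.mem_product, Finset.mem_range, Set.mem_ofPred_eq] at hm ⊢
        have := hf h1
        simp only at h1 h2 this
        omega }
  refine ⟨la, ?_⟩
  funext i
  have key : ∀ j, j < la.rowLen i ↔ j < f i := fun j => by
    rw [← YoungDiagram.mem_iff_lt_rowLen, ← YoungDiagram.mem_cells]
    simp only [la, Finset.mem_filter, Finset.mem_product, Finset.mem_range]
    refine ⟨fun h => h.2, fun h => ⟨⟨?_, h.trans_le (hf (Nat.zero_le i))⟩, h⟩⟩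
    by_contra hi
    rw [hM i (by omega)] at h
    omega
  have h1 := key (f i)
  have h2 := key (la.rowLen i)
  omega

open Classical in
/-- The diagram with the given row lengths. -/
noncomputable def diagramOf (f : ℕ → ℕ) : YoungDiagram :=
  if h : ∃ la : YoungDiagram, la.rowLen = f then h.choose else ⊥

theorem rowLen_diagramOf {f : ℕ → ℕ} (h : ∃ la : YoungDiagram, la.rowLen = f) :
    (diagramOf f).rowLen = f := by
  rw [diagramOf, dif_pos h]; exact h.choose_spec

/-- The Gelfand–Tsetlin patterns of shape `la` with `N` rows. -/
noncomputable def patterns (N : ℕ) (la : YoungDiagram) : Finset (ℕ → ℕ → ℕ) :=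
  (finite_stripChain N la.card 0 la.rowLen fun _ h => YoungDiagram.rowLen_eq_zero h).toFinset

theorem mem_patterns {N : ℕ} {la : YoungDiagram} {g : ℕ → ℕ → ℕ} :
    g ∈ patterns N la ↔ StripChain N 0 la.rowLen g := by
  simp [patterns]

/-- The monomial with the exponents `β 0, …, β (N - 1)`. -/
noncomputable def monom (N : ℕ) (β : ℕ → ℕ) : MvPolynomial (Fin N) ℚ :=
  ∏ i : Fin N, MvPolynomial.X i ^ β i

theorem monom_add (N : ℕ) (β γ : ℕ → ℕ) : monom N (β + γ) = monom N β * monom N γ := by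
  simp [monom, pow_add, Finset.prod_mul_distrib]

/-- The Schur polynomial in `N` variables. -/
noncomputable def schurPoly (N : ℕ) (la : YoungDiagram) : MvPolynomial (Fin N) ℚ :=
  ∑ g ∈ patterns N la, monom N (content la.card g)

/-- The alternant with exponents `β i + N - 1 - i`. -/
noncomputable def alternant (N : ℕ) (β : ℕ → ℕ) : MvPolynomial (Fin N) ℚ :=
  Matrix.det (Matrix.of fun i j : Fin N =>
    (MvPolynomial.X i : MvPolynomial (Fin N) ℚ) ^ (β j + (N - 1 - j)))

/-- For `I = 0` and the cap `g (k + 2) 0`, the ordinary upper bound of row `0`, the toggle is the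
full Bender–Knuth involution. It permutes the patterns and interchanges the exponents of the two
variables. -/
theorem rename_swap_schurPoly (n : ℕ) (la : YoungDiagram) (k : Fin n) :
    MvPolynomial.rename (Equiv.swap k.castSucc k.succ) (schurPoly (n + 1) la) =
      schurPoly (n + 1) la := by
  rw [schurPoly, map_sum]
  let t : (ℕ → ℕ → ℕ) → ℕ → ℕ → ℕ := fun g => toggle k 0 (g (k + 2) 0) g
  have hc : ∀ g ∈ patterns (n + 1) la, CanToggle k 0 (g (k + 2) 0) g := fun g hg =>
    ⟨((mem_patterns.mp hg).lace (k + 1) 0).1, le_rfl, fun i hi => absurd hi (by omega)⟩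
  have ht : ∀ g ∈ patterns (n + 1) la, t g ∈ patterns (n + 1) la := fun g hg =>
    mem_patterns.mpr ((mem_patterns.mp hg).toggle (hc g hg) (by omega))
  have htt : ∀ g ∈ patterns (n + 1) la, t (t g) = g := fun g hg => by
    have : t g (k + 2) 0 = g (k + 2) 0 := by
      simp only [t]; rw [toggle_of_ne g (by omega)]
    change toggle k 0 (t g (k + 2) 0) (t g) = g
    rw [this]
    exact toggle_toggle (mem_patterns.mp hg).lace (hc g hg)
  refine Finset.sum_nbij' t t ht ht htt htt fun g hg => ?_
  obtain ⟨h1, h2, h3⟩ := content_benderKnuth (mem_patterns.mp hg)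
    (fun i h => YoungDiagram.rowLen_eq_zero (la := la) h) k
  simp only [monom, map_prod, map_pow, MvPolynomial.rename_X]
  rw [← Equiv.prod_comp (Equiv.swap k.castSucc k.succ)
    (fun i : Fin (n + 1) => (MvPolynomial.X i : MvPolynomial (Fin (n + 1)) ℚ) ^ content la.card (t g) i)]
  refine Finset.prod_congr rfl fun i _ => ?_
  congr 1
  rcases eq_or_ne i k.castSucc with rfl | hi1
  · rw [Equiv.swap_apply_left]; simpa [t] using h2.symm
  rcases eq_or_ne i k.succ with rfl | hi2
  · rw [Equiv.swap_apply_right]; simpa [t] using h1.symm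
  · rw [Equiv.swap_apply_of_ne_of_ne hi1 hi2]
    refine (h3 i ?_ ?_).symm
    · intro h; exact hi1 (Fin.ext (by simpa using h))
    · intro h; exact hi2 (Fin.ext (by simpa using h))

theorem rename_schurPoly (N : ℕ) (la : YoungDiagram) (σ : Equiv.Perm (Fin N)) :
    MvPolynomial.rename σ (schurPoly N la) = schurPoly N la := by
  cases N with
  | zero =>
    rw [Subsingleton.elim σ 1]
    simp
  | succ n =>
    have hσ : σ ∈ Submonoid.closure
        (Set.range fun i : Fin n => Equiv.swap i.castSucc i.succ) := by
      rw [Equiv.Perm.mclosure_swap_castSucc_succ]; trivial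
    induction hσ using Submonoid.closure_induction with
    | mem x hx => obtain ⟨k, rfl⟩ := hx; exact rename_swap_schurPoly n la k
    | one => simp
    | mul x y _ _ hx hy =>
      rw [Equiv.Perm.coe_mul, ← MvPolynomial.rename_rename, hy, hx]

theorem alternant_eq_sum (N : ℕ) (β : ℕ → ℕ) :
    alternant N β = ∑ σ : Equiv.Perm (Fin N), (Equiv.Perm.sign σ : ℤ) •
      MvPolynomial.rename σ (monom N (fun i => β i + (N - 1 - i))) := by
  rw [alternant, Matrix.det_apply]
  refine Finset.sum_congr rfl fun σ _ => ?_
  simp [monom, map_prod, Units.smul_def]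

/-- Symmetry lets the Schur polynomial be moved inside each permuted monomial of the alternant,
where it is expanded over the patterns. -/
theorem alternant_mul_schurPoly (N : ℕ) (β : ℕ → ℕ) (la : YoungDiagram) :
    alternant N β * schurPoly N la =
      ∑ g ∈ patterns N la, alternant N (β + content la.card g) := by
  simp only [alternant_eq_sum]
  rw [Finset.sum_comm, Finset.sum_mul]
  refine Finset.sum_congr rfl fun σ _ => ?_
  rw [← rename_schurPoly N la σ, smul_mul_assoc, ← map_mul, schurPoly, Finset.mul_sum, map_sum,
    Finset.smul_sum]
  refine Finset.sum_congr rfl fun g _ => ?_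
  rw [← monom_add]
  congr 3
  funext i
  simp only [Pi.add_apply]; omega

/-- Since ρ drops by one from `k` to `k + 1`, the hypotheses say that β' + ρ arises from β + ρ by
interchanging two entries, that is, two columns of the determinant. -/
theorem alternant_swap {N k : ℕ} (hk : k + 1 < N) {β β' : ℕ → ℕ} (h1 : β' k + 1 = β (k + 1))
    (h2 : β' (k + 1) = β k + 1) (h3 : ∀ l, l ≠ k → l ≠ k + 1 → β' l = β l) :
    alternant N β' = - alternant N β := by
  have hne : (⟨k, by omega⟩ : Fin N) ≠ ⟨k + 1, hk⟩ := by simp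
  have := Matrix.det_permute' (Equiv.swap (⟨k, by omega⟩ : Fin N) ⟨k + 1, hk⟩)
    (Matrix.of fun i j : Fin N =>
    (MvPolynomial.X i : MvPolynomial (Fin N) ℚ) ^ (β j + (N - 1 - j)))
  rw [Equiv.Perm.sign_swap hne] at this
  simp only [Units.val_neg, Units.val_one, Int.cast_neg, Int.cast_one, neg_mul, one_mul] at this
  rw [alternant, alternant, ← this]
  congr 1
  refine Matrix.ext fun i j => ?_
  simp only [Matrix.of_apply, Matrix.submatrix_apply, id_eq]
  refine congrArg (fun e => (MvPolynomial.X i : MvPolynomial (Fin N) ℚ) ^ e) ?_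
  rcases eq_or_ne j ⟨k, by omega⟩ with rfl | hj1
  · rw [Equiv.swap_apply_left]
    change β' k + (N - 1 - k) = β (k + 1) + (N - 1 - (k + 1))
    omega
  rcases eq_or_ne j ⟨k + 1, hk⟩ with rfl | hj2
  · rw [Equiv.swap_apply_right]
    change β' (k + 1) + (N - 1 - (k + 1)) = β k + (N - 1 - k)
    omega
  · rw [Equiv.swap_apply_of_ne_of_ne hj1 hj2, h3 j]
    · intro h; exact hj1 (Fin.ext h)
    · intro h; exact hj2 (Fin.ext h)

theorem alternant_zero_ne_zero (N : ℕ) : alternant N 0 ≠ 0 := by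
  have h : alternant N 0 = Matrix.det ((Matrix.vandermonde
      (fun i : Fin N => (MvPolynomial.X i : MvPolynomial (Fin N) ℚ))).submatrix id Fin.revPerm) := by
    rw [alternant]
    congr 1
    refine Matrix.ext fun i j => ?_
    simp only [Pi.zero_apply, zero_add, Matrix.of_apply, Matrix.submatrix_apply, id_eq,
      Fin.revPerm_apply, Matrix.vandermonde_apply, Fin.val_rev]
    rw [show N - 1 - (j : ℕ) = N - (j + 1) by omega]
  rw [h, Matrix.det_permute']
  refine mul_ne_zero ?_ (Matrix.det_vandermonde_ne_zero_iff.mpr (MvPolynomial.X_injective))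
  rcases Int.units_eq_one_or (Equiv.Perm.sign (Fin.revPerm : Equiv.Perm (Fin N))) with h | h <;>
    simp [h]

-- `flipFail` is an involution on the chains with a violation, and by `FirstFail.content_toggle` it
-- reverses the sign of the alternant.
open Classical in
theorem sum_alternant_eq_sum_filter (N : ℕ) {a : ℕ → ℕ} (ha : Antitone a) (la : YoungDiagram) :
    ∑ g ∈ patterns N la, alternant N (a + content la.card g) =
      ∑ g ∈ patterns N la with Interlaced (companion a g), alternant N (a + content la.card g) := by
  rw [← Finset.sum_filter_add_sum_filter_not (patterns N la) (fun g => Interlaced (companion a g))]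
  rw [add_eq_left]
  have hf : ∀ g ∈ (patterns N la).filter (fun g => ¬ Interlaced (companion a g)),
      StripChain N 0 la.rowLen g ∧ ∃ I k, FirstFail a g I k := fun g hg => by
    rw [Finset.mem_filter, mem_patterns] at hg
    exact ⟨hg.1, exists_firstFail hg.1 ha hg.2⟩
  have hneg : ∀ g ∈ (patterns N la).filter (fun g => ¬ Interlaced (companion a g)),
      alternant N (a + content la.card (flipFail a g)) = - alternant N (a + content la.card g) := by
    intro g hg
    obtain ⟨hg, I, k, h⟩ := hf g hg
    obtain ⟨h1, h2, h3⟩ := h.content_toggle hg ha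
      (fun i h => YoungDiagram.rowLen_eq_zero (la := la) h)
    rw [h.flipFail_eq]
    refine alternant_swap (hg.lt_of_fails ha h.fails) h1 h2 fun l hl hl' => ?_
    simp only [Pi.add_apply, h3 l hl hl']
  refine Finset.sum_involution (fun g _ => flipFail a g) ?_ ?_ ?_ ?_
  · intro g hg
    rw [hneg g hg, add_neg_cancel]
  -- A fixed point would make the alternant equal to its negative, hence zero.
  · intro g hg h0 he
    have := hneg g hg
    rw [he, eq_neg_iff_add_eq_zero, ← two_mul] at this
    exact h0 ((mul_eq_zero.mp this).resolve_left two_ne_zero)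
  · intro g hg
    obtain ⟨hg, I, k, h⟩ := hf g hg
    rw [Finset.mem_filter, mem_patterns, h.flipFail_eq]
    exact ⟨hg.toggle (h.canToggle hg.lace ha) (hg.lt_of_fails ha h.fails),
      (h.toggle hg.lace ha).not_interlaced⟩
  · intro g hg
    obtain ⟨hg, I, k, h⟩ := hf g hg
    exact h.flipFail_flipFail hg.lace ha


/-! ### The product of two Schur polynomials -/

theorem StripChain.eq_zero {N M : ℕ} {a b : ℕ → ℕ} {g : ℕ → ℕ → ℕ} (hg : StripChain N a b g)
    (hb : ∀ i, M ≤ i → b i = 0) (k : ℕ) {i : ℕ} (hi : M ≤ i) : g k i = 0 := by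
  have := hg.le k i; rw [hb i hi] at this; omega

/-- Each horizontal strip creates at most one new row, so after `k` strips there are at most `k`
rows. -/
theorem StripChain.row_eq_zero {N : ℕ} {b : ℕ → ℕ} {g : ℕ → ℕ → ℕ} (hg : StripChain N 0 b g)
    {k i : ℕ} (h : k ≤ i) : g k i = 0 := by
  induction k generalizing i with
  | zero => rw [hg.bot]; rfl
  | succ k ih =>
    obtain ⟨i, rfl⟩ : ∃ i', i = i' + 1 := ⟨i - 1, by omega⟩
    have := (hg.lace k i).2
    rw [ih (by omega)] at this
    omega

/-- The chain of the tableau whose row `i` is filled with `i`. -/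
def highestChain (b : ℕ → ℕ) : ℕ → ℕ → ℕ := fun k i => if i < k then b i else 0

theorem stripChain_highestChain {b : ℕ → ℕ} (hb : Antitone b) {N : ℕ} (h : ∀ i, N ≤ i → b i = 0) :
    StripChain N 0 b (highestChain b) := by
  refine ⟨?_, ?_, ?_⟩
  · funext i; simp [highestChain]
  · intro k hk
    funext i
    simp only [highestChain, ite_eq_left_iff, not_lt]
    intro hi
    rw [h i (by omega)]
  · intro k i
    have := hb (Nat.le_succ i)
    simp only [highestChain, Nat.succ_eq_add_one] at *
    constructor
    · split_ifs <;> omega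
    · split_ifs <;> omega

theorem companion_highestChain (b : ℕ → ℕ) (M k : ℕ) :
    companion 0 (highestChain b) M k = if k < M then b k else 0 := by
  have : ∀ i, highestChain b (k + 1) i - highestChain b k i = if i = k then b i else 0 := fun i => by
    simp only [highestChain]
    split_ifs <;> omega
  simp [companion, this]

theorem content_highestChain {b : ℕ → ℕ} (hb : Antitone b) {M : ℕ} (h : ∀ i, M ≤ i → b i = 0) :
    content M (highestChain b) = b := by
  funext k
  have h1 := companion_eq_content (a := 0) (stripChain_highestChain hb h).lace M k
  rw [companion_highestChain] at h1
  simp only [Pi.zero_apply, zero_add] at h1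
  rw [← h1]
  split_ifs with hk
  · rfl
  · rw [h k (by omega)]

/-- By induction on the row, the ballot condition excludes letters larger than the row index: the
preceding letter does not yet occur above. Interlacing excludes the smaller letters. -/
theorem eq_highestChain {N : ℕ} {b : ℕ → ℕ} {g : ℕ → ℕ → ℕ} (hg : StripChain N 0 b g)
    (hi : Interlaced (companion 0 g)) : g = highestChain b := by
  have h0 : ∀ i k, i < k → g (k + 1) i - g k i = 0 := by
    intro i
    induction i using Nat.strong_induction_on with
    | _ i ih =>
      intro k hk
      obtain ⟨k, rfl⟩ : ∃ k', k = k' + 1 := ⟨k - 1, by omega⟩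
      have h1 := (hi i k).2
      rw [companion_succ] at h1
      have h2 : companion 0 g i k = 0 := by
        simp only [companion, Pi.zero_apply, zero_add]
        refine Finset.sum_eq_zero fun i' hi' => ?_
        have := Finset.mem_range.mp hi'
        exact ih i' this k (by omega)
      omega
  have h1 : ∀ i d, g (i + 1 + d) i = g (i + 1) i := by
    intro i d
    induction d with
    | zero => rfl
    | succ d ih =>
      have a := h0 i (i + 1 + d) (by omega)
      have b := (hg.lace (i + 1 + d) i).1
      rw [← add_assoc]; omega
  funext k i
  rw [highestChain]
  split_ifs with hk
  · obtain ⟨d, rfl⟩ := Nat.exists_eq_add_of_le (show i + 1 ≤ k from hk)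
    rw [h1, ← h1 i N, hg.top _ (by omega)]
  · exact hg.row_eq_zero (by omega)

-- This is the bialternant formula, the case μ = ∅ of the cancellation. The bound on `N` ensures
-- that the one surviving chain fits into `N` steps.
open Classical in
theorem alternant_zero_mul_schurPoly {N : ℕ} {la : YoungDiagram} (h : la.card ≤ N) :
    alternant N 0 * schurPoly N la = alternant N la.rowLen := by
  have hz : ∀ i, la.card ≤ i → la.rowLen i = 0 := fun i h => YoungDiagram.rowLen_eq_zero h
  rw [alternant_mul_schurPoly, sum_alternant_eq_sum_filter N (fun _ _ _ => le_rfl)]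
  have : (patterns N la).filter (fun g => Interlaced (companion 0 g)) = {highestChain la.rowLen} := by
    ext g
    rw [Finset.mem_filter, mem_patterns, Finset.mem_singleton]
    constructor
    · rintro ⟨h1, h2⟩; exact eq_highestChain h1 h2
    · rintro rfl
      refine ⟨stripChain_highestChain la.antitone_rowLen fun i hi => hz i (by omega), ?_⟩
      rw [interlaced_companion_iff]
      intro I k
      simp only [Fails, companion_highestChain, not_lt]
      have := la.rowLen_anti k (k + 1) (by omega)
      split_ifs <;> omega
  rw [this, Finset.sum_singleton, zero_add, content_highestChain la.antitone_rowLen hz]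

theorem content_eq_zero {N M k : ℕ} {a b : ℕ → ℕ} {g : ℕ → ℕ → ℕ} (hg : StripChain N a b g)
    (hk : N ≤ k) : content M g k = 0 := by
  simp [content, rowSum, hg.top k hk, hg.top (k + 1) (by omega)]

theorem sum_content {N M K : ℕ} {b : ℕ → ℕ} {g : ℕ → ℕ → ℕ} (hg : StripChain N 0 b g)
    (hK : N ≤ K) : ∑ k ∈ Finset.range K, content M g k = ∑ i ∈ Finset.range M, b i := by
  have : ∀ K, ∑ k ∈ Finset.range K, content M g k = rowSum M g K := by
    intro K
    induction K with
    | zero => simp [rowSum, hg.bot]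
    | succ K ih => rw [Finset.sum_range_succ, ih, add_comm, content_add hg.lace]
  rw [this, rowSum, hg.top K hK]

/-- Evaluated at a row without cells, the interlacing of the companion says that μ plus the whole
content is weakly decreasing. -/
theorem exists_rowLen_eq_add_content {N : ℕ} {mu nu : YoungDiagram} {g : ℕ → ℕ → ℕ}
    (hg : StripChain N 0 nu.rowLen g) (hi : Interlaced (companion mu.rowLen g)) :
    ∃ la : YoungDiagram, la.rowLen = mu.rowLen + content nu.card g := by
  have hz : ∀ i, nu.card ≤ i → nu.rowLen i = 0 := fun i h => YoungDiagram.rowLen_eq_zero h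
  refine YoungDiagram.exists_rowLen_eq (M := N + mu.card) (antitone_nat_of_succ_le fun k => ?_) ?_
  · have h1 := (hi nu.card k).2
    rw [companion_succ, hg.eq_zero hz _ le_rfl, companion_eq_content hg.lace,
      companion_eq_content hg.lace] at h1
    simpa using h1
  · intro k hk
    rw [Pi.add_apply, content_eq_zero hg (by omega), YoungDiagram.rowLen_eq_zero (by omega)]

theorem card_eq_of_rowLen_eq_add_content {N : ℕ} {la mu nu : YoungDiagram} {g : ℕ → ℕ → ℕ}
    (hg : StripChain N 0 nu.rowLen g) (h : la.rowLen = mu.rowLen + content nu.card g) :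
    la.card = mu.card + nu.card := by
  have h1 := YoungDiagram.sum_rowLen (la := la) (M := la.card + mu.card + N) (by omega)
  have h2 := YoungDiagram.sum_rowLen (la := mu) (M := la.card + mu.card + N) (by omega)
  have h3 := sum_content (M := nu.card) (K := la.card + mu.card + N) hg (by omega)
  rw [YoungDiagram.sum_rowLen le_rfl] at h3
  rw [h] at h1
  simp only [Pi.add_apply, Finset.sum_add_distrib] at h1
  omega

-- After multiplication by the Vandermonde factor both sides are sums of alternants, and
-- `MvPolynomial` over ℚ has no zero divisors.
open Classical in
theorem schurPoly_mul_schurPoly {N : ℕ} {mu nu : YoungDiagram} (h : mu.card + nu.card ≤ N) :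
    schurPoly N mu * schurPoly N nu =
      ∑ g ∈ patterns N nu with Interlaced (companion mu.rowLen g),
        schurPoly N (diagramOf (mu.rowLen + content nu.card g)) := by
  refine mul_left_cancel₀ (alternant_zero_ne_zero N) ?_
  rw [← mul_assoc, alternant_zero_mul_schurPoly (by omega), alternant_mul_schurPoly,
    sum_alternant_eq_sum_filter N mu.antitone_rowLen, Finset.mul_sum]
  refine Finset.sum_congr rfl fun g hg => ?_
  rw [Finset.mem_filter, mem_patterns] at hg
  have he := rowLen_diagramOf (exists_rowLen_eq_add_content hg.1 hg.2)
  have hc := card_eq_of_rowLen_eq_add_content hg.1 he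
  rw [alternant_zero_mul_schurPoly (by omega), he]


/-! ### Tableaux and chains -/

theorem mem_skewCells {lam mu : YoungDiagram} {i j : ℕ} :
    (i, j) ∈ skewCells lam mu ↔ mu.rowLen i ≤ j ∧ j < lam.rowLen i := by
  rw [skewCells, Finset.mem_sdiff, YoungDiagram.mem_cells, YoungDiagram.mem_cells,
    YoungDiagram.mem_iff_lt_rowLen, YoungDiagram.mem_iff_lt_rowLen, not_lt, and_comm]

/-- An initial segment of an interval is determined by its cardinality. This converts between the
entries of a tableau and the row ends of its chain, in both directions. -/
theorem iff_lt_add_card_filter_Ico {a b : ℕ} {P : ℕ → Prop} [DecidablePred P]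
    (hP : ∀ x y, a ≤ x → x ≤ y → y < b → P y → P x) {j : ℕ} (ha : a ≤ j) (hb : j < b) :
    P j ↔ j < a + ((Finset.Ico a b).filter P).card := by
  constructor
  · intro hj
    have : Finset.Ico a (j + 1) ⊆ (Finset.Ico a b).filter P := fun x hx => by
      rw [Finset.mem_Ico] at hx
      rw [Finset.mem_filter, Finset.mem_Ico]
      exact ⟨by omega, hP x j hx.1 (by omega) hb hj⟩
    have := Finset.card_le_card this
    rw [Nat.card_Ico] at this
    omega
  · intro hj
    by_contra hn
    have : (Finset.Ico a b).filter P ⊆ Finset.Ico a j := fun x hx => by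
      rw [Finset.mem_filter, Finset.mem_Ico] at hx
      rw [Finset.mem_Ico]
      refine ⟨hx.1.1, ?_⟩
      by_contra hxj
      exact hn (hP j x ha (by omega) hx.1.2 hx.2)
    have := Finset.card_le_card this
    rw [Nat.card_Ico] at this
    omega

namespace SkewSSYT

variable {lam mu : YoungDiagram}

theorem row_weak_le (S : SkewSSYT lam mu) {i j₁ j₂ : ℕ} (h : j₁ ≤ j₂) (h1 : mu.rowLen i ≤ j₁)
    (h2 : j₂ < lam.rowLen i) : S.entry i j₁ ≤ S.entry i j₂ := by
  rcases h.lt_or_eq with h | rfl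
  · exact S.row_weak i j₁ j₂ h (mem_skewCells.mpr ⟨h1, by omega⟩) (mem_skewCells.mpr ⟨by omega, h2⟩)
  · exact le_rfl

/-- The chain of partitions of a tableau: row `k` of the `I`-th one ends after the entries `< I`. -/
def toChain (S : SkewSSYT lam mu) (I k : ℕ) : ℕ :=
  mu.rowLen k + ((Finset.Ico (mu.rowLen k) (lam.rowLen k)).filter fun j => S.entry k j < I).card

theorem lt_iff_lt_toChain (S : SkewSSYT lam mu) {k j : ℕ} (h : (k, j) ∈ skewCells lam mu) (I : ℕ) :
    S.entry k j < I ↔ j < S.toChain I k := by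
  rw [mem_skewCells] at h
  exact iff_lt_add_card_filter_Ico (P := fun j => S.entry k j < I)
    (fun x y h1 h2 h3 h4 => (S.row_weak_le h2 h1 h3).trans_lt h4) h.1 h.2

theorem toChain_mono (S : SkewSSYT lam mu) {I I' : ℕ} (h : I ≤ I') (k : ℕ) :
    S.toChain I k ≤ S.toChain I' k := by
  refine Nat.add_le_add_left (Finset.card_le_card fun j hj => ?_) _
  rw [Finset.mem_filter] at hj ⊢
  exact ⟨hj.1, hj.2.trans_le h⟩

theorem toChain_le (S : SkewSSYT lam mu) (h : ∀ k, mu.rowLen k ≤ lam.rowLen k) (I k : ℕ) :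
    S.toChain I k ≤ lam.rowLen k := by
  have := Finset.card_filter_le (Finset.Ico (mu.rowLen k) (lam.rowLen k)) (fun j => S.entry k j < I)
  rw [Nat.card_Ico] at this
  have := h k
  unfold toChain; omega

theorem stripChain_toChain (S : SkewSSYT lam mu) (h : ∀ k, mu.rowLen k ≤ lam.rowLen k) {N : ℕ}
    (hN : ∀ k j, (k, j) ∈ skewCells lam mu → S.entry k j < N) :
    StripChain N mu.rowLen lam.rowLen S.toChain := by
  refine ⟨?_, ?_, ?_⟩
  · funext k; simp [toChain]
  · intro I hI
    funext k
    have := h k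
    rw [toChain, Finset.filter_true_of_mem, Nat.card_Ico]
    · omega
    · intro j hj
      exact (hN k j (mem_skewCells.mpr (Finset.mem_Ico.mp hj))).trans_le hI
  · intro I k
    refine ⟨S.toChain_mono (Nat.le_succ I) k, ?_⟩
    -- Otherwise the cell of row `k` in column `S.toChain I k` has an entry at least `I`, while the
    -- cell below has an entry at most `I`.
    by_contra hlt
    push Not at hlt
    have h1 : mu.rowLen k ≤ S.toChain I k := Nat.le_add_right _ _
    have h2 := S.toChain_le h (I + 1) (k + 1)
    have h3 := lam.rowLen_anti k (k + 1) (Nat.le_succ k)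
    have h4 := mu.rowLen_anti k (k + 1) (Nat.le_succ k)
    have c1 : (k, S.toChain I k) ∈ skewCells lam mu := mem_skewCells.mpr ⟨h1, by omega⟩
    have c2 : (k + 1, S.toChain I k) ∈ skewCells lam mu := mem_skewCells.mpr ⟨by omega, by omega⟩
    have h5 := (S.lt_iff_lt_toChain c2 (I + 1)).mpr hlt
    have h6 := (S.lt_iff_lt_toChain c1 I).not.mpr (lt_irrefl _)
    have h7 := S.col_strict k (k + 1) _ (Nat.lt_succ_self k) c1 c2
    omega

theorem ext_toChain {S S' : SkewSSYT lam mu} (h : S.toChain = S'.toChain) : S = S' := by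
  refine SkewSSYT.ext ?_
  funext k j
  by_cases hc : (k, j) ∈ skewCells lam mu
  · have h1 := fun I => S.lt_iff_lt_toChain hc I
    have h2 := fun I => S'.lt_iff_lt_toChain hc I
    simp only [h, ← h2] at h1
    have a := (h1 (S.entry k j)).not.mp (lt_irrefl _)
    have b := (h1 (S'.entry k j)).not.mpr (lt_irrefl _)
    omega
  · rw [S.zeros k j hc, S'.zeros k j hc]

theorem exists_toChain_eq {N : ℕ} {g : ℕ → ℕ → ℕ}
    (hg : StripChain N mu.rowLen lam.rowLen g) : ∃ S : SkewSSYT lam mu, S.toChain = g := by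
  -- The entry is the number of steps after which the cell is still uncovered, equivalently the
  -- index of the step that covers it.
  let e : ℕ → ℕ → ℕ := fun k j => if (k, j) ∈ skewCells lam mu then
    ((Finset.Ico 0 N).filter fun I => g (I + 1) k ≤ j).card else 0
  have he : ∀ k j, (k, j) ∈ skewCells lam mu → ∀ I, e k j < I ↔ j < g I k := by
    intro k j hc I
    have hc' := mem_skewCells.mp hc
    have hle : e k j ≤ N := by
      simp only [e, if_pos hc]
      exact (Finset.card_filter_le _ _).trans (by simp)
    cases I with
    | zero => rw [hg.bot]; omega
    | succ I =>
      by_cases hI : I < N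
      · have := iff_lt_add_card_filter_Ico (P := fun I => g (I + 1) k ≤ j) (a := 0) (b := N)
          (fun x y _ h2 _ h4 => (hg.lace.mono (show x + 1 ≤ y + 1 by omega) k).trans h4)
          (Nat.zero_le I) hI
        simp only [e, if_pos hc]
        omega
      · rw [hg.top (I + 1) (by omega)]; omega
  have hanti : ∀ I i d, g (I + 1) (i + d) ≤ g (I + 1) i := by
    intro I i d
    induction d with
    | zero => exact le_rfl
    | succ d ih =>
      have := hg.lace I (i + d)
      rw [← add_assoc]; omega
  refine ⟨⟨e, ?_, ?_, ?_⟩, ?_⟩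
  · intro i j₁ j₂ hj h1 h2
    have a := (he i j₂ h2 (e i j₂ + 1)).mp (Nat.lt_succ_self _)
    have b := (he i j₁ h1 (e i j₂ + 1)).mpr (by omega)
    omega
  · intro i₁ i₂ j hi h1 h2
    rw [he i₁ j h1]
    have a := (he i₂ j h2 (e i₂ j + 1)).mp (Nat.lt_succ_self _)
    obtain ⟨d, rfl⟩ := Nat.exists_eq_add_of_le (show i₁ + 1 ≤ i₂ from hi)
    have b := hanti (e (i₁ + 1 + d) j) (i₁ + 1) d
    have c := (hg.lace (e (i₁ + 1 + d) j) i₁).2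
    omega
  · intro i j hc
    simp only [e, if_neg hc]
  · funext I k
    change mu.rowLen k + ((Finset.Ico (mu.rowLen k) (lam.rowLen k)).filter fun j => e k j < I).card = _
    have h1 : mu.rowLen k ≤ g I k := by rw [← hg.bot]; exact hg.lace.mono (Nat.zero_le I) k
    have h2 := hg.le I k
    have : ((Finset.Ico (mu.rowLen k) (lam.rowLen k)).filter fun j => e k j < I) =
        Finset.Ico (mu.rowLen k) (g I k) := by
      ext j
      rw [Finset.mem_filter, Finset.mem_Ico, Finset.mem_Ico]
      constructor
      · rintro ⟨h3, h4⟩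
        exact ⟨h3.1, (he k j (mem_skewCells.mpr h3) I).mp h4⟩
      · rintro ⟨h3, h4⟩
        have h5 : mu.rowLen k ≤ j ∧ j < lam.rowLen k := ⟨h3, by omega⟩
        exact ⟨h5, (he k j (mem_skewCells.mpr h5) I).mpr h4⟩
    rw [this, Nat.card_Ico]; omega

theorem toChain_succ (S : SkewSSYT lam mu) (I k : ℕ) :
    S.toChain (I + 1) k = S.toChain I k +
      ((Finset.Ico (mu.rowLen k) (lam.rowLen k)).filter fun j => S.entry k j = I).card := by
  rw [toChain, toChain, add_assoc, ← Finset.card_union_of_disjoint, ← Finset.filter_or]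
  · simp only [Nat.lt_succ_iff_lt_or_eq]
  · rw [Finset.disjoint_filter]
    intro j _ h; omega

theorem card_filter_skewCells {M : ℕ} (hM : lam.card ≤ M) (P : ℕ → ℕ → Prop)
    [∀ i, DecidablePred (P i)] :
    ((skewCells lam mu).filter fun c => P c.1 c.2).card =
      ∑ k ∈ Finset.range M, ((Finset.Ico (mu.rowLen k) (lam.rowLen k)).filter (P k)).card := by
  rw [← Finset.card_sigma]
  refine Finset.card_bij' (fun c _ => ⟨c.1, c.2⟩) (fun p _ => (p.1, p.2)) ?_ ?_
    (fun _ _ => rfl) (fun _ _ => rfl)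
  · rintro ⟨i, j⟩ hc
    rw [Finset.mem_filter, mem_skewCells] at hc
    rw [Finset.mem_sigma, Finset.mem_filter, Finset.mem_range, Finset.mem_Ico]
    refine ⟨?_, hc.1, hc.2⟩
    by_contra hi
    have := YoungDiagram.rowLen_eq_zero (la := lam) (i := i) (by simp only at hi; omega)
    omega
  · rintro ⟨i, j⟩ hc
    rw [Finset.mem_sigma, Finset.mem_filter, Finset.mem_range, Finset.mem_Ico] at hc
    rw [Finset.mem_filter, mem_skewCells]
    exact hc.2

theorem entryCount_eq (S : SkewSSYT lam mu) {M : ℕ} (hM : lam.card ≤ M) (I : ℕ) :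
    entryCount (skewCells lam mu) S.entry I = content M S.toChain I := by
  rw [entryCount, card_filter_skewCells hM (fun i j => S.entry i j = I), content, rowSum, rowSum,
    Finset.sum_congr rfl (fun k _ => S.toChain_succ I k), Finset.sum_add_distrib,
    Nat.add_sub_cancel_left]

theorem entry_lt_of_hasType {S : SkewSSYT lam mu} {N : ℕ} {α : ℕ → ℕ} (hS : S.HasType α)
    (hα : ∀ i, N ≤ i → α i = 0) (k j : ℕ) (hc : (k, j) ∈ skewCells lam mu) : S.entry k j < N := by
  by_contra hn
  have h1 := hS (S.entry k j)
  rw [hα _ (by omega), entryCount, Finset.card_eq_zero] at h1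
  have : (k, j) ∈ (skewCells lam mu).filter fun c => S.entry c.1 c.2 = S.entry k j := by
    rw [Finset.mem_filter]; exact ⟨hc, rfl⟩
  rw [h1] at this
  exact absurd this (Finset.notMem_empty _)

theorem finite_hasType (h : ∀ k, mu.rowLen k ≤ lam.rowLen k) {N : ℕ} {α : ℕ → ℕ}
    (hα : ∀ i, N ≤ i → α i = 0) : Finite {S : SkewSSYT lam mu // S.HasType α} := by
  have := (finite_stripChain N lam.card mu.rowLen lam.rowLen
    fun _ h => YoungDiagram.rowLen_eq_zero h).to_subtype
  refine Finite.of_injective (β := {g | StripChain N mu.rowLen lam.rowLen g})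
    (fun S => ⟨S.1.toChain, S.1.stripChain_toChain h (entry_lt_of_hasType S.2 hα)⟩) fun S S' he => ?_
  exact Subtype.ext (ext_toChain (congrArg Subtype.val he))

/-- Tableaux of a given type correspond to chains of a given content. -/
theorem card_eq_card_chains (h : ∀ k, mu.rowLen k ≤ lam.rowLen k) {N : ℕ} {α : ℕ → ℕ}
    (hα : ∀ i, N ≤ i → α i = 0) (Q : (ℕ → ℕ → ℕ) → Prop) :
    Nat.card {S : SkewSSYT lam mu // S.HasType α ∧ Q S.toChain} =
      Nat.card {g // StripChain N mu.rowLen lam.rowLen g ∧ content lam.card g = α ∧ Q g} := by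
  refine Nat.card_eq_of_bijective (fun S => ⟨S.1.toChain, S.1.stripChain_toChain h (entry_lt_of_hasType S.2.1 hα),
    funext fun I => ?_, S.2.2⟩) ⟨?_, ?_⟩
  · rw [← S.1.entryCount_eq le_rfl]; exact S.2.1 I
  · intro S S' he
    exact Subtype.ext (ext_toChain (congrArg Subtype.val he))
  · rintro ⟨g, hg, hc, hQ⟩
    obtain ⟨S, rfl⟩ := exists_toChain_eq hg
    exact ⟨⟨S, fun I => by rw [S.entryCount_eq le_rfl, hc], hQ⟩, rfl⟩

theorem card_skewCells_of_hasType {N : ℕ} {α : ℕ → ℕ} {S : SkewSSYT lam mu} (hS : S.HasType α)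
    (hα : ∀ i, N ≤ i → α i = 0) : (skewCells lam mu).card = ∑ i ∈ Finset.range N, α i := by
  rw [Finset.card_eq_sum_card_fiberwise (f := fun c => S.entry c.1 c.2) (t := Finset.range N)]
  · exact Finset.sum_congr rfl fun i _ => hS i
  · intro c hc
    rw [Finset.mem_coe, Finset.mem_range]
    exact entry_lt_of_hasType hS hα _ _ hc

end SkewSSYT

/-- The difference of diagrams is defined without containment. If it has only |λ| - |μ| cells, all
of μ must have been removed from λ. -/
theorem rowLen_le_of_card_skewCells {lam mu nu : YoungDiagram} (hc : mu.card + nu.card = lam.card)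
    (h : (skewCells lam mu).card = nu.card) (k : ℕ) : mu.rowLen k ≤ lam.rowLen k := by
  have h1 := Finset.card_sdiff_add_card_inter lam.cells mu.cells
  change (skewCells lam mu).card + _ = lam.card at h1
  have h2 : lam.cells ∩ mu.cells = mu.cells :=
    Finset.eq_of_subset_of_card_le Finset.inter_subset_right (by
      change mu.card ≤ _; omega)
  have h3 : mu.cells ⊆ lam.cells := by rw [← h2]; exact Finset.inter_subset_left
  by_contra hlt
  push Not at hlt
  have : (k, lam.rowLen k) ∈ mu := YoungDiagram.mem_iff_lt_rowLen.mpr hlt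
  have := h3 ((YoungDiagram.mem_cells _).mpr this)
  rw [YoungDiagram.mem_cells, YoungDiagram.mem_iff_lt_rowLen] at this
  exact lt_irrefl _ this

/-! ### Schur functions -/

theorem rowLen_bot : (⊥ : YoungDiagram).rowLen = 0 := by
  funext i
  by_contra h
  exact YoungDiagram.notMem_bot (i, 0) (YoungDiagram.mem_iff_lt_rowLen.mpr (Nat.pos_of_ne_zero h))

theorem kostka_eq_card_chains (lam : YoungDiagram) (α : ℕ →₀ ℕ) {N : ℕ} (hα : ∀ i, N ≤ i → α i = 0) :
    kostka lam α =
      Nat.card {g // StripChain N 0 lam.rowLen g ∧ content lam.card g = α} := by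
  have hcells : skewCells lam ⊥ = lam.cells := by simp [skewCells]
  have h := SkewSSYT.card_eq_card_chains (lam := lam) (mu := ⊥) (N := N) (α := α)
    (fun k => by rw [rowLen_bot]; exact Nat.zero_le _) hα (fun _ => True)
  simp only [and_true, rowLen_bot] at h
  rw [← h]
  refine Nat.card_congr ⟨fun T => ⟨⟨fun i j => T.1 i j, ?_, ?_, ?_⟩, ?_⟩,
    fun S => ⟨⟨S.1.entry, ?_, ?_, ?_⟩, ?_⟩, fun _ => rfl, fun _ => rfl⟩
  · intro i j₁ j₂ hj _ h2
    rw [hcells] at h2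
    exact T.1.row_weak hj h2
  · intro i₁ i₂ j hi _ h2
    rw [hcells] at h2
    exact T.1.col_strict hi h2
  · intro i j hc
    rw [hcells] at hc
    exact T.1.zeros hc
  · intro k
    change entryCount (skewCells lam ⊥) (fun i j => T.1 i j) k = α k
    rw [hcells]; exact T.2 k
  · intro i j₁ j₂ hj h2
    refine S.1.row_weak i j₁ j₂ hj ?_ ?_
    · rw [hcells]; exact lam.up_left_mem le_rfl hj.le h2
    · rw [hcells]; exact h2
  · intro i₁ i₂ j hi h2
    refine S.1.col_strict i₁ i₂ j hi ?_ ?_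
    · rw [hcells]; exact lam.up_left_mem hi.le le_rfl h2
    · rw [hcells]; exact h2
  · intro i j hc
    exact S.1.zeros i j (by rw [hcells]; exact hc)
  · intro k
    have := S.2 k
    rw [hcells] at this
    exact this

theorem coeff_monom (N : ℕ) (β : ℕ → ℕ) (m : Fin N →₀ ℕ) [Decidable (∀ i : Fin N, β i = m i)] :
    MvPolynomial.coeff m (monom N β) = if ∀ i : Fin N, β i = m i then 1 else 0 := by
  classical
  have : monom N β = MvPolynomial.monomial (Finsupp.equivFunOnFinite.symm fun i : Fin N => β i) 1 := by
    rw [MvPolynomial.monomial_eq, monom, Finsupp.prod_fintype _ _ (fun i => by simp)]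
    simp
  rw [this, MvPolynomial.coeff_monomial]
  refine if_congr ?_ rfl rfl
  rw [Finsupp.ext_iff]
  rfl

open Classical in
theorem coeff_schurPoly (N : ℕ) (lam : YoungDiagram) (m : Fin N →₀ ℕ) :
    MvPolynomial.coeff m (schurPoly N lam) =
      ((patterns N lam).filter fun g => ∀ i : Fin N, content lam.card g i = m i).card := by
  rw [schurPoly, MvPolynomial.coeff_sum, Finset.card_filter, Nat.cast_sum]
  refine Finset.sum_congr rfl fun g _ => ?_
  rw [coeff_monom, Nat.cast_ite, Nat.cast_one, Nat.cast_zero]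

/-- Tableaux whose type vanishes from `N` on use only letters `< N`, so this coefficient is already
seen in `N` variables. -/
theorem coeff_schur (N : ℕ) (lam : YoungDiagram) (α : ℕ →₀ ℕ) (hα : ∀ i, N ≤ i → α i = 0) :
    MvPowerSeries.coeff α (schur lam) =
      MvPolynomial.coeff α (MvPolynomial.rename (Fin.val : Fin N → ℕ) (schurPoly N lam)) := by
  classical
  have hsupp : (α.support : Set ℕ) ⊆ Set.range (Fin.val : Fin N → ℕ) := by
    intro i hi
    rw [Finset.mem_coe, Finsupp.mem_support_iff] at hi
    have : i < N := by
      by_contra h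
      exact hi (hα i (by omega))
    exact ⟨⟨i, this⟩, rfl⟩
  have he := Finsupp.mapDomain_comapDomain Fin.val (Fin.val_injective (n := N)) α hsupp
  conv_rhs => rw [← he]
  rw [MvPolynomial.coeff_rename_mapDomain _ Fin.val_injective, coeff_schurPoly]
  change (kostka lam α : ℚ) = _
  rw [kostka_eq_card_chains lam α hα, ← Nat.card_eq_finsetCard]
  congr 1
  refine Nat.card_congr (Equiv.subtypeEquivRight fun g => ?_)
  rw [Finset.mem_filter, mem_patterns]
  refine and_congr_right fun hg => ⟨fun h i => by rw [h]; rfl, fun h => funext fun i => ?_⟩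
  by_cases hi : i < N
  · exact h ⟨i, hi⟩
  · rw [content_eq_zero hg (by omega), hα i (by omega)]

/-! ### Linear independence -/

/-- The letters `< k` lie in the first `k` rows. This is the source of dominance for nonzero Kostka
numbers. -/
theorem rowSum_le_sum_of_stripChain {N : ℕ} {b : ℕ → ℕ} {g : ℕ → ℕ → ℕ} (hg : StripChain N 0 b g)
    (M k : ℕ) : rowSum M g k ≤ ∑ i ∈ Finset.range k, b i := by
  calc rowSum M g k ≤ rowSum (M + k) g k :=
        Finset.sum_le_sum_of_subset (Finset.range_mono (by omega))
    _ = rowSum k g k := rowSum_eq_of_le (by omega) fun i hi => hg.row_eq_zero hi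
    _ ≤ _ := Finset.sum_le_sum fun i _ => hg.le k i

theorem rowSum_eq_sum_content {M : ℕ} {g : ℕ → ℕ → ℕ} (h0 : g 0 = 0) (hg : Interlaced g) (k : ℕ) :
    ∑ i ∈ Finset.range k, content M g i = rowSum M g k := by
  induction k with
  | zero => simp [rowSum, h0]
  | succ k ih => rw [Finset.sum_range_succ, ih, add_comm, content_add hg]

/-- The exponent vector given by a partition. -/
noncomputable def YoungDiagram.toFinsupp (la : YoungDiagram) : ℕ →₀ ℕ :=
  Finsupp.onFinset (Finset.range la.card) la.rowLen fun i hi => by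
    rw [Finset.mem_range]
    by_contra h
    exact hi (YoungDiagram.rowLen_eq_zero (by omega))

theorem sum_rowLen_le_of_kostka_ne_zero {ka la : YoungDiagram} (h : kostka ka la.toFinsupp ≠ 0) (k : ℕ) :
    ∑ i ∈ Finset.range k, la.rowLen i ≤ ∑ i ∈ Finset.range k, ka.rowLen i := by
  rw [kostka_eq_card_chains ka _ (N := la.card) (fun i hi => YoungDiagram.rowLen_eq_zero hi)] at h
  obtain ⟨⟨g, hg, hc⟩⟩ := (Nat.card_ne_zero.mp h).1
  have hc' : content ka.card g = la.rowLen := hc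
  rw [← hc', rowSum_eq_sum_content hg.bot hg.lace]
  exact rowSum_le_sum_of_stripChain hg _ _

theorem kostka_self_ne_zero (la : YoungDiagram) : kostka la la.toFinsupp ≠ 0 := by
  have hz : ∀ i, la.card ≤ i → la.rowLen i = 0 := fun i hi => YoungDiagram.rowLen_eq_zero hi
  rw [kostka_eq_card_chains la _ (N := la.card) hz]
  refine Nat.card_ne_zero.mpr ⟨⟨⟨highestChain la.rowLen,
    stripChain_highestChain la.antitone_rowLen hz, ?_⟩⟩, ?_⟩
  · exact content_highestChain la.antitone_rowLen hz
  · refine Set.Finite.subset (finite_stripChain la.card la.card 0 la.rowLen hz) ?_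
    exact fun g hg => hg.1

/-- In a vanishing combination, look at the coefficient of x^λ for a λ in the support that maximizes
the total of all partial row sums. Every shape contributing to it dominates λ, so by maximality it
has the same partial sums and equals λ. -/
theorem linearIndependent_schur : LinearIndependent ℚ schur := by
  rw [linearIndependent_iff]
  intro e he
  by_contra hne
  have hs : e.support.Nonempty := Finsupp.support_nonempty_iff.mpr hne
  -- `K` exceeds every relevant row index, so partial sums up to `K` determine the shapes in the
  -- support.
  let K := ∑ ka ∈ e.support, ka.card
  have hK : ∀ ka ∈ e.support, ka.card ≤ K := fun ka h =>
    Finset.single_le_sum (f := YoungDiagram.card) (fun _ _ => Nat.zero_le _) h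
  obtain ⟨la, hla, hmax⟩ := Finset.exists_max_image e.support
    (fun ka => ∑ k ∈ Finset.range (K + 1), ∑ i ∈ Finset.range k, ka.rowLen i) hs
  have hcoeff := congrArg (MvPowerSeries.coeff la.toFinsupp) he
  rw [Finsupp.linearCombination_apply, Finsupp.sum, map_sum, map_zero,
    Finset.sum_eq_single_of_mem la hla] at hcoeff
  · rw [map_smul, smul_eq_mul] at hcoeff
    refine (mul_ne_zero (Finsupp.mem_support_iff.mp hla) ?_) hcoeff
    exact Nat.cast_ne_zero.mpr (kostka_self_ne_zero la)
  · intro ka hka hne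
    rw [map_smul, smul_eq_mul, mul_eq_zero]
    right
    by_contra h
    have h' : kostka ka la.toFinsupp ≠ 0 := fun h0 => h (by
      change (kostka ka la.toFinsupp : ℚ) = 0
      rw [h0, Nat.cast_zero])
    have hle := sum_rowLen_le_of_kostka_ne_zero h'
    have heq := (Finset.sum_eq_sum_iff_of_le (fun k _ => hle k)).mp
      (le_antisymm (Finset.sum_le_sum fun k _ => hle k) (hmax ka hka))
    refine hne (YoungDiagram.ext_rowLen (funext fun i => ?_))
    by_cases hi : i < K
    · have h1 := heq i (Finset.mem_range.mpr (by omega))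
      have h2 := heq (i + 1) (Finset.mem_range.mpr (by omega))
      rw [Finset.sum_range_succ, Finset.sum_range_succ] at h2
      omega
    · rw [YoungDiagram.rowLen_eq_zero ((hK ka hka).trans (by omega)),
        YoungDiagram.rowLen_eq_zero ((hK la hla).trans (by omega))]


/-! ### The Littlewood–Richardson rule -/

/-- The companion of the tableau is a tableau: for all `I` and `K`, at most as many entries `I + 1`
stand in the rows `≤ K` as entries `I` in the rows `< K`. -/
def SkewSSYT.IsYamanouchi {lam mu : YoungDiagram} (S : SkewSSYT lam mu) : Prop :=
  Interlaced (companion 0 S.toChain)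

theorem content_eq_of_le {M M' : ℕ} {g : ℕ → ℕ → ℕ} (h : M ≤ M') (hg : ∀ k i, M ≤ i → g k i = 0) :
    content M' g = content M g := by
  funext k
  rw [content, content, rowSum_eq_of_le h (hg _), rowSum_eq_of_le h (hg _)]

/-- Chains that satisfy the Littlewood–Richardson condition stop growing after `|mu| + |nu|` steps. -/
theorem StripChain.of_interlaced_companion {N : ℕ} {mu nu : YoungDiagram} {g : ℕ → ℕ → ℕ}
    (hg : StripChain N 0 nu.rowLen g) (hi : Interlaced (companion mu.rowLen g)) :
    StripChain (mu.card + nu.card) 0 nu.rowLen g := by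
  have hz : ∀ i, nu.card ≤ i → nu.rowLen i = 0 := fun i h => YoungDiagram.rowLen_eq_zero h
  obtain ⟨la, hla⟩ := exists_rowLen_eq_add_content hg hi
  have hcard := card_eq_of_rowLen_eq_add_content hg hla
  have hstep : ∀ k, mu.card + nu.card ≤ k → g (k + 1) = g k := by
    intro k hk
    have h1 : content nu.card g k = 0 := by
      have := congrFun hla k
      rw [YoungDiagram.rowLen_eq_zero (by omega), Pi.add_apply] at this
      omega
    have h2 := content_add (M := nu.card) hg.lace k
    rw [h1, zero_add] at h2
    have h3 := (Finset.sum_eq_sum_iff_of_le (fun i _ => (hg.lace k i).1)).mp h2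
    funext i
    by_cases h : i < nu.card
    · exact (h3 i (Finset.mem_range.mpr h)).symm
    · rw [hg.eq_zero hz _ (by omega), hg.eq_zero hz _ (by omega)]
  have hconst : ∀ d k, mu.card + nu.card ≤ k → g (k + d) = g k := by
    intro d k hk
    induction d with
    | zero => rfl
    | succ d ih => rw [← add_assoc, hstep _ (by omega), ih]
  refine ⟨hg.bot, fun k hk => ?_, hg.lace⟩
  rw [← hconst N k hk]
  exact hg.top _ (by omega)

open Classical in
theorem filter_patterns_eq {N : ℕ} {mu nu : YoungDiagram} (h : mu.card + nu.card ≤ N) :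
    (patterns N nu).filter (fun g => Interlaced (companion mu.rowLen g)) =
      (patterns (mu.card + nu.card) nu).filter (fun g => Interlaced (companion mu.rowLen g)) := by
  ext g
  rw [Finset.mem_filter, Finset.mem_filter, mem_patterns, mem_patterns]
  refine ⟨fun ⟨h1, h2⟩ => ⟨h1.of_interlaced_companion h2, h2⟩, fun ⟨h1, h2⟩ => ⟨⟨h1.bot, fun k hk => ?_,
    h1.lace⟩, h2⟩⟩
  exact h1.top k (by omega)

open Classical in
/-- The expansion of `s_mu s_nu`. -/
noncomputable def lrExpansion (mu nu : YoungDiagram) : YoungDiagram →₀ ℚ :=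
  ∑ g ∈ patterns (mu.card + nu.card) nu with Interlaced (companion mu.rowLen g),
    Finsupp.single (diagramOf (mu.rowLen + content nu.card g)) 1

/-- Each coefficient is compared in a finite number of variables, where the polynomial identity
applies. The list of surviving chains does not depend on that number, by `filter_patterns_eq`, so
one expansion serves all coefficients. -/
theorem linearCombination_lrExpansion (mu nu : YoungDiagram) :
    Finsupp.linearCombination ℚ schur (lrExpansion mu nu) = schur mu * schur nu := by
  classical
  ext α
  -- Large enough for the product formula and for all the variables in x^α.
  let N := mu.card + nu.card + ∑ i ∈ α.support, (i + 1)
  have hα : ∀ i, N ≤ i → α i = 0 := by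
    intro i hi
    by_contra h
    have := Finset.single_le_sum (f := fun i => i + 1) (fun _ _ => Nat.zero_le _)
      (Finsupp.mem_support_iff.mpr h)
    simp only [N] at hi this
    omega
  have hmul : MvPowerSeries.coeff α (schur mu * schur nu) = MvPolynomial.coeff α
      (MvPolynomial.rename (Fin.val : Fin N → ℕ) (schurPoly N mu * schurPoly N nu)) := by
    rw [MvPowerSeries.coeff_mul, map_mul, MvPolynomial.coeff_mul]
    refine Finset.sum_congr rfl fun p hp => ?_
    rw [Finset.HasAntidiagonal.mem_antidiagonal] at hp
    have hsum : ∀ i, N ≤ i → p.1 i + p.2 i = 0 := fun i hi => by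
      rw [← Finsupp.add_apply, hp, hα i hi]
    rw [coeff_schur N mu p.1 (fun i hi => by have := hsum i hi; omega),
      coeff_schur N nu p.2 (fun i hi => by have := hsum i hi; omega)]
  rw [hmul, schurPoly_mul_schurPoly (show mu.card + nu.card ≤ N by simp only [N]; omega),
    filter_patterns_eq (show mu.card + nu.card ≤ N by simp only [N]; omega), lrExpansion, map_sum,
    map_sum, map_sum, MvPolynomial.coeff_sum]
  refine Finset.sum_congr rfl fun g _ => ?_
  rw [Finsupp.linearCombination_single, one_smul, coeff_schur N _ α hα]

open Classical in
theorem lrExpansion_apply {lam mu nu : YoungDiagram} :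
    lrExpansion mu nu lam = (Nat.card {g // StripChain (mu.card + nu.card) 0 nu.rowLen g ∧
      Interlaced (companion mu.rowLen g) ∧ mu.rowLen + content nu.card g = lam.rowLen} : ℚ) := by
  have h : ∀ g ∈ (patterns (mu.card + nu.card) nu).filter
      (fun g => Interlaced (companion mu.rowLen g)),
      (Finsupp.single (diagramOf (mu.rowLen + content nu.card g)) (1 : ℚ)) lam =
        if mu.rowLen + content nu.card g = lam.rowLen then 1 else 0 := by
    intro g hg
    rw [Finset.mem_filter, mem_patterns] at hg
    have he := rowLen_diagramOf (exists_rowLen_eq_add_content hg.1 hg.2)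
    rw [Finsupp.single_apply]
    refine if_congr ⟨fun h => by rw [← h, he], fun h => ?_⟩ rfl rfl
    exact YoungDiagram.ext_rowLen (by rw [he, h])
  rw [lrExpansion, Finsupp.finsetSum_apply, Finset.sum_congr rfl h, Finset.sum_boole,
    Finset.filter_filter, ← Nat.card_eq_finsetCard]
  congr 1
  refine Nat.card_congr (Equiv.subtypeEquivRight fun g => ?_)
  rw [Finset.mem_filter, mem_patterns]

/-- Passing to companions interchanges the roles: the end of one chain becomes start plus content of
the other, and being interlaced is exchanged with having an interlaced companion.
`companion_companion` makes the two maps inverse to each other. -/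
theorem card_companion_chains {lam mu nu : YoungDiagram} (hc : mu.card + nu.card = lam.card) :
    Nat.card {g // StripChain lam.card 0 nu.rowLen g ∧
      Interlaced (companion mu.rowLen g) ∧ mu.rowLen + content nu.card g = lam.rowLen} =
    Nat.card {h // StripChain lam.card mu.rowLen lam.rowLen h ∧ content lam.card h = nu.rowLen ∧
      Interlaced (companion 0 h)} := by
  have hz : ∀ i, nu.card ≤ i → nu.rowLen i = 0 := fun i h => YoungDiagram.rowLen_eq_zero h
  refine Nat.card_congr ⟨fun g => ⟨companion mu.rowLen g.1, ?_⟩, fun h => ⟨companion 0 h.1, ?_⟩, ?_, ?_⟩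
  · obtain ⟨g, hg, hi, hla⟩ := g
    have hcc : companion 0 (companion mu.rowLen g) = g := companion_companion hg.bot hg.lace
    refine ⟨⟨companion_zero _ _, fun I hI => ?_, hi⟩, ?_, ?_⟩
    · change companion mu.rowLen g I = _
      rw [← hla]
      funext k
      rw [companion_eq_content hg.lace,
        content_eq_of_le (show nu.card ≤ I by omega) (fun k i => hg.eq_zero hz k), Pi.add_apply]
    · funext I
      have := companion_eq_content (a := 0) hi lam.card I
      rw [hcc, hg.top _ le_rfl] at this
      simpa using this.symm
    · simp only [hcc]; exact hg.lace
  · obtain ⟨h, hh, hnu, hi⟩ := h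
    have hcc : companion mu.rowLen (companion 0 h) = h := companion_companion hh.bot hh.lace
    have hchain : StripChain lam.card 0 nu.rowLen (companion 0 h) := by
      refine ⟨companion_zero _ _, fun K hK => ?_, hi⟩
      funext I
      rw [companion_eq_content hh.lace, content_eq_of_le hK (fun k i => hh.eq_zero
        (fun i h => YoungDiagram.rowLen_eq_zero h) k), hnu, Pi.zero_apply, zero_add]
    refine ⟨hchain, ?_, ?_⟩
    · simp only [hcc]; exact hh.lace
    · funext k
      have := companion_eq_content (a := mu.rowLen) hi lam.card k
      rw [hcc, hh.top _ le_rfl] at this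
      rw [this, Pi.add_apply,
        content_eq_of_le (show nu.card ≤ lam.card by omega) (fun k i => hchain.eq_zero hz k)]
  · rintro ⟨g, hg, hi, hla⟩
    exact Subtype.ext (companion_companion hg.bot hg.lace)
  · rintro ⟨h, hh, hnu, hi⟩
    exact Subtype.ext (companion_companion hh.bot hh.lace)

/-- The Littlewood–Richardson rule. -/
theorem isLRCoeff_card {lam mu nu : YoungDiagram} (hc : mu.card + nu.card = lam.card) :
    IsLRCoeff lam mu nu
      (Nat.card {S : SkewSSYT lam mu // S.HasType nu.rowLen ∧ S.IsYamanouchi} : ℚ) := by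
  refine ⟨lrExpansion mu nu, ?_, fun d => ?_⟩
  · rw [lrExpansion_apply, hc, card_companion_chains hc]
    congr 1
    have hz : ∀ i, lam.card ≤ i → nu.rowLen i = 0 := fun i h =>
      YoungDiagram.rowLen_eq_zero (by omega)
    by_cases hle : ∀ k, mu.rowLen k ≤ lam.rowLen k
    · exact (SkewSSYT.card_eq_card_chains hle hz (fun g => Interlaced (companion 0 g))).symm
    -- If μ is not contained in λ, both counts are zero: a chain cannot descend from μ to λ, and the
    -- skew shape has too many cells for the type ν.
    · have h1 : IsEmpty {h // StripChain lam.card mu.rowLen lam.rowLen h ∧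
          content lam.card h = nu.rowLen ∧ Interlaced (companion 0 h)} := by
        refine ⟨fun ⟨h, hh, _⟩ => hle fun k => ?_⟩
        rw [← hh.bot]
        exact hh.le 0 k
      have h2 : IsEmpty {S : SkewSSYT lam mu // S.HasType nu.rowLen ∧ S.IsYamanouchi} := by
        refine ⟨fun ⟨S, hS, _⟩ => hle (rowLen_le_of_card_skewCells hc ?_)⟩
        rw [SkewSSYT.card_skewCells_of_hasType hS hz, YoungDiagram.sum_rowLen (by omega)]
      rw [Nat.card_of_isEmpty, Nat.card_of_isEmpty]
  · change Finsupp.linearCombination ℚ schur d = _ ↔ _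
    rw [← linearCombination_lrExpansion]
    exact linearIndependent_schur.finsuppLinearCombination_injective.eq_iff


/-! ### Verification of programs -/

namespace RAM

/-- Started in memory `m`, the program halts within `T` steps, and the output and the final memory
satisfy `Q`. -/
def Emits (p : Prog) (m : Mem) (T : ℕ) (Q : List (ℕ → ℕ) → Mem → Prop) : Prop :=
  ∃ out t m', Run p m out t m' ∧ t ≤ T ∧ Q out m'

/-- Started in memory `m`, the program halts within `T` steps without output, and the final memory
satisfies `Q`. -/
def Does (p : Prog) (m : Mem) (T : ℕ) (Q : Mem → Prop) : Prop :=
  Emits p m T fun out m' => out = [] ∧ Q m'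

theorem Emits.mono {p : Prog} {m : Mem} {T T' : ℕ} {Q Q' : List (ℕ → ℕ) → Mem → Prop}
    (h : Emits p m T Q) (hT : T ≤ T') (hQ : ∀ o m', Q o m' → Q' o m') : Emits p m T' Q' := by
  obtain ⟨o, t, m', hr, ht, hq⟩ := h
  exact ⟨o, t, m', hr, ht.trans hT, hQ o m' hq⟩

theorem Emits.seq {p q : Prog} {m : Mem} {T₁ T₂ : ℕ} {Q : List (ℕ → ℕ) → Mem → Prop}
    (h : Emits p m T₁ fun o m₁ => Emits q m₁ T₂ fun o' m₂ => Q (o ++ o') m₂) :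
    Emits (.seq p q) m (T₁ + T₂) Q := by
  obtain ⟨o, t, m₁, hr, ht, o', t', m₂, hr', ht', hq⟩ := h
  exact ⟨_, _, _, .seq hr hr', by omega, hq⟩

/-- The bound `T i` may depend on the iteration, so that the costs of nested loops of varying length
are summed and not replaced by a maximum. The condition is evaluated `B + 1` times. -/
theorem Emits.loop {e : Expr} {p : Prog} {m : Mem} {T : ℕ → ℕ} {Q : List (ℕ → ℕ) → Mem → Prop}
    (Inv : ℕ → List (ℕ → ℕ) → Mem → Prop) (B : ℕ) (h0 : Inv 0 [] m)
    (hstep : ∀ i < B, ∀ o m, Inv i o m →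
      e.eval m ≠ 0 ∧ Emits p m (T i) fun o' m' => Inv (i + 1) (o ++ o') m')
    (hend : ∀ o m, Inv B o m → e.eval m = 0 ∧ Q o m) :
    Emits (.loop e p) m (∑ i ∈ Finset.range B, (T i + (1 + e.cost)) + (1 + e.cost)) Q := by
  have key : ∀ d i o m, i + d = B → Inv i o m → Emits (.loop e p) m
      (∑ j ∈ Finset.range d, (T (i + j) + (1 + e.cost)) + (1 + e.cost)) fun o' m' => Q (o ++ o') m' := by
    intro d
    induction d with
    | zero =>
      intro i o m hi h
      obtain rfl : i = B := by omega
      obtain ⟨he, hq⟩ := hend o m h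
      exact ⟨[], _, m, .loop_false he, by simp, by simpa using hq⟩
    | succ d ih =>
      intro i o m hi h
      obtain ⟨he, o₁, t₁, m₁, hr, ht, hinv⟩ := hstep i (by omega) o m h
      obtain ⟨o₂, t₂, m₂, hr', ht', hq⟩ := ih (i + 1) _ _ (by omega) hinv
      refine ⟨_, _, _, .loop_true he hr hr', ?_, by simpa using hq⟩
      rw [Finset.sum_range_succ']
      have e : ∀ j, T (i + (j + 1)) = T (i + 1 + j) := fun j => by rw [add_assoc, add_comm 1 j]
      simp only [add_zero, e]
      omega
  simpa using key B 0 [] m (by omega) h0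

theorem Does.mono {p : Prog} {m : Mem} {T T' : ℕ} {Q Q' : Mem → Prop}
    (h : Does p m T Q) (hT : T ≤ T') (hQ : ∀ m', Q m' → Q' m') : Does p m T' Q' :=
  Emits.mono h hT fun _ m' hq => ⟨hq.1, hQ m' hq.2⟩

theorem Does.seq {p q : Prog} {m : Mem} {T₁ T₂ : ℕ} {Q : Mem → Prop}
    (h : Does p m T₁ fun m₁ => Does q m₁ T₂ Q) : Does (.seq p q) m (T₁ + T₂) Q := by
  refine Emits.seq (Emits.mono h le_rfl ?_)
  rintro o m' ⟨rfl, hq⟩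
  exact hq

theorem Does.seq_emits {p q : Prog} {m : Mem} {T₁ T₂ : ℕ} {Q : List (ℕ → ℕ) → Mem → Prop}
    (h : Does p m T₁ fun m₁ => Emits q m₁ T₂ Q) : Emits (.seq p q) m (T₁ + T₂) Q := by
  refine Emits.seq (Emits.mono h le_rfl ?_)
  rintro o m' ⟨rfl, hq⟩
  exact hq

theorem Does.skip {m : Mem} {Q : Mem → Prop} (h : Q m) : Does .skip m 1 Q :=
  ⟨[], _, _, .skip m, le_rfl, rfl, h⟩

theorem Does.write {a : ℕ} {i e : Expr} {m : Mem} {Q : Mem → Prop}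
    (h : Q (m.set a (i.eval m) (e.eval m))) : Does (.write a i e) m (1 + i.cost + e.cost) Q :=
  ⟨[], _, _, .write m a i e, le_rfl, rfl, h⟩

theorem Does.ite {e : Expr} {p q : Prog} {m : Mem} {T : ℕ} {Q : Mem → Prop}
    (h1 : e.eval m ≠ 0 → Does p m T Q) (h2 : e.eval m = 0 → Does q m T Q) :
    Does (.ite e p q) m (1 + e.cost + T) Q := by
  by_cases he : e.eval m = 0
  · obtain ⟨o, t, m', hr, ht, hq⟩ := h2 he
    exact ⟨o, _, m', .ite_false he hr, by omega, hq⟩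
  · obtain ⟨o, t, m', hr, ht, hq⟩ := h1 he
    exact ⟨o, _, m', .ite_true he hr, by omega, hq⟩

theorem Does.loop {e : Expr} {p : Prog} {m : Mem} {T : ℕ → ℕ} {Q : Mem → Prop}
    (Inv : ℕ → Mem → Prop) (B : ℕ) (h0 : Inv 0 m)
    (hstep : ∀ i < B, ∀ m, Inv i m → e.eval m ≠ 0 ∧ Does p m (T i) (Inv (i + 1)))
    (hend : ∀ m, Inv B m → e.eval m = 0 ∧ Q m) :
    Does (.loop e p) m (∑ i ∈ Finset.range B, (T i + (1 + e.cost)) + (1 + e.cost)) Q := by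
  refine Emits.loop (fun i o m => o = [] ∧ Inv i m) B ⟨rfl, h0⟩ ?_ ?_
  · rintro i hi o m ⟨rfl, h⟩
    exact hstep i hi m h
  · rintro o m ⟨rfl, h⟩
    exact ⟨(hend m h).1, rfl, (hend m h).2⟩

/-- A loop in which all the iterations have the same bound. -/
theorem Does.loop_const {e : Expr} {p : Prog} {m : Mem} {T : ℕ} {Q : Mem → Prop}
    (Inv : ℕ → Mem → Prop) (B : ℕ) (h0 : Inv 0 m)
    (hstep : ∀ i < B, ∀ m, Inv i m → e.eval m ≠ 0 ∧ Does p m T (Inv (i + 1)))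
    (hend : ∀ m, Inv B m → e.eval m = 0 ∧ Q m) :
    Does (.loop e p) m (B * (T + (1 + e.cost)) + (1 + e.cost)) Q := by
  have := Does.loop (T := fun _ => T) Inv B h0 hstep hend
  simpa using this

theorem Mem.set_same (m : Mem) (a i v : ℕ) : (m.set a i v) a i = v := by simp [Mem.set]

theorem Mem.set_idx (m : Mem) (a i v i' : ℕ) :
    (m.set a i v) a i' = if i' = i then v else m a i' := by simp [Mem.set]

theorem Mem.set_ne (m : Mem) {a a' : ℕ} (h : a' ≠ a) (i v : ℕ) : (m.set a i v) a' = m a' := by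
  funext i'; simp [Mem.set, h]

/-- The memories agree outside the arrays in `s`. -/
def Frame (s : Finset ℕ) (m m' : Mem) : Prop := ∀ a, a ∉ s → m' a = m a

theorem Frame.refl (s : Finset ℕ) (m : Mem) : Frame s m m := fun _ _ => rfl

theorem Frame.trans {s : Finset ℕ} {m m' m'' : Mem} (h : Frame s m m') (h' : Frame s m' m'') :
    Frame s m m'' := fun a ha => (h' a ha).trans (h a ha)

theorem Frame.set {s : Finset ℕ} {m m' : Mem} (h : Frame s m m') {a : ℕ} (ha : a ∈ s) (i v : ℕ) :
    Frame s m (m'.set a i v) := fun a' ha' => by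
  rw [Mem.set_ne _ (fun he => ha' (by rwa [he])), h a' ha']

theorem Frame.mono {s s' : Finset ℕ} {m m' : Mem} (h : Frame s m m') (hs : s ⊆ s') : Frame s' m m' :=
  fun a ha => h a fun ha' => ha (hs ha')

/-- The variable that is stored at index `0` of array `a`. -/
abbrev Expr.var (a : ℕ) : Expr := .read a (.const 0)

/-- Assignment to a variable. -/
abbrev Prog.assign (a : ℕ) (e : Expr) : Prog := .write a (.const 0) e

/-- Increment of a variable. -/
abbrev Prog.incr (a : ℕ) : Prog := .assign a (.add (.var a) (.const 1))

/-! ### Replacing the output instruction -/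

/-- A bound for the numbers of the arrays in an expression. -/
def Expr.bound : Expr → ℕ
  | .const _ => 0
  | .read a e => max (a + 1) e.bound
  | .add e₁ e₂ => max e₁.bound e₂.bound
  | .sub e₁ e₂ => max e₁.bound e₂.bound

/-- A bound for the numbers of the arrays in a program. -/
def Prog.bound : Prog → ℕ
  | .skip => 0
  | .write a i e => max (a + 1) (max i.bound e.bound)
  | .emit => 0
  | .seq p q => max p.bound q.bound
  | .ite e p q => max e.bound (max p.bound q.bound)
  | .loop e p => max e.bound p.bound

/-- Replace all the output instructions in a program by the program `c`. -/
def Prog.replaceEmit (p c : Prog) : Prog :=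
  match p with
  | .skip => .skip
  | .write a i e => .write a i e
  | .emit => c
  | .seq p q => .seq (p.replaceEmit c) (q.replaceEmit c)
  | .ite e p q => .ite e (p.replaceEmit c) (q.replaceEmit c)
  | .loop e p => .loop e (p.replaceEmit c)

theorem Expr.eval_congr {m m' : Mem} {F : ℕ} (h : ∀ a < F, m' a = m a) (e : Expr) (he : e.bound ≤ F) :
    e.eval m' = e.eval m := by
  induction e with
  | const k => rfl
  | read a e ih =>
    simp only [Expr.bound, max_le_iff] at he
    rw [Expr.eval, Expr.eval, ih he.2, h a (by omega)]
  | add e₁ e₂ ih₁ ih₂ =>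
    simp only [Expr.bound, max_le_iff] at he
    rw [Expr.eval, Expr.eval, ih₁ he.1, ih₂ he.2]
  | sub e₁ e₂ ih₁ ih₂ =>
    simp only [Expr.bound, max_le_iff] at he
    rw [Expr.eval, Expr.eval, ih₁ he.1, ih₂ he.2]

open Classical in
/-- If the program `c` counts the output arrays with the property `good`, using only arrays `≥ F`, then
a program whose output instructions are replaced by `c` counts its outputs with this property. -/
theorem does_replaceEmit {c : Prog} {F T : ℕ} {good : (ℕ → ℕ) → Prop} {Inv : ℕ → Mem → Prop}
    (hF : outArr < F)
    (hInv : ∀ k m m', Inv k m → (∀ a, F ≤ a → m' a = m a) → Inv k m')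
    (hc : ∀ k m, Inv k m → Does c m T fun m' => (∀ a < F, m' a = m a) ∧
      Inv (k + if good (m outArr) then 1 else 0) m')
    {G : Prog} {m : Mem} {out : List (ℕ → ℕ)} {s : ℕ} {m' : Mem} (hG : Run G m out s m')
    (hb : G.bound ≤ F) (k : ℕ) (n : Mem) (hn : ∀ a < F, n a = m a) (hk : Inv k n) :
    Does (G.replaceEmit c) n (s + out.length * T) fun n' => (∀ a < F, n' a = m' a) ∧
      Inv (k + out.countP good) n' := by
  induction hG generalizing k n with
  | skip m =>
    exact (Does.skip (Q := fun n' => (∀ a < F, n' a = m a) ∧ Inv k n') ⟨hn, hk⟩).mono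
      (by simp) (fun _ h => by simpa using h)
  | write m a i e =>
    simp only [Prog.bound, max_le_iff] at hb
    refine Does.mono (Does.write (Q := fun n' => (∀ a' < F, n' a' = m.set a (i.eval m) (e.eval m) a') ∧
      Inv k n') ⟨?_, ?_⟩) (by simp) (fun _ h => by simpa using h)
    · intro a' ha'
      rw [Expr.eval_congr hn i hb.2.1, Expr.eval_congr hn e hb.2.2]
      funext j
      simp only [Mem.set, hn a' ha']
    · refine hInv k n _ hk fun a' ha' => Mem.set_ne n (by omega) _ _
  -- The only case in which the counter changes. The step of the replaced instruction remains in `s`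
  -- as slack.
  | emit m =>
    refine (hc k n hk).mono (by simp) fun n' h => ⟨fun a ha => (h.1 a ha).trans (hn a ha), ?_⟩
    rw [hn outArr hF] at h
    simpa [List.countP_cons] using h.2
  | @seq p q m₁ m₂ m₃ o₁ o₂ t₁ t₂ _ _ ih₁ ih₂ =>
    simp only [Prog.bound, max_le_iff] at hb
    have h2 := (ih₁ hb.1 k n hn hk).mono le_rfl (fun n' h => ih₂ hb.2 _ n' h.1 h.2)
    refine (Does.seq h2).mono ?_ fun n' h => ⟨h.1, ?_⟩
    · rw [List.length_append, add_mul]; omega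
    · rw [List.countP_append, ← add_assoc]; exact h.2
  | ite_true he _ ih =>
    simp only [Prog.bound, max_le_iff] at hb
    obtain ⟨o, t, n', hr, ht, hq⟩ := ih hb.2.1 k n hn hk
    exact ⟨o, _, n', .ite_true (by rwa [Expr.eval_congr hn _ hb.1]) hr, by omega, hq⟩
  | ite_false he _ ih =>
    simp only [Prog.bound, max_le_iff] at hb
    obtain ⟨o, t, n', hr, ht, hq⟩ := ih hb.2.2 k n hn hk
    exact ⟨o, _, n', .ite_false (by rwa [Expr.eval_congr hn _ hb.1]) hr, by omega, hq⟩
  | @loop_false e p m he =>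
    simp only [Prog.bound, max_le_iff] at hb
    exact ⟨[], _, n, .loop_false (by rwa [Expr.eval_congr hn _ hb.1]), by simp, rfl, hn, by simpa using hk⟩
  | @loop_true e p m₁ m₂ m₃ o₁ o₂ t₁ t₂ he _ _ ih₁ ih₂ =>
    simp only [Prog.bound, max_le_iff] at hb
    obtain ⟨o, t, n₁, hr, ht, rfl, hq⟩ := ih₁ hb.2 k n hn hk
    obtain ⟨o', t', n₂, hr', ht', rfl, hq'⟩ :=
      ih₂ (by simp only [Prog.bound, max_le_iff]; exact hb) _ n₁ hq.1 hq.2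
    refine ⟨_, _, n₂, .loop_true (by rwa [Expr.eval_congr hn _ hb.1]) hr hr', ?_, rfl, hq'.1, ?_⟩
    · rw [List.length_append, add_mul]; omega
    · rw [List.countP_append, ← add_assoc]; exact hq'.2

end RAM


/-! ### The test of the Littlewood–Richardson condition -/

namespace RAM

theorem Expr.eval_var (m : Mem) (a : ℕ) : (Expr.var a).eval m = m a 0 := rfl

theorem Does.assign {a : ℕ} {e : Expr} {m : Mem} {Q : Mem → Prop}
    (h : Q (m.set a 0 (e.eval m))) : Does (.assign a e) m (2 + e.cost) Q :=
  Does.write h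

theorem Does.incr {a : ℕ} {m : Mem} {Q : Mem → Prop}
    (h : Q (m.set a 0 (m a 0 + 1))) : Does (.incr a) m 6 Q :=
  Does.assign h

/-- The total budget is fixed from outside, and what the first program leaves of it is handed to the
second. -/
theorem Does.step {p q : Prog} {m : Mem} {T₁ T : ℕ} {R Q : Mem → Prop} (h : Does p m T₁ R)
    (hT : T₁ ≤ T) (k : ∀ m₁, R m₁ → Does q m₁ (T - T₁) Q) : Does (.seq p q) m T Q :=
  (Does.seq (h.mono le_rfl k)).mono (by omega) fun _ h => h

theorem Does.step_assign {a : ℕ} {e : Expr} {q : Prog} {m : Mem} {T : ℕ} {Q : Mem → Prop}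
    (hT : 2 + e.cost ≤ T) (k : Does q (m.set a 0 (e.eval m)) (T - (2 + e.cost)) Q) :
    Does (.seq (.assign a e) q) m T Q :=
  (Does.seq (Does.assign k)).mono (by omega) fun _ h => h

/-- The number of entries `x` among the first `b` entries of an array. -/
def countBelow (v : ℕ → ℕ) (b x : ℕ) : ℕ := ((Finset.range b).filter fun q => v q = x).card

theorem countBelow_succ (v : ℕ → ℕ) (b x : ℕ) :
    countBelow v (b + 1) x = countBelow v b x + if v b = x then 1 else 0 := by
  rw [countBelow, Finset.range_add_one, Finset.filter_insert]
  split_ifs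
  · rw [Finset.card_insert_of_notMem (by simp)]; rfl
  · rfl

/-- Count the entries equal to `tgt` among the first `b` entries of the array `arr`; the result is left
in `x`, the loop variable is `q`. -/
def countProg (q x tgt arr : ℕ) (b : Expr) : Prog :=
  .seq (.assign x (.const 0)) (.seq (.assign q (.const 0)) (.loop (.sub b (.var q))
    (.seq (.ite (.add (.sub (.read arr (.var q)) (.var tgt)) (.sub (.var tgt) (.read arr (.var q))))
      .skip (.incr x)) (.incr q))))

/-- The tested sum of the two truncated differences vanishes exactly when the entry equals the
target, so the increment stands in the false branch. The bound `b` is evaluated anew in every round,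
hence its stability under changes of `q` and `x` is required. -/
theorem does_countProg {q x tgt arr B : ℕ} {b : Expr} {m : Mem} (hqx : q ≠ x) (hq : tgt ≠ q)
    (hx : tgt ≠ x) (haq : arr ≠ q) (hax : arr ≠ x)
    (hb : ∀ m', Frame {q, x} m m' → b.eval m' = B) :
    Does (countProg q x tgt arr b) m (10 + b.cost + B * (30 + b.cost)) fun m' =>
      Frame {q, x} m m' ∧ m' x 0 = countBelow (m arr) B (m tgt 0) := by
  refine Does.step_assign (by simp only [Expr.cost]; omega)
    (Does.step_assign (by simp only [Expr.cost]; omega) (Does.mono (Does.loop_const (T := 26)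
      (fun i m' => Frame {q, x} m m' ∧ m' q 0 = i ∧
        m' x 0 = countBelow (m arr) i (m tgt 0)) B ⟨?_, ?_, ?_⟩ ?_ ?_) ?_ (fun _ h => h)))
  · exact ((Frame.refl _ _).set (by simp) _ _).set (by simp) _ _
  · rw [Mem.set_same]; rfl
  · rw [Mem.set_ne _ hqx.symm, Mem.set_same]; rfl
  · rintro i hi m' ⟨hf', hqi, hxi⟩
    refine ⟨by rw [Expr.eval, hb m' hf', Expr.eval_var, hqi]; omega, ?_⟩
    have ha : m' arr = m arr := hf' arr (by simp [haq, hax])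
    have ht : m' tgt = m tgt := hf' tgt (by simp [hq, hx])
    refine Does.step (T₁ := 20) (Does.mono (Does.ite (T := 6)
      (Q := fun m'' => Frame {q, x} m m'' ∧ m'' q 0 = i ∧
        m'' x 0 = countBelow (m arr) (i + 1) (m tgt 0)) ?_ ?_) (by simp [Expr.cost])
      (fun _ h => h)) (by omega) ?_
    · intro he
      refine (Does.skip ⟨hf', hqi, ?_⟩).mono (by omega) (fun _ h => h)
      simp only [Expr.eval, hqi, ha, ht] at he
      rw [hxi, countBelow_succ, if_neg (by omega), add_zero]
    · intro he
      refine Does.incr ⟨hf'.set (by simp) _ _, by rw [Mem.set_ne _ hqx, hqi], ?_⟩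
      simp only [Expr.eval, hqi, ha, ht] at he
      rw [Mem.set_same, hxi, countBelow_succ, if_pos (by omega)]
    · rintro m'' ⟨hf'', hq'', hx''⟩
      refine Does.incr ⟨hf''.set (by simp) _ _, by rw [Mem.set_same, hq''], ?_⟩
      rw [Mem.set_ne _ hqx.symm, hx'']
  · rintro m' ⟨hf', hqi, hxi⟩
    exact ⟨by rw [Expr.eval, hb m' hf', Expr.eval_var, hqi, Nat.sub_self], hf', hxi⟩
  · simp only [Expr.cost]; ring_nf; omega

/-- The condition on an output array that is tested: `E i` is the index at which row `i` starts and `R`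
is the number of rows. -/
def GoodArray (E : ℕ → ℕ) (R : ℕ) (v : ℕ → ℕ) : Prop :=
  ∀ i < R, ∀ p, E i ≤ p → p < E (i + 1) → v p ≠ 0 →
    countBelow v (E (i + 1)) (v p) ≤ countBelow v (E i) (v p - 1)

/-- Test the cell with number `p = F + 3` in row `i = F + 2`. The arrays `F`, `F + 1` hold the row ends
and the number of rows; a violation is recorded in the variable `F + 8`. -/
def testCell (F : ℕ) : Prog :=
  .seq (.assign (F + 7) (.sub (.read outArr (.var (F + 3))) (.const 1)))
  (.seq (countProg (F + 4) (F + 5) (F + 7) outArr (.read F (.var (F + 2))))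
  (.seq (.assign (F + 7) (.read outArr (.var (F + 3))))
  (.seq (countProg (F + 4) (F + 6) (F + 7) outArr (.read F (.add (.var (F + 2)) (.const 1))))
  (.seq (.ite (.var (F + 7))
    (.ite (.sub (.var (F + 6)) (.var (F + 5))) (.assign (F + 8) (.const 1)) .skip) .skip)
  (.incr (F + 3))))))

/-- The variables of the test. -/
def testVars (F : ℕ) : Finset ℕ := {F + 2, F + 3, F + 4, F + 5, F + 6, F + 7, F + 8}

theorem does_testCell {F : ℕ} (hF : outArr < F) {m : Mem} {E : ℕ → ℕ} {i n : ℕ}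
    (hE1 : m F i = E i) (hE2 : m F (i + 1) = E (i + 1)) (h1 : E i ≤ n) (h2 : E (i + 1) ≤ n)
    (hi : m (F + 2) 0 = i) :
    Does (testCell F) m (100 * (n + 1)) fun m' =>
      Frame ((testVars F).erase (F + 2)) m m' ∧ m' (F + 3) 0 = m (F + 3) 0 + 1 ∧
      (m' (F + 8) 0 = 0 ↔ m (F + 8) 0 = 0 ∧ (m outArr (m (F + 3) 0) ≠ 0 →
        countBelow (m outArr) (E (i + 1)) (m outArr (m (F + 3) 0)) ≤
          countBelow (m outArr) (E i) (m outArr (m (F + 3) 0) - 1))) := by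
  have ho : ∀ k, outArr ≠ F + k := fun k => by omega
  have ho0 : outArr ≠ F := by omega
  set v := m outArr with hv
  set p := m (F + 3) 0 with hp
  refine Does.step_assign (by simp only [Expr.cost]; omega) ?_
  set m₁ := m.set (F + 7) 0 (Expr.eval m (.sub (.read outArr (.var (F + 3))) (.const 1))) with hm₁
  have f₁ : Frame {F + 4, F + 5, F + 6, F + 7} m m₁ := (Frame.refl _ _).set (by simp) _ _
  have e₁ : ∀ m', Frame {F + 4, F + 5} m₁ m' → (Expr.read F (.var (F + 2))).eval m' = E i := by
    intro m' hf
    have f' : Frame {F + 4, F + 5, F + 6, F + 7} m m' := f₁.trans (hf.mono (by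
      intro a; simp; omega))
    rw [Expr.eval, Expr.eval_var, f' F (by simp), f' (F + 2) (by simp), hi, hE1]
  refine Does.step (does_countProg (by simp) (by simp) (by simp) (ho _) (ho _) e₁)
    (by simp only [Expr.cost]; omega) ?_
  rintro m₂ ⟨f₂, hx₂⟩
  have f₂' : Frame {F + 4, F + 5, F + 6, F + 7} m m₂ := f₁.trans (f₂.mono (by intro a; simp; omega))
  have hx : m₂ (F + 5) 0 = countBelow v (E i) (v p - 1) := by
    rw [hx₂, f₁ outArr (by simp [ho]), hm₁, Mem.set_same]; rfl
  refine Does.step_assign (by simp only [Expr.cost]; omega) ?_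
  set m₃ := m₂.set (F + 7) 0 (Expr.eval m₂ (.read outArr (.var (F + 3)))) with hm₃
  have f₃ : Frame {F + 4, F + 5, F + 6, F + 7} m m₃ := f₂'.set (by simp) _ _
  have t₃ : m₃ (F + 7) 0 = v p := by
    rw [hm₃, Mem.set_same, Expr.eval, Expr.eval_var, f₂' outArr (by simp [ho]), f₂' (F + 3) (by simp)]
  have e₃ : ∀ m', Frame {F + 4, F + 6} m₃ m' →
      (Expr.read F (.add (.var (F + 2)) (.const 1))).eval m' = E (i + 1) := by
    intro m' hf
    have f' : Frame {F + 4, F + 5, F + 6, F + 7} m m' := f₃.trans (hf.mono (by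
      intro a; simp; omega))
    rw [Expr.eval, Expr.eval, Expr.eval_var, f' F (by simp), f' (F + 2) (by simp), hi, ← hE2]
    rfl
  refine Does.step (does_countProg (by simp) (by simp) (by simp) (ho _) (ho _) e₃)
    (by simp only [Expr.cost]; omega) ?_
  rintro m₄ ⟨f₄, hy₄⟩
  have f₄' : Frame {F + 4, F + 5, F + 6, F + 7} m m₄ := f₃.trans (f₄.mono (by intro a; simp; omega))
  have hy : m₄ (F + 6) 0 = countBelow v (E (i + 1)) (v p) := by
    rw [hy₄, f₃ outArr (by simp [ho]), t₃]
  have hx' : m₄ (F + 5) 0 = countBelow v (E i) (v p - 1) := by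
    rw [f₄ _ (by simp), hm₃, Mem.set_ne _ (by simp), hx]
  have ht : m₄ (F + 7) 0 = v p := by rw [f₄ _ (by simp), t₃]
  have h8 : m₄ (F + 8) 0 = m (F + 8) 0 := by rw [f₄' _ (by simp)]
  refine Does.step (T₁ := 13) (R := fun m' => Frame {F + 4, F + 5, F + 6, F + 7, F + 8} m m' ∧
    (m' (F + 8) 0 = 0 ↔ m (F + 8) 0 = 0 ∧ (v p ≠ 0 →
        countBelow v (E (i + 1)) (v p) ≤ countBelow v (E i) (v p - 1)))) ?_
    (by simp only [Expr.cost]; omega) ?_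
  · have f₅ : Frame {F + 4, F + 5, F + 6, F + 7, F + 8} m m₄ := f₄'.mono (by intro a; simp; omega)
    -- The letter `0` has no predecessor: the count made for the truncated value `0 - 1` is ignored
    -- in that case.
    refine (Does.ite (T := 9) (fun h => (Does.ite (T := 3) (fun h' => ?_) fun h' => ?_).mono
      (by simp [Expr.cost]) fun _ h => h) fun h => ?_).mono (by simp [Expr.cost]) fun _ h => h
    · simp only [Expr.eval, ht, hx', hy] at h h'
      refine Does.assign ⟨f₅.set (by simp) _ _, ?_⟩
      rw [Mem.set_same]
      simp only [Expr.eval]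
      omega
    · simp only [Expr.eval, ht, hx', hy] at h h'
      refine (Does.skip ⟨f₅, ?_⟩).mono (by omega) fun _ h => h
      omega
    · simp only [Expr.eval, ht] at h
      refine (Does.skip ⟨f₅, ?_⟩).mono (by omega) fun _ h => h
      omega
  · rintro m₅ ⟨f₅, h₅⟩
    refine (Does.incr ⟨?_, ?_, ?_⟩).mono (by simp only [Expr.cost]; omega) fun _ h => h
    · refine (f₅.mono ?_).set (by simp [testVars]) _ _
      intro a; simp [testVars]; omega
    · rw [Mem.set_same, f₅ _ (by simp)]
    · rw [Mem.set_ne _ (by simp)]; exact h₅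

end RAM


/-! ### Testing a whole output array. -/

namespace RAM

/-- Test the array of outputs; the number of successful tests is counted in the variable `F + 9`. -/
def testArray (F : ℕ) : Prog :=
  .seq (.assign (F + 8) (.const 0)) (.seq (.assign (F + 2) (.const 0))
  (.seq (.loop (.sub (.var (F + 1)) (.var (F + 2)))
    (.seq (.assign (F + 3) (.read F (.var (F + 2))))
    (.seq (.loop (.sub (.read F (.add (.var (F + 2)) (.const 1))) (.var (F + 3))) (testCell F))
    (.incr (F + 2)))))
  (.ite (.var (F + 8)) .skip (.incr (F + 9)))))

/-- The bound is proportional to the number of cells in the row, apart from a constant; this is what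
gives a quadratic total. -/
theorem does_testRow {F : ℕ} (hF : outArr < F) {m : Mem} {E : ℕ → ℕ} {i n : ℕ}
    (hE1 : m F i = E i) (hE2 : m F (i + 1) = E (i + 1)) (h12 : E i ≤ E (i + 1)) (h2 : E (i + 1) ≤ n)
    (hi : m (F + 2) 0 = i) :
    Does (.seq (.assign (F + 3) (.read F (.var (F + 2))))
      (.seq (.loop (.sub (.read F (.add (.var (F + 2)) (.const 1))) (.var (F + 3))) (testCell F))
      (.incr (F + 2)))) m ((E (i + 1) - E i) * (100 * n + 109) + 20) fun m' =>
      Frame (testVars F) m m' ∧ m' (F + 2) 0 = i + 1 ∧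
      (m' (F + 8) 0 = 0 ↔ m (F + 8) 0 = 0 ∧ ∀ p, E i ≤ p → p < E (i + 1) → m outArr p ≠ 0 →
        countBelow (m outArr) (E (i + 1)) (m outArr p) ≤
          countBelow (m outArr) (E i) (m outArr p - 1)) := by
  have ho : ∀ k, outArr ≠ F + k := fun k => by omega
  set v := m outArr with hv
  refine Does.step_assign (by simp only [Expr.cost]; omega) ?_
  set m₁ := m.set (F + 3) 0 (Expr.eval m (.read F (.var (F + 2)))) with hm₁
  have f₁ : Frame ((testVars F).erase (F + 2)) m m₁ := (Frame.refl _ _).set (by simp [testVars]) _ _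
  have hp : m₁ (F + 3) 0 = E i := by rw [hm₁, Mem.set_same, Expr.eval, Expr.eval_var, hi, hE1]
  have h8 : m₁ (F + 8) 0 = m (F + 8) 0 := by rw [hm₁, Mem.set_ne _ (by simp)]
  refine Does.step (Does.loop_const (T := 100 * (n + 1)) (fun j m' =>
    Frame ((testVars F).erase (F + 2)) m m' ∧ m' (F + 3) 0 = E i + j ∧
    (m' (F + 8) 0 = 0 ↔ m (F + 8) 0 = 0 ∧ ∀ p, E i ≤ p → p < E i + j → v p ≠ 0 →
        countBelow v (E (i + 1)) (v p) ≤ countBelow v (E i) (v p - 1)))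
      (E (i + 1) - E i) ⟨f₁, by simpa using hp, ?_⟩ ?_ (Q := fun m' =>
    Frame ((testVars F).erase (F + 2)) m m' ∧
    (m' (F + 8) 0 = 0 ↔ m (F + 8) 0 = 0 ∧ ∀ p, E i ≤ p → p < E (i + 1) → v p ≠ 0 →
        countBelow v (E (i + 1)) (v p) ≤ countBelow v (E i) (v p - 1))) ?_) ?_ ?_
  · rw [h8]
    exact ⟨fun h => ⟨h, fun p h1 h2 => by omega⟩, fun h => h.1⟩
  · rintro j hj m' ⟨f', hp', h8'⟩
    have a0 : m' F = m F := f' F (by simp [testVars])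
    have a2 : m' (F + 2) 0 = i := by rw [f' (F + 2) (by simp), hi]
    have ao : m' outArr = v := f' outArr (by simp [testVars, ho])
    refine ⟨?_, (does_testCell hF (E := E) (i := i) (n := n) (by rw [a0, hE1]) (by rw [a0, hE2])
      (by omega) h2 a2).mono le_rfl ?_⟩
    · simp only [Expr.eval, a0, a2, hp', hE2]; omega
    · rintro m'' ⟨f'', hp'', h8''⟩
      refine ⟨f'.trans f'', by rw [hp'', hp', add_assoc], ?_⟩
      rw [h8'', h8', ao, hp']
      constructor
      · rintro ⟨⟨h1, h2⟩, h3⟩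
        refine ⟨h1, fun p hp1 hp2 => ?_⟩
        rcases Nat.lt_succ_iff_lt_or_eq.mp (show p < (E i + j) + 1 by omega) with h | rfl
        · exact h2 p hp1 h
        · exact h3
      · rintro ⟨h1, h2⟩
        exact ⟨⟨h1, fun p hp1 hp2 => h2 p hp1 (by omega)⟩, h2 _ (by omega) (by omega)⟩
  · rintro m' ⟨f', hp', h8'⟩
    have a0 : m' F = m F := f' F (by simp [testVars])
    have a2 : m' (F + 2) 0 = i := by rw [f' (F + 2) (by simp), hi]
    have he : E i + (E (i + 1) - E i) = E (i + 1) := by omega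
    rw [he] at h8' hp'
    refine ⟨?_, f', h8'⟩
    simp only [Expr.eval, a0, a2, hp', hE2]; omega
  · simp only [Expr.cost]; ring_nf; omega
  · rintro m' ⟨f', h8'⟩
    refine (Does.incr ⟨?_, ?_, ?_⟩).mono (by simp only [Expr.cost]; ring_nf; omega) fun _ h => h
    · exact (f'.mono (Finset.erase_subset _ _)).set (by simp [testVars]) _ _
    · rw [Mem.set_same, f' (F + 2) (by simp), hi]
    · rw [Mem.set_ne _ (by simp)]; exact h8'

open Classical in
theorem does_testArray {F : ℕ} (hF : outArr < F) {m : Mem} {E : ℕ → ℕ} {R n : ℕ}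
    (hE : ∀ i ≤ R, m F i = E i) (hR : m (F + 1) 0 = R) (hmono : Monotone E) (h0 : E 0 = 0)
    (hn : E R ≤ n) (hRn : R ≤ n) :
    Does (testArray F) m (200 * (n + 1) ^ 2) fun m' =>
      Frame (insert (F + 9) (testVars F)) m m' ∧
      m' (F + 9) 0 = m (F + 9) 0 + if GoodArray E R (m outArr) then 1 else 0 := by
  have ho : ∀ k, outArr ≠ F + k := fun k => by omega
  have hT : E R * (100 * n + 109) + R * 26 + 50 ≤ 200 * (n + 1) ^ 2 := by
    have := Nat.mul_le_mul_right (100 * n + 109) hn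
    nlinarith
  refine Does.step_assign (by simp only [Expr.cost]; nlinarith) (Does.step_assign
    (by simp only [Expr.cost]; omega) ?_)
  set m₁ := (m.set (F + 8) 0 (Expr.eval m (.const 0))).set (F + 2) 0
    (Expr.eval (m.set (F + 8) 0 (Expr.eval m (.const 0))) (.const 0)) with hm₁
  have f₁ : Frame (testVars F) m m₁ :=
    ((Frame.refl _ _).set (by simp [testVars]) _ _).set (by simp [testVars]) _ _
  have h8 : m₁ (F + 8) 0 = 0 := by rw [hm₁, Mem.set_ne _ (by simp), Mem.set_same]; rfl
  have h2 : m₁ (F + 2) 0 = 0 := by rw [hm₁, Mem.set_same]; rfl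
  -- The row lengths telescope to the total number of cells. The constant `26` is `20` per row and
  -- `6` for the loop condition.
  have hsum : ∀ R' ≤ R, ∑ i ∈ Finset.range R', ((E (i + 1) - E i) * (100 * n + 109) + 20 +
      (1 + (1 + (1 + 1) + (1 + 1)))) =
      E R' * (100 * n + 109) + R' * 26 := by
    intro R' hR'
    induction R' with
    | zero => simp [h0]
    | succ k ih =>
      rw [Finset.sum_range_succ, ih (by omega)]
      have := hmono (Nat.le_succ k)
      obtain ⟨d, hd⟩ := Nat.exists_eq_add_of_le this
      rw [Nat.succ_eq_add_one] at hd
      rw [hd, Nat.add_sub_cancel_left]; ring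
  refine Does.step (Does.loop (T := fun i => (E (i + 1) - E i) * (100 * n + 109) + 20) (fun i m' =>
    Frame (testVars F) m m' ∧ m' (F + 2) 0 = i ∧
    (m' (F + 8) 0 = 0 ↔ ∀ i' < i, ∀ p, E i' ≤ p → p < E (i' + 1) → m outArr p ≠ 0 →
        countBelow (m outArr) (E (i' + 1)) (m outArr p) ≤
          countBelow (m outArr) (E i') (m outArr p - 1))) R ⟨f₁, h2, by simp [h8]⟩ ?_
    (Q := fun m' => Frame (testVars F) m m' ∧ (m' (F + 8) 0 = 0 ↔ GoodArray E R (m outArr))) ?_)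
    ?_ ?_
  · rintro i hi m' ⟨f', h2', h8'⟩
    have a0 : m' F = m F := f' F (by simp [testVars])
    have a1 : m' (F + 1) 0 = R := by rw [f' (F + 1) (by simp [testVars]), hR]
    have ao : m' outArr = m outArr := f' outArr (by simp [testVars, ho])
    refine ⟨by simp only [Expr.eval, a1, h2']; omega, (does_testRow hF (E := E) (n := n)
      (by rw [a0, hE i hi.le]) (by rw [a0, hE _ hi]) (hmono (Nat.le_succ i))
      ((hmono (show i + 1 ≤ R from hi)).trans hn) h2').mono le_rfl ?_⟩
    rintro m'' ⟨f'', h2'', h8''⟩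
    refine ⟨f'.trans f'', h2'', ?_⟩
    rw [h8'', h8', ao]
    constructor
    · rintro ⟨h3, h4⟩ i' hi'
      rcases Nat.lt_succ_iff_lt_or_eq.mp hi' with h | rfl
      · exact h3 i' h
      · exact h4
    · exact fun h => ⟨fun i' hi' => h i' (by omega), h i (by omega)⟩
  · rintro m' ⟨f', h2', h8'⟩
    have a1 : m' (F + 1) 0 = R := by rw [f' (F + 1) (by simp [testVars]), hR]
    exact ⟨by simp only [Expr.eval, a1, h2', Nat.sub_self], f', h8'⟩
  · have := hsum R le_rfl
    simp only [Expr.cost]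
    omega
  · rintro m' ⟨f', h8'⟩
    have f'' : Frame (insert (F + 9) (testVars F)) m m' := f'.mono (Finset.subset_insert _ _)
    have h9 : m' (F + 9) 0 = m (F + 9) 0 := by rw [f' (F + 9) (by simp [testVars])]
    have := hsum R le_rfl
    refine (Does.ite (T := 6) (fun he => ?_) fun he => ?_).mono (T := 9) ?_ fun _ h => h
    · rw [Expr.eval_var] at he
      refine (Does.skip ⟨f'', ?_⟩).mono (by omega) fun _ h => h
      rw [if_neg (fun h => he (h8'.mpr h)), h9, add_zero]
    · rw [Expr.eval_var] at he
      refine Does.incr ⟨f''.set (by simp) _ _, ?_⟩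
      rw [if_pos (h8'.mp he), Mem.set_same, h9]
    · simp only [Expr.cost]
      omega

/-! ### The row ends -/

/-- Compute the row ends of the skew shape and the number of rows. -/
def rowEndsProg (i E R : ℕ) : Prog :=
  .seq (.assign i (.const 0)) (.seq (.assign E (.const 0))
  (.seq (.loop (.read 0 (.var i)) (.seq (.write E (.add (.var i) (.const 1))
    (.add (.read E (.var i)) (.sub (.read 0 (.var i)) (.read 1 (.var i))))) (.incr i)))
  (.assign R (.var i))))

/-- The index of the first cell of row `i` in the output array. -/
def rowEnds (lam mu : YoungDiagram) (i : ℕ) : ℕ :=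
  ∑ k ∈ Finset.range i, (lam.rowLen k - mu.rowLen k)

theorem rowEnds_succ (lam mu : YoungDiagram) (i : ℕ) :
    rowEnds lam mu (i + 1) = rowEnds lam mu i + (lam.rowLen i - mu.rowLen i) :=
  Finset.sum_range_succ _ _

theorem rowEnds_mono (lam mu : YoungDiagram) : Monotone (rowEnds lam mu) :=
  monotone_nat_of_le_succ fun i => by rw [rowEnds_succ]; omega

theorem colLen_le_card (la : YoungDiagram) : la.colLen 0 ≤ la.card := by
  by_contra h
  push Not at h
  have h1 := YoungDiagram.mem_iff_lt_colLen.mpr h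
  rw [YoungDiagram.mem_iff_lt_rowLen, YoungDiagram.rowLen_eq_zero le_rfl] at h1
  omega

theorem rowLen_ne_zero_iff (la : YoungDiagram) (i : ℕ) : la.rowLen i ≠ 0 ↔ i < la.colLen 0 := by
  rw [← YoungDiagram.mem_iff_lt_colLen, YoungDiagram.mem_iff_lt_rowLen, Nat.pos_iff_ne_zero]

theorem rowEnds_le (lam mu : YoungDiagram) (i : ℕ) : rowEnds lam mu i ≤ lam.card := by
  rw [← YoungDiagram.sum_rowLen (show lam.card ≤ lam.card + i by omega)]
  refine (Finset.sum_le_sum fun k _ => Nat.sub_le _ _).trans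
    (Finset.sum_le_sum_of_subset (Finset.range_mono (by omega)))

/-- The loop stops at the first zero part of λ, whose index is the number of rows. The lower bounds
keep the arrays with λ and μ from being overwritten. -/
theorem does_rowEndsProg {i E R : ℕ} (h0 : 2 ≤ i ∧ 2 ≤ E ∧ 2 ≤ R) (h1 : i ≠ E)
    (h3 : E ≠ R) {m : Mem} {lam mu : YoungDiagram} (hl : m 0 = lam.rowLen) (hm : m 1 = mu.rowLen) :
    Does (rowEndsProg i E R) m (40 * (lam.card + 1)) fun m' =>
      Frame {i, E, R} m m' ∧ (∀ j ≤ lam.colLen 0, m' E j = rowEnds lam mu j) ∧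
      m' R 0 = lam.colLen 0 := by
  have hc := colLen_le_card lam
  refine Does.step_assign (by simp only [Expr.cost]; omega) (Does.step_assign
    (by simp only [Expr.cost]; omega) (Does.step (Does.loop_const (T := 23) (fun k m' =>
      Frame {i, E, R} m m' ∧ m' i 0 = k ∧ ∀ j ≤ k, m' E j = rowEnds lam mu j) (lam.colLen 0)
      ⟨?_, ?_, ?_⟩ ?_ (Q := fun m' => Frame {i, E, R} m m' ∧ m' i 0 = lam.colLen 0 ∧
        ∀ j ≤ lam.colLen 0, m' E j = rowEnds lam mu j) ?_) ?_ ?_))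
  · exact ((Frame.refl _ _).set (by simp) _ _).set (by simp) _ _
  · rw [Mem.set_ne _ h1, Mem.set_same]; rfl
  · intro j hj
    obtain rfl : j = 0 := by omega
    rw [Mem.set_same]; rfl
  · rintro k hk m' ⟨f', hi', hE'⟩
    have a0 : m' 0 = lam.rowLen := by rw [f' 0 (by simp; omega), hl]
    have a1 : m' 1 = mu.rowLen := by rw [f' 1 (by simp; omega), hm]
    refine ⟨?_, Does.step (Does.write (Q := fun m'' => Frame {i, E, R} m m'' ∧ m'' i 0 = k ∧
      ∀ j ≤ k + 1, m'' E j = rowEnds lam mu j) ⟨f'.set (by simp) _ _, ?_, ?_⟩)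
      (by simp only [Expr.cost]; omega) ?_⟩
    · rw [Expr.eval, Expr.eval_var, a0, hi']; exact (rowLen_ne_zero_iff lam k).mpr hk
    · rw [Mem.set_ne _ h1, hi']
    · intro j hj
      simp only [Expr.eval, hi', a0, a1, hE' k le_rfl, ← rowEnds_succ]
      rw [Mem.set_idx]
      split_ifs with he
      · rw [he]
      · exact hE' j (by omega)
    · rintro m'' ⟨f'', hi'', hE''⟩
      refine (Does.incr ⟨f''.set (by simp) _ _, ?_, ?_⟩).mono (by simp only [Expr.cost]; omega)
        fun _ h => h
      · rw [Mem.set_same, hi'']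
      · rw [Mem.set_ne _ h1.symm]; exact hE''
  · rintro m' ⟨f', hi', hE'⟩
    have a0 : m' 0 = lam.rowLen := by rw [f' 0 (by simp; omega), hl]
    refine ⟨?_, f', hi', hE'⟩
    rw [Expr.eval, Expr.eval_var, a0, hi']
    by_contra h
    exact lt_irrefl _ ((rowLen_ne_zero_iff lam _).mp h)
  · simp only [Expr.cost]; omega
  · rintro m' ⟨f', hi', hE'⟩
    refine (Does.assign ⟨f'.set (by simp) _ _, ?_, ?_⟩).mono (by simp only [Expr.cost]; omega)
      fun _ h => h
    · rw [Mem.set_ne _ h3]; exact hE'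
    · rw [Mem.set_same, Expr.eval_var, hi']

end RAM


/-! ### Counting the outputs of a generating program -/

namespace RAM

variable {lam mu nu : YoungDiagram}

/-- The first `rowEnds lam mu K` entries of the array are exactly the rows `< K`, so counting in an
initial segment evaluates the companion. -/
theorem countBelow_rowEnds {v : ℕ → ℕ} {T : SkewSSYT lam mu} (h : Represents v T) (K I : ℕ) :
    countBelow v (rowEnds lam mu K) I = companion 0 T.toChain K I := by
  induction K with
  | zero => simp [rowEnds, countBelow, companion]
  | succ K ih =>
    rw [companion_succ, ← ih, T.toChain_succ, Nat.add_sub_cancel_left, rowEnds_succ]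
    simp only [countBelow, Finset.card_filter]
    rw [Finset.sum_range_add, Finset.sum_Ico_eq_sum_range]
    congr 1
    refine Finset.sum_congr rfl fun j hj => ?_
    rw [Finset.mem_range] at hj
    have := h K (mu.rowLen K + j) (mem_skewCells.mpr ⟨by omega, by omega⟩)
    rw [Nat.add_sub_cancel_left] at this
    rw [← this]; rfl

theorem countBelow_mono (v : ℕ → ℕ) {b b' : ℕ} (h : b ≤ b') (x : ℕ) :
    countBelow v b x ≤ countBelow v b' x :=
  Finset.card_le_card (Finset.filter_subset_filter _ (Finset.range_mono h))

theorem countBelow_eq_of_forall_ne (v : ℕ → ℕ) {b b' x : ℕ} (h : b ≤ b')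
    (hne : ∀ p, b ≤ p → p < b' → v p ≠ x) : countBelow v b' x = countBelow v b x := by
  refine congrArg Finset.card (Finset.ext fun p => ?_)
  simp only [Finset.mem_filter, Finset.mem_range]
  refine ⟨fun ⟨h1, h2⟩ => ⟨?_, h2⟩, fun ⟨h1, h2⟩ => ⟨by omega, h2⟩⟩
  by_contra hp
  exact hne p (by omega) h1 h2

/-- It suffices to test the letters that occur in a row. For an absent letter the left side has not
changed since the previous row and the right side can only have grown; before the first row the left
side is zero. -/
theorem goodArray_iff {v : ℕ → ℕ} {T : SkewSSYT lam mu} (h : Represents v T) :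
    GoodArray (rowEnds lam mu) (lam.colLen 0) v ↔ T.IsYamanouchi := by
  rw [SkewSSYT.IsYamanouchi, interlaced_companion_iff]
  simp only [Fails, not_lt, ← countBelow_rowEnds h]
  constructor
  · intro hg K I
    induction K with
    | zero =>
      by_cases hp : ∃ p, rowEnds lam mu 0 ≤ p ∧ p < rowEnds lam mu (0 + 1) ∧ v p = I + 1
      · obtain ⟨p, h1, h2, h3⟩ := hp
        have hK : 0 < lam.colLen 0 := by
          rw [← rowLen_ne_zero_iff]
          rw [rowEnds_succ] at h2; omega
        have := hg 0 hK p h1 h2 (by omega)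
        rwa [h3, Nat.add_sub_cancel] at this
      · push Not at hp
        rw [countBelow_eq_of_forall_ne v (rowEnds_mono lam mu (Nat.le_succ 0)) hp]
        simp [countBelow, rowEnds]
    | succ K ih =>
      by_cases hp : ∃ p, rowEnds lam mu (K + 1) ≤ p ∧ p < rowEnds lam mu (K + 1 + 1) ∧ v p = I + 1
      · obtain ⟨p, h1, h2, h3⟩ := hp
        have hK : K + 1 < lam.colLen 0 := by
          rw [← rowLen_ne_zero_iff]
          rw [rowEnds_succ] at h2; omega
        have := hg (K + 1) hK p h1 h2 (by omega)
        rwa [h3, Nat.add_sub_cancel] at this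
      · push Not at hp
        rw [countBelow_eq_of_forall_ne v (rowEnds_mono lam mu (Nat.le_succ (K + 1))) hp]
        exact ih.trans (countBelow_mono v (rowEnds_mono lam mu (Nat.le_succ K)) I)
  · intro hi K _ p _ _ hp
    have := hi K (v p - 1)
    rwa [Nat.sub_add_cancel (Nat.one_le_iff_ne_zero.mpr hp)] at this

open Classical in
theorem countP_goodArray {out : List (ℕ → ℕ)} {L : List (SkewSSYTOfType lam mu nu)}
    (hn : L.Nodup) (hall : ∀ T, T ∈ L) (hr : List.Forall₂ (fun v T => Represents v T.1) out L) :
    out.countP (GoodArray (rowEnds lam mu) (lam.colLen 0)) =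
      Nat.card {S : SkewSSYT lam mu // S.HasType nu.rowLen ∧ S.IsYamanouchi} := by
  have h1 : out.countP (GoodArray (rowEnds lam mu) (lam.colLen 0)) =
      L.countP (fun T => T.1.IsYamanouchi) := by
    clear hn hall
    induction hr with
    | nil => rfl
    | cons hv _ ih =>
      rw [List.countP_cons, List.countP_cons, ih]
      simp only [goodArray_iff hv]
  have h2 : {S : SkewSSYT lam mu // S.HasType nu.rowLen ∧ S.IsYamanouchi} ≃
      {T : SkewSSYTOfType lam mu nu // T ∈ (L.filter fun T => T.1.IsYamanouchi).toFinset} :=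
    (Equiv.subtypeSubtypeEquivSubtypeInter _ _).symm.trans
      (Equiv.subtypeEquivRight fun T => by simp [hall])
  rw [h1, Nat.card_congr h2, Nat.card_eq_finsetCard, List.toFinset_card_of_nodup (hn.filter _),
    List.countP_eq_length_filter]

/-- The program that runs `G` and counts the outputs that satisfy the Littlewood–Richardson
condition. -/
def countOutputs (G : Prog) : Prog :=
  let F := max G.bound 4
  .seq (rowEndsProg (F + 2) F (F + 1)) (.seq (G.replaceEmit (testArray F))
    (.write outArr (.const 0) (.var (F + 9))))

/-- The number of outputs and the running time of `G` enter separately: (2) needs a bound in which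
only the number of outputs is multiplied by n². -/
theorem computesLR_countOutputs {G : Prog} (hc : mu.card + nu.card = lam.card)
    {out : List (ℕ → ℕ)} {s : ℕ} {m : Mem} {L : List (SkewSSYTOfType lam mu nu)}
    (hG : Run G (input lam mu nu) out s m) (hn : L.Nodup) (hall : ∀ T, T ∈ L)
    (hr : List.Forall₂ (fun v T => Represents v T.1) out L) :
    ComputesLR (countOutputs G) lam mu nu
      (40 * (lam.card + 1) + (s + out.length * (200 * (lam.card + 1) ^ 2)) + 4) := by
  classical
  unfold countOutputs
  have hbF : G.bound ≤ max G.bound 4 := le_max_left _ _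
  have hF4 : 4 ≤ max G.bound 4 := le_max_right _ _
  generalize max G.bound 4 = F at hbF hF4
  have hoF : outArr < F := by unfold outArr; omega
  have key : Does (.seq (rowEndsProg (F + 2) F (F + 1)) (.seq (G.replaceEmit (testArray F))
      (.write outArr (.const 0) (.var (F + 9))))) (input lam mu nu)
      (40 * (lam.card + 1) + (s + out.length * (200 * (lam.card + 1) ^ 2)) + 4) fun m' =>
      m' outArr 0 = out.countP (GoodArray (rowEnds lam mu) (lam.colLen 0)) := by
    refine Does.step (does_rowEndsProg (lam := lam) (mu := mu) (by omega) (by omega) (by omega)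
      (by simp [input]) (by simp [input])) (by omega) ?_
    rintro m₁ ⟨f₁, hE, hR⟩
    have h9 : m₁ (F + 9) 0 = 0 := by
      rw [f₁ (F + 9) (by simp)]
      simp [input]
    refine Does.step (does_replaceEmit (T := 200 * (lam.card + 1) ^ 2)
      (good := GoodArray (rowEnds lam mu) (lam.colLen 0)) (Inv := fun k m' =>
        (∀ j ≤ lam.colLen 0, m' F j = rowEnds lam mu j) ∧ m' (F + 1) 0 = lam.colLen 0 ∧
        m' (F + 9) 0 = k) hoF ?_ ?_ hG hbF 0 m₁ ?_ ⟨hE, hR, h9⟩) (by omega) ?_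
    · rintro k m m' ⟨h1, h2, h3⟩ he
      rw [he F le_rfl, he (F + 1) (by omega), he (F + 9) (by omega)]
      exact ⟨h1, h2, h3⟩
    · rintro k m ⟨h1, h2, h3⟩
      refine (does_testArray hoF h1 h2 (rowEnds_mono lam mu) rfl (rowEnds_le lam mu _)
        (colLen_le_card lam)).mono le_rfl ?_
      rintro m' ⟨f', h'⟩
      refine ⟨fun a ha => f' a (by simp [testVars]; omega), ?_, ?_, ?_⟩
      · rw [f' F (by simp [testVars])]; exact h1
      · rw [f' (F + 1) (by simp [testVars])]; exact h2
      · rw [h', h3]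
    · intro a ha
      exact f₁ a (by simp; omega)
    · rintro m₂ ⟨-, -, -, h⟩
      refine (Does.write ?_).mono (by simp only [Expr.cost]; omega) fun _ h => h
      rw [Expr.eval, Mem.set_same, Expr.eval_var, h, zero_add]
  obtain ⟨o, t, m', hrun, ht, -, hm'⟩ := key
  refine ⟨o, t, m', hrun, ht, ?_⟩
  rw [hm', countP_goodArray hn hall hr]
  exact isLRCoeff_card hc

/-- Every output costs a step. That a run takes at least one step allows the O(n) preprocessing to
be absorbed into t n². -/
theorem Run.length_lt {p : Prog} {m m' : Mem} {out : List (ℕ → ℕ)} {t : ℕ} (h : Run p m out t m') :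
    out.length ≤ t ∧ 1 ≤ t := by
  induction h with
  | loop_true _ _ _ ih₁ ih₂ => rw [List.length_append]; omega
  | seq _ _ ih₁ ih₂ => rw [List.length_append]; omega
  | ite_true _ _ ih => omega
  | ite_false _ _ ih => omega
  | skip | emit => simp
  | write | loop_false => rw [List.length_nil]; omega

theorem computesLR_of_generatesSSYT {G : Prog} {t : ℕ} (hpos : 0 < lam.card)
    (hc : mu.card + nu.card = lam.card) (h : GeneratesSSYT G lam mu nu t) :
    ComputesLR (countOutputs G) lam mu nu (1000 * (t * lam.card ^ 2)) := by
  obtain ⟨out, s, m, L, hG, hs, hn, hall, hr⟩ := h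
  obtain ⟨o, s', m', h1, h2, h3⟩ := computesLR_countOutputs hc hG hn hall hr
  refine ⟨o, s', m', h1, h2.trans ?_, h3⟩
  obtain ⟨h4, h5⟩ := hG.length_lt
  generalize lam.card = n at *
  have h6 : (n + 1) ^ 2 ≤ 4 * n ^ 2 := by nlinarith
  have h7 : out.length * (200 * (n + 1) ^ 2) ≤ t * (200 * (4 * n ^ 2)) :=
    Nat.mul_le_mul (h4.trans hs) (by omega)
  have h8 : t * 1 ≤ t * n ^ 2 := Nat.mul_le_mul_left t (Nat.one_le_pow _ _ hpos)
  have h9 : 1 * (n + 1) ^ 2 ≤ t * (n + 1) ^ 2 := Nat.mul_le_mul_right _ (h5.trans hs)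
  have h10 : t * (n + 1) ^ 2 ≤ t * (4 * n ^ 2) := Nat.mul_le_mul_left t h6
  nlinarith

end RAM


/-! ### Tableaux as words of rows -/

namespace RAM

variable {lam mu nu : YoungDiagram}

/-- The end of row `i` after the cells number `0, …, q - 1` have been added to the rows
`w 0, …, w (q - 1)` of `mu`. -/
def rowFill (mu : YoungDiagram) (w : ℕ → ℕ) (q i : ℕ) : ℕ := mu.rowLen i + countBelow w q i

/-- Cell number `q`, with the letter `V q`, can be added to row `r`. -/
structure CanAdd (lam mu : YoungDiagram) (V w : ℕ → ℕ) (q r : ℕ) : Prop where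
  lt : rowFill mu w q r < lam.rowLen r
  prev : ∀ r', r = r' + 1 → rowFill mu w q r < rowFill mu w q r'
  letter : ∀ q', q = q' + 1 → V q' = V q → r ≤ w q'

/-- The word `w 0, …, w (e - 1)` of rows describes a partial tableau with the letters
`V 0, …, V (e - 1)`. -/
structure IsWord (lam mu : YoungDiagram) (V : ℕ → ℕ) (e : ℕ) (w : ℕ → ℕ) : Prop where
  step : ∀ q < e, CanAdd lam mu V w q (w q)
  zero : ∀ q, e ≤ q → w q = 0

theorem countBelow_congr {v v' : ℕ → ℕ} {b : ℕ} (h : ∀ q < b, v q = v' q) (x : ℕ) :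
    countBelow v b x = countBelow v' b x := by
  refine congrArg Finset.card (Finset.filter_congr fun q hq => ?_)
  rw [h q (Finset.mem_range.mp hq)]

theorem rowFill_congr {w w' : ℕ → ℕ} {q : ℕ} (h : ∀ q' < q, w q' = w' q') (i : ℕ) :
    rowFill mu w q i = rowFill mu w' q i := by
  rw [rowFill, rowFill, countBelow_congr h]

theorem rowFill_zero (w : ℕ → ℕ) (i : ℕ) : rowFill mu w 0 i = mu.rowLen i := by
  simp [rowFill, countBelow]

theorem rowFill_succ (w : ℕ → ℕ) (q i : ℕ) :
    rowFill mu w (q + 1) i = rowFill mu w q i + if w q = i then 1 else 0 := by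
  rw [rowFill, rowFill, countBelow_succ, add_assoc]

theorem rowFill_mono (w : ℕ → ℕ) {q q' : ℕ} (h : q ≤ q') (i : ℕ) :
    rowFill mu w q i ≤ rowFill mu w q' i :=
  Nat.add_le_add_left (countBelow_mono w h i) _

theorem CanAdd.congr {V w w' : ℕ → ℕ} {q r : ℕ} (h : ∀ q' < q, w q' = w' q')
    (hc : CanAdd lam mu V w q r) : CanAdd lam mu V w' q r := by
  refine ⟨?_, fun r' hr => ?_, fun q' hq hV => ?_⟩
  · rw [← rowFill_congr h]; exact hc.lt
  · rw [← rowFill_congr h, ← rowFill_congr h]; exact hc.prev r' hr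
  · rw [← h q' (by omega)]; exact hc.letter q' hq hV

theorem IsWord.update {V w : ℕ → ℕ} {e r : ℕ} (h : IsWord lam mu V e w)
    (hc : CanAdd lam mu V w e r) : IsWord lam mu V (e + 1) (Function.update w e r) := by
  have hag : ∀ q < e, w q = Function.update w e r q := fun q hq => by
    rw [Function.update_of_ne (by omega)]
  refine ⟨fun q hq => ?_, fun q hq => ?_⟩
  · rcases Nat.lt_succ_iff_lt_or_eq.mp hq with hq | rfl
    · rw [← hag q hq]
      exact (h.step q hq).congr fun q' hq' => hag q' (by omega)
    · rw [Function.update_self]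
      exact hc.congr hag
  · rw [Function.update_of_ne (by omega), h.zero q (by omega)]

theorem IsWord.truncate {V w : ℕ → ℕ} {e : ℕ} (h : IsWord lam mu V (e + 1) w) :
    IsWord lam mu V e (Function.update w e 0) := by
  have hag : ∀ q < e, w q = Function.update w e 0 q := fun q hq => by
    rw [Function.update_of_ne (by omega)]
  refine ⟨fun q hq => ?_, fun q hq => ?_⟩
  · rw [← hag q hq]
    exact (h.step q (by omega)).congr fun q' hq' => hag q' (by omega)
  · rcases eq_or_ne q e with rfl | hne
    · rw [Function.update_self]
    · rw [Function.update_of_ne hne, h.zero q (by omega)]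

theorem rowFill_le {V w : ℕ → ℕ} {e q : ℕ} (hle : ∀ k, mu.rowLen k ≤ lam.rowLen k)
    (h : ∀ q < e, CanAdd lam mu V w q (w q)) (hq : q ≤ e) (i : ℕ) :
    rowFill mu w q i ≤ lam.rowLen i := by
  induction q with
  | zero => rw [rowFill_zero]; exact hle i
  | succ q ih =>
    rw [rowFill_succ]
    split_ifs with hi
    · have := (h q hq).lt
      rw [hi] at this
      omega
    · exact ih (by omega)

theorem rowFill_anti {V w : ℕ → ℕ} {e q : ℕ} (h : ∀ q < e, CanAdd lam mu V w q (w q)) (hq : q ≤ e)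
    (i : ℕ) : rowFill mu w q (i + 1) ≤ rowFill mu w q i := by
  induction q with
  | zero => rw [rowFill_zero, rowFill_zero]; exact mu.rowLen_anti _ _ (Nat.le_succ i)
  | succ q ih =>
    have h1 := ih (by omega)
    rw [rowFill_succ, rowFill_succ]
    by_cases hi : w q = i + 1
    · have := (h q hq).prev i hi
      rw [hi] at this
      rw [if_pos hi]
      omega
    · rw [if_neg hi]; omega

theorem sum_rowFill {V w : ℕ → ℕ} {e q : ℕ} (hc : mu.card ≤ lam.card)
    (h : ∀ q < e, CanAdd lam mu V w q (w q)) (hq : q ≤ e) :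
    ∑ i ∈ Finset.range lam.card, rowFill mu w q i = mu.card + q := by
  induction q with
  | zero => simp only [rowFill_zero, YoungDiagram.sum_rowLen hc, add_zero]
  | succ q ih =>
    simp only [rowFill_succ, Finset.sum_add_distrib]
    rw [ih (by omega), Finset.sum_ite_eq, if_pos, add_assoc]
    rw [Finset.mem_range]
    by_contra hlt
    have := (h q hq).lt
    rw [YoungDiagram.rowLen_eq_zero (by omega)] at this
    omega

/-- `c I` is the number of the letters `V 0, …, V (N - 1)` that are less than `I`. -/
structure LetterCount (N : ℕ) (V c : ℕ → ℕ) : Prop where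
  lt_iff : ∀ q < N, ∀ I, V q < I ↔ q < c I
  le : ∀ I, c I ≤ N

variable {N : ℕ} {V c : ℕ → ℕ}

theorem LetterCount.zero (h : LetterCount N V c) : c 0 = 0 := by
  by_contra hne
  have := h.le 0
  exact absurd ((h.lt_iff 0 (by omega) 0).mpr (by omega)) (Nat.not_lt_zero _)

theorem LetterCount.mono (h : LetterCount N V c) : Monotone c := by
  intro I J hIJ
  by_contra hlt
  push Not at hlt
  have h1 := h.le I
  have h2 := (h.lt_iff (c J) (by omega) I).mpr hlt
  have h3 := (h.lt_iff (c J) (by omega) J).mp (by omega)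
  omega

theorem LetterCount.eq_iff (h : LetterCount N V c) {q : ℕ} (hq : q < N) (I : ℕ) :
    V q = I ↔ c I ≤ q ∧ q < c (I + 1) := by
  have h1 := h.lt_iff q hq I
  have h2 := h.lt_iff q hq (I + 1)
  omega

theorem exists_letterCount_eq (h : LetterCount N V c) : ∃ K, ∀ I, K ≤ I → c I = N := by
  refine ⟨∑ q ∈ Finset.range N, (V q + 1), fun I hI => ?_⟩
  by_contra hne
  have h1 := h.le I
  have h2 := Finset.single_le_sum (f := fun q => V q + 1) (fun _ _ => Nat.zero_le _)
    (Finset.mem_range.mpr (show c I < N by omega))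
  have h3 := (h.lt_iff (c I) (by omega) I).mp (by omega)
  omega

/-- The chain of a word. -/
theorem interlaced_rowFill {w : ℕ → ℕ} (hV : LetterCount N V c)
    (h : ∀ q < N, CanAdd lam mu V w q (w q)) : Interlaced fun I k => rowFill mu w (c I) k := by
  intro I k
  refine ⟨rowFill_mono w (hV.mono (Nat.le_succ I)) k, ?_⟩
  -- Equal letters are inserted from the lower rows to the upper ones, that is, from left to right
  -- in their horizontal strip.
  have hblock : ∀ d q, c I ≤ q → q + d < c (I + 1) → w (q + d) ≤ w q := by
    intro d
    induction d with
    | zero => intro q _ _; exact le_rfl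
    | succ d ih =>
      intro q h1 h2
      have h3 := hV.le (I + 1)
      refine le_trans ?_ (ih q h1 (by omega))
      refine (h (q + (d + 1)) (by omega)).letter (q + d) (by omega) ?_
      rw [(hV.eq_iff (show q + d < N by omega) I).mpr (by omega),
        (hV.eq_iff (show q + (d + 1) < N by omega) I).mpr (by omega)]
  -- When a letter `I` goes to row `k + 1`, none has gone to row `k` yet. So the insertion condition
  -- compares with the length of row `k` at the start of the block.
  have key : ∀ d, c I + d ≤ c (I + 1) → rowFill mu w (c I + d) (k + 1) ≤ rowFill mu w (c I) k := by
    intro d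
    induction d with
    | zero => intro _; exact rowFill_anti h (hV.le I) k
    | succ d ih =>
      intro hd
      have h3 := hV.le (I + 1)
      have h1 := ih (by omega)
      rw [← add_assoc, rowFill_succ]
      split_ifs with hw
      · have h2 := (h (c I + d) (by omega)).prev k hw
        rw [hw] at h2
        have h4 : rowFill mu w (c I + d) k = rowFill mu w (c I) k := by
          rw [rowFill, rowFill, countBelow_eq_of_forall_ne w (show c I ≤ c I + d by omega)]
          intro p hp1 hp2 hp3
          have := hblock (c I + d - p) p hp1 (by omega)
          rw [show p + (c I + d - p) = c I + d by omega] at this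
          omega
        omega
      · exact h1
  have := key (c (I + 1) - c I) (by have := hV.mono (Nat.le_succ I); simp only [Nat.succ_eq_add_one] at this; omega)
  rwa [show c I + (c (I + 1) - c I) = c (I + 1) by
    have := hV.mono (Nat.le_succ I); simp only [Nat.succ_eq_add_one] at this; omega] at this

theorem exists_stripChain_rowFill {w : ℕ → ℕ} (hle : ∀ k, mu.rowLen k ≤ lam.rowLen k)
    (hN : mu.card + N = lam.card) (hV : LetterCount N V c)
    (h : ∀ q < N, CanAdd lam mu V w q (w q)) :
    ∃ K, StripChain K mu.rowLen lam.rowLen fun I k => rowFill mu w (c I) k := by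
  obtain ⟨K, hK⟩ := exists_letterCount_eq hV
  refine ⟨K, ?_, fun I hI => ?_, interlaced_rowFill hV h⟩
  · funext k; simp only [hV.zero, rowFill_zero]
  · funext k
    simp only [hK I hI]
    -- After all `N` insertions each row is at most that of λ, and the sizes agree, so the rows are
    -- equal.
    have h1 := sum_rowFill (lam := lam) (by omega) h le_rfl
    have h2 := (Finset.sum_eq_sum_iff_of_le (s := Finset.range lam.card)
      (fun i _ => rowFill_le hle h le_rfl i)).mp (by
        rw [h1, YoungDiagram.sum_rowLen le_rfl, hN])
    by_cases hk : k < lam.card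
    · exact h2 k (Finset.mem_range.mpr hk)
    · have h3 := rowFill_le hle h le_rfl k
      have h4 := YoungDiagram.rowLen_eq_zero (la := lam) (i := k) (by omega)
      omega

theorem exists_tableau_of_word {w : ℕ → ℕ} (hle : ∀ k, mu.rowLen k ≤ lam.rowLen k)
    (hN : mu.card + N = lam.card) (hV : LetterCount N V c) (h : IsWord lam mu V N w) :
    ∃ S : SkewSSYT lam mu, S.toChain = fun I k => rowFill mu w (c I) k := by
  obtain ⟨K, hK⟩ := exists_stripChain_rowFill hle hN hV h.step
  exact SkewSSYT.exists_toChain_eq hK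

theorem hasType_of_toChain_eq {w : ℕ → ℕ} (hN : mu.card + N = lam.card) (hV : LetterCount N V c)
    (h : IsWord lam mu V N w) {S : SkewSSYT lam mu}
    (hS : S.toChain = fun I k => rowFill mu w (c I) k) : S.HasType fun I => c (I + 1) - c I := by
  intro I
  rw [S.entryCount_eq le_rfl, hS, content, rowSum, rowSum, sum_rowFill (by omega) h.step (hV.le _),
    sum_rowFill (by omega) h.step (hV.le _)]
  change _ = c (I + 1) - c I
  omega

/-- At the first difference one word uses a larger row index. The other can no longer return to that
row while the same letter is inserted, so the shapes differ at the end of this block. -/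
theorem word_injective {w w' : ℕ → ℕ} (hV : LetterCount N V c) (h : IsWord lam mu V N w)
    (h' : IsWord lam mu V N w')
    (he : ∀ I k, rowFill mu w (c I) k = rowFill mu w' (c I) k) : w = w' := by
  have key : ∀ w w' : ℕ → ℕ, IsWord lam mu V N w →
      (∀ I k, rowFill mu w (c I) k = rowFill mu w' (c I) k) → ∀ q < N,
      (∀ q' < q, w q' = w' q') → ¬ w q < w' q := by
    intro w w' h he q hq hag hlt
    have hVq := (hV.eq_iff hq (V q)).mp rfl
    have hNI := hV.le (V q + 1)
    have hblock : ∀ d, q + d < c (V q + 1) → w (q + d) ≤ w q := by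
      intro d
      induction d with
      | zero => intro _; exact le_rfl
      | succ d ih =>
        intro h2
        refine le_trans ?_ (ih (by omega))
        refine (h.step (q + (d + 1)) (by omega)).letter (q + d) (by omega) ?_
        rw [(hV.eq_iff (show q + d < N by omega) (V q)).mpr (by omega),
          (hV.eq_iff (show q + (d + 1) < N by omega) (V q)).mpr (by omega)]
    have h1 : rowFill mu w (c (V q + 1)) (w' q) = rowFill mu w q (w' q) := by
      rw [rowFill, rowFill, countBelow_eq_of_forall_ne w hVq.2.le]
      intro p hp1 hp2 hp3
      have := hblock (p - q) (by omega)
      rw [show q + (p - q) = p by omega] at this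
      omega
    have h2 := rowFill_mono (mu := mu) w' (show q + 1 ≤ c (V q + 1) from hVq.2) (w' q)
    rw [rowFill_succ, if_pos rfl, ← rowFill_congr hag, ← he, h1] at h2
    omega
  funext q
  induction q using Nat.strong_induction_on with
  | _ q ih =>
    by_cases hq : q < N
    · have h1 := key w w' h he q hq ih
      have h2 := key w' w h' (fun I k => (he I k).symm) q hq (fun q' hq' => (ih q' hq').symm)
      omega
    · rw [h.zero q (by omega), h'.zero q (by omega)]

theorem exists_max_lt {f g : ℕ → ℕ} {M : ℕ} (hM : ∀ k, M ≤ k → g k = 0)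
    (h : ∑ k ∈ Finset.range M, f k < ∑ k ∈ Finset.range M, g k) :
    ∃ k, f k < g k ∧ ∀ l, k < l → g l ≤ f l := by
  classical
  obtain ⟨k, hk, hlt⟩ := Finset.exists_lt_of_sum_lt h
  have hkM := Finset.mem_range.mp hk
  refine ⟨Nat.findGreatest (fun k => f k < g k) M,
    Nat.findGreatest_spec (P := fun k => f k < g k) hkM.le hlt, fun l hl => ?_⟩
  by_contra hn
  push Not at hn
  by_cases hlM : l ≤ M
  · exact Nat.findGreatest_is_greatest hl hlM hn
  · rw [hM l (by omega)] at hn; omega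

/-- Every tableau is given by a word. -/
theorem exists_word (hN : mu.card + N = lam.card) (hV : LetterCount N V c) {K : ℕ} {g : ℕ → ℕ → ℕ}
    (hg : StripChain K mu.rowLen lam.rowLen g)
    (hsum : ∀ I, rowSum lam.card g I = mu.card + c I) :
    ∃ w, IsWord lam mu V N w ∧ ∀ I k, rowFill mu w (c I) k = g I k := by
  have hz : ∀ I k, lam.card ≤ k → g I k = 0 := fun I k hk =>
    hg.eq_zero (fun i h => YoungDiagram.rowLen_eq_zero h) I hk
  -- The word is built greedily, always in the lowest row that still lacks the current letter. The
  -- invariants say that all rows below a chosen one were already complete for its letter, and that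
  -- the partial shape is sandwiched between the terms of the chain.
  have key : ∀ e ≤ N, ∃ w, IsWord lam mu V e w ∧
      (∀ q < e, ∀ k, w q < k → g (V q + 1) k ≤ rowFill mu w q k) ∧
      ∀ q ≤ e, ∀ I k, (c I ≤ q → g I k ≤ rowFill mu w q k) ∧ (q ≤ c I → rowFill mu w q k ≤ g I k) := by
    intro e
    induction e with
    | zero =>
      intro _
      refine ⟨fun _ => 0, ⟨fun q hq => absurd hq (Nat.not_lt_zero q), fun _ _ => rfl⟩,
        fun q hq => absurd hq (Nat.not_lt_zero q), fun q hq I k => ?_⟩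
      obtain rfl : q = 0 := by omega
      rw [rowFill_zero]
      refine ⟨fun h0 => ?_, fun _ => ?_⟩
      · have h1 : ∀ i ∈ Finset.range lam.card, g 0 i ≤ g I i :=
          fun i _ => hg.lace.mono (Nat.zero_le I) i
        have h2 := (Finset.sum_eq_sum_iff_of_le h1).mp (by
          change rowSum lam.card g 0 = rowSum lam.card g I
          rw [hsum, hsum, hV.zero]; omega)
        by_cases hk : k < lam.card
        · rw [← hg.bot, h2 k (Finset.mem_range.mpr hk)]
        · rw [hz I k (by omega)]; exact Nat.zero_le _
      · rw [← hg.bot]; exact hg.lace.mono (Nat.zero_le I) k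
    | succ e ih =>
      intro he
      obtain ⟨w, hw, hmax, hcon⟩ := ih (by omega)
      obtain ⟨hc1, hc2⟩ := (hV.eq_iff (show e < N by omega) (V e)).mp rfl
      have hs := sum_rowFill (lam := lam) (by omega) hw.step le_rfl
      obtain ⟨r, hr, hrmax⟩ := exists_max_lt (f := rowFill mu w e) (hz (V e + 1)) (by
        have := hsum (V e + 1)
        rw [rowSum] at this
        rw [hs, this]; omega)
      have hadd : CanAdd lam mu V w e r := by
        refine ⟨hr.trans_le (hg.le _ _), ?_, ?_⟩
        · rintro r' rfl
          exact hr.trans_le (((hg.lace (V e) r').2).trans ((hcon e le_rfl (V e) r').1 hc1))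
        · rintro q' rfl hVq
          by_contra hlt
          push Not at hlt
          have h1 := hmax q' (Nat.lt_succ_self q') r hlt
          rw [hVq] at h1
          have h2 := rowFill_mono (mu := mu) w (Nat.le_succ q') r
          simp only [Nat.succ_eq_add_one] at h2
          omega
      have hag : ∀ q < e, w q = Function.update w e r q := fun q hq => by
        rw [Function.update_of_ne (by omega)]
      have hfill : ∀ q ≤ e, ∀ k, rowFill mu (Function.update w e r) q k = rowFill mu w q k :=
        fun q hq k => (rowFill_congr (fun q' hq' => hag q' (by omega)) k).symm
      have hfill' : ∀ k, rowFill mu (Function.update w e r) (e + 1) k =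
          rowFill mu w e k + if r = k then 1 else 0 := fun k => by
        rw [rowFill_succ, hfill e le_rfl, Function.update_self]
      have hw' := hw.update hadd
      have hup : ∀ I, e + 1 ≤ c I → ∀ k, rowFill mu (Function.update w e r) (e + 1) k ≤ g I k := by
        intro I hI k
        have h1 : V e < I := (hV.lt_iff e (by omega) I).mpr hI
        rw [hfill']
        split_ifs with hk
        · subst hk
          exact le_trans hr (hg.lace.mono h1 r)
        · exact (hcon e le_rfl I k).2 (by omega)
      refine ⟨_, hw', fun q hq k hk => ?_, fun q hq I k => ?_⟩
      · rcases Nat.lt_succ_iff_lt_or_eq.mp hq with hq | rfl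
        · rw [← hag q hq] at hk
          rw [hfill q hq.le]
          exact hmax q hq k hk
        · rw [Function.update_self] at hk
          rw [hfill q le_rfl]
          exact hrmax k hk
      · rcases Nat.lt_succ_iff_lt_or_eq.mp (Nat.lt_succ_of_le hq) with hq | rfl
        · rw [hfill q (by omega)]
          exact hcon q (by omega) I k
        · refine ⟨fun hI => ?_, fun hI => hup I hI k⟩
          rcases Nat.lt_or_ge e (c I) with h1 | h1
          -- Here `c I = e + 1`: the block has just ended, and containment with equal sizes gives
          -- equality of the shapes.
          · have h2 := (Finset.sum_eq_sum_iff_of_le (s := Finset.range lam.card)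
              (fun i _ => hup I h1 i)).mp (by
                have := hsum I
                rw [rowSum] at this
                rw [sum_rowFill (by omega) hw'.step le_rfl, this]; omega)
            by_cases hk : k < lam.card
            · exact (h2 k (Finset.mem_range.mpr hk)).ge
            · rw [hz I k (by omega)]; exact Nat.zero_le _
          · exact ((hcon e le_rfl I k).1 h1).trans (by rw [hfill']; omega)
  obtain ⟨w, hw, -, hcon⟩ := key N le_rfl
  refine ⟨w, hw, fun I k => ?_⟩
  have := hcon (c I) (hV.le I) I k
  exact le_antisymm (this.2 le_rfl) (this.1 le_rfl)

/-- Without conditions on the letters, every partial word can be extended. -/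
theorem exists_extension {w : ℕ → ℕ} (hN : mu.card + N = lam.card) {e : ℕ} (he : e ≤ N)
    (h : IsWord lam mu id e w) :
    ∃ w', IsWord lam mu id N w' ∧ ∀ q < e, w' q = w q := by
  obtain ⟨d, rfl⟩ := Nat.exists_eq_add_of_le he
  clear he
  induction d generalizing e w with
  | zero => exact ⟨w, h, fun _ _ => rfl⟩
  | succ d ih =>
    have hs := sum_rowFill (lam := lam) (by omega) h.step le_rfl
    have hex : ∃ r, rowFill mu w e r < lam.rowLen r := by
      have : ∑ i ∈ Finset.range lam.card, rowFill mu w e i <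
          ∑ i ∈ Finset.range lam.card, lam.rowLen i := by
        rw [hs, YoungDiagram.sum_rowLen le_rfl]; omega
      obtain ⟨r, -, hr⟩ := Finset.exists_lt_of_sum_lt this
      exact ⟨r, hr⟩
    -- In the topmost incomplete row a cell can always be added, since the row above is already
    -- full. All letters are distinct, so there is no condition on letters.
    have hadd : CanAdd lam mu id w e (Nat.find hex) := by
      refine ⟨Nat.find_spec hex, fun r' hr => ?_, fun q' hq hV => ?_⟩
      · have h1 := Nat.find_min hex (m := r') (by omega)
        have h2 := Nat.find_spec hex
        have h3 := lam.rowLen_anti r' (Nat.find hex) (by omega)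
        omega
      · simp only [id] at hV; omega
    obtain ⟨w', h1, h2⟩ := ih (h.update hadd) (by omega)
    rw [show e + 1 + d = e + (d + 1) by ring] at h1
    exact ⟨w', h1, fun q hq => by rw [h2 q (by omega), Function.update_of_ne (by omega)]⟩

theorem IsWord.forget {w : ℕ → ℕ} {e : ℕ} (h : IsWord lam mu V e w) : IsWord lam mu id e w :=
  ⟨fun q hq => ⟨(h.step q hq).lt, (h.step q hq).prev, fun q' hq' hV => by
    simp only [id] at hV; omega⟩, h.zero⟩

/-! ### The number of words -/

/-- With distinct letters `0, …, N - 1`, words describe standard tableaux. -/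
theorem letterCount_id (N : ℕ) : LetterCount N id fun I => min I N :=
  ⟨fun q hq I => by simp only [id]; omega, fun I => min_le_right _ _⟩

theorem card_skewCells_add (hle : ∀ k, mu.rowLen k ≤ lam.rowLen k) :
    mu.card + (skewCells lam mu).card = lam.card := by
  have hsub : mu.cells ⊆ lam.cells := by
    rintro ⟨i, j⟩ h
    rw [YoungDiagram.mem_cells, YoungDiagram.mem_iff_lt_rowLen] at h ⊢
    exact h.trans_le (hle i)
  have := Finset.card_sdiff_add_card_eq_card hsub
  change (skewCells lam mu).card + mu.card = lam.card at this
  omega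

/-- Forget the letters of a partial word, complete it and take its standard tableau. The tableau
determines the completed word, hence its first `e` places, so this is injective. This is where
f^{λ/μ} enters the running time. -/
theorem card_words_le (hle : ∀ k, mu.rowLen k ≤ lam.rowLen k) {e : ℕ}
    (he : e ≤ (skewCells lam mu).card) (W : Finset (ℕ → ℕ)) (hW : ∀ w ∈ W, IsWord lam mu V e w) :
    W.card ≤ numSkewSYT lam mu := by
  have hN := card_skewCells_add hle
  have hV := letterCount_id (skewCells lam mu).card
  have hex : ∀ w : W, ∃ S : {T : SkewSSYT lam mu // T.HasType fun k =>
      if k < (skewCells lam mu).card then 1 else 0}, ∃ w', IsWord lam mu id (skewCells lam mu).card w' ∧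
      (∀ q < e, w' q = w.1 q) ∧
      S.1.toChain = fun I k => rowFill mu w' (min I (skewCells lam mu).card) k := by
    intro w
    obtain ⟨w', h1, h2⟩ := exists_extension hN he (hW w.1 w.2).forget
    obtain ⟨S, hS⟩ := exists_tableau_of_word hle hN hV h1
    refine ⟨⟨S, ?_⟩, w', h1, h2, hS⟩
    convert hasType_of_toChain_eq hN hV h1 hS using 2 with k
    split_ifs <;> omega
  choose f g h1 h2 h3 using hex
  have hfin := SkewSSYT.finite_hasType hle (N := (skewCells lam mu).card)
    (α := fun k => if k < (skewCells lam mu).card then 1 else 0) fun i hi => if_neg (by omega)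
  have hinj : Function.Injective f := by
    intro w w' hww
    have h4 : g w = g w' := by
      refine word_injective hV (h1 w) (h1 w') fun I k => ?_
      have h5 := h3 w
      rw [hww, h3 w'] at h5
      exact (congrFun (congrFun h5 I) k).symm
    refine Subtype.ext (funext fun q => ?_)
    by_cases hq : q < e
    · rw [← h2 w q hq, ← h2 w' q hq, h4]
    · rw [(hW w.1 w.2).zero q (by omega), (hW w'.1 w'.2).zero q (by omega)]
  have := Nat.card_le_card_of_injective f hinj
  rwa [Nat.card_eq_finsetCard] at this

/-- Tableaux of two shapes with the same cells. -/
def castShape {lam' mu' : YoungDiagram} (h : skewCells lam mu = skewCells lam' mu')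
    (S : SkewSSYT lam mu) : SkewSSYT lam' mu' :=
  ⟨S.entry, by rw [← h]; exact S.row_weak, by rw [← h]; exact S.col_strict,
    by rw [← h]; exact S.zeros⟩

theorem numSkewSYT_congr {lam' mu' : YoungDiagram} (h : skewCells lam mu = skewCells lam' mu') :
    numSkewSYT lam mu = numSkewSYT lam' mu' := by
  refine Nat.card_congr ⟨fun S => ⟨castShape h S.1, ?_⟩, fun S => ⟨castShape h.symm S.1, ?_⟩,
    fun _ => rfl, fun _ => rfl⟩
  · intro k
    have := S.2 k
    simp only [h] at this
    exact this
  · intro k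
    have := S.2 k
    simp only [← h] at this
    exact this

/-- Needed even if μ is not contained in λ, because a bound proportional to f^{λ/μ} must cover the
preprocessing. The shape is unchanged when μ is replaced by its intersection with λ, and then the
empty word can be counted. -/
theorem numSkewSYT_pos (lam mu : YoungDiagram) : 0 < numSkewSYT lam mu := by
  have h : skewCells lam mu = skewCells lam (lam ⊓ mu) := by
    ext c
    simp only [skewCells, Finset.mem_sdiff, YoungDiagram.cells_inf, Finset.mem_inter]
    tauto
  rw [numSkewSYT_congr h]
  have hle : ∀ k, (lam ⊓ mu).rowLen k ≤ lam.rowLen k := fun k => by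
    by_contra hlt
    push Not at hlt
    have h1 := YoungDiagram.mem_iff_lt_rowLen.mpr hlt
    have h2 := YoungDiagram.mem_iff_lt_rowLen.mp (YoungDiagram.mem_inf.mp h1).1
    omega
  have := card_words_le (V := id) hle (Nat.zero_le _) {fun _ => 0} fun w hw => by
    obtain rfl := Finset.mem_singleton.mp hw
    exact ⟨fun q hq => absurd hq (Nat.not_lt_zero q), fun _ _ => rfl⟩
  rwa [Finset.card_singleton] at this

end RAM


/-! ### Generating the tableaux of a given type -/

namespace RAM

variable {lam mu nu : YoungDiagram}

theorem Does.step_write {a : ℕ} {i e : Expr} {q : Prog} {m : Mem} {T : ℕ} {Q : Mem → Prop}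
    (hT : 1 + i.cost + e.cost ≤ T)
    (k : Does q (m.set a (i.eval m) (e.eval m)) (T - (1 + i.cost + e.cost)) Q) :
    Does (.seq (.write a i e) q) m T Q :=
  (Does.seq (Does.write k)).mono (by omega) fun _ h => h

theorem Does.step_incr {a : ℕ} {q : Prog} {m : Mem} {T : ℕ} {Q : Mem → Prop}
    (hT : 6 ≤ T) (k : Does q (m.set a 0 (m a 0 + 1)) (T - 6) Q) :
    Does (.seq (.incr a) q) m T Q :=
  (Does.seq (Does.incr k)).mono (by omega) fun _ h => h

/-- Store the letters `0 ^ nu 0, 1 ^ nu 1, …` in the array `7` and their number in the variable `8`. -/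
def lettersProg : Prog :=
  .seq (.assign 8 (.const 0)) (.seq (.assign 9 (.const 0)) (.loop (.read 2 (.var 9))
    (.seq (.assign 10 (.const 0)) (.seq (.loop (.sub (.read 2 (.var 9)) (.var 10))
      (.seq (.write 7 (.var 8) (.var 9)) (.seq (.incr 8) (.incr 10)))) (.incr 9)))))

/-- The number of letters `< I` in a word of type `nu`. -/
def letterSum (nu : YoungDiagram) (I : ℕ) : ℕ := ∑ i ∈ Finset.range I, nu.rowLen i

theorem letterSum_succ (nu : YoungDiagram) (I : ℕ) :
    letterSum nu (I + 1) = letterSum nu I + nu.rowLen I := Finset.sum_range_succ _ _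

theorem letterSum_mono (nu : YoungDiagram) : Monotone (letterSum nu) :=
  monotone_nat_of_le_succ fun I => by rw [letterSum_succ]; omega

theorem letterSum_le (nu : YoungDiagram) (I : ℕ) : letterSum nu I ≤ nu.card := by
  rw [← YoungDiagram.sum_rowLen (show nu.card ≤ nu.card + I by omega)]
  exact Finset.sum_le_sum_of_subset (Finset.range_mono (by omega))

theorem letterSum_colLen (nu : YoungDiagram) : letterSum nu (nu.colLen 0) = nu.card := by
  rw [← YoungDiagram.sum_rowLen le_rfl]
  refine Finset.sum_subset (Finset.range_mono (colLen_le_card nu)) fun i _ hi => ?_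
  by_contra h
  exact hi (Finset.mem_range.mpr ((rowLen_ne_zero_iff nu i).mp h))

/-- The bound is linear since the inner loops together run once for each cell of ν. -/
theorem does_lettersProg {m : Mem} (hm : m 2 = nu.rowLen) :
    Does lettersProg m (100 * (nu.card + 1)) fun m' =>
      Frame {7, 8, 9, 10} m m' ∧ m' 8 0 = nu.card ∧ LetterCount nu.card (m' 7) (letterSum nu) := by
  have hT : ∀ K, ∑ k ∈ Finset.range K, ((nu.rowLen k * 30 + 30) + (1 + (1 + (1 + 1)))) =
      letterSum nu K * 30 + K * 34 := by
    intro K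
    induction K with
    | zero => rfl
    | succ K ih => rw [Finset.sum_range_succ, ih, letterSum_succ]; ring
  have hT' := hT (nu.colLen 0)
  rw [letterSum_colLen] at hT'
  have hcl := colLen_le_card nu
  refine Does.step_assign (by simp only [Expr.cost]; omega) (Does.step_assign
    (by simp only [Expr.cost]; omega) (Does.mono (Does.loop (T := fun k => nu.rowLen k * 30 + 30)
    (fun k m' => Frame {7, 8, 9, 10} m m' ∧ m' 9 0 = k ∧ m' 8 0 = letterSum nu k ∧
      ∀ q < letterSum nu k, ∀ I, m' 7 q < I ↔ q < letterSum nu I) (nu.colLen 0) ⟨?_, ?_, ?_, ?_⟩ ?_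
      ?_) ?_ fun _ h => h))
  · exact ((Frame.refl _ _).set (by simp) _ _).set (by simp) _ _
  · rw [Mem.set_same]; rfl
  · rw [Mem.set_ne _ (by simp), Mem.set_same]; rfl
  · intro q hq; exact absurd hq (Nat.not_lt_zero q)
  · rintro k hk m₁ ⟨f₁, h9, h8, h7⟩
    have hrow : (Expr.read 2 (.var 9)).eval m₁ = nu.rowLen k := by
      rw [Expr.eval, Expr.eval_var, f₁ 2 (by simp), hm, h9]
    refine ⟨by rw [hrow]; exact (rowLen_ne_zero_iff nu k).mpr hk, ?_⟩
    refine Does.step_assign (by simp only [Expr.cost]; omega) (Does.step (Does.loop_const (T := 18)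
      (fun j m' => Frame {7, 8, 9, 10} m m' ∧ m' 9 0 = k ∧ m' 10 0 = j ∧
        m' 8 0 = letterSum nu k + j ∧
        ∀ q < letterSum nu k + j, ∀ I, m' 7 q < I ↔ q < letterSum nu I) (nu.rowLen k)
        ⟨?_, ?_, ?_, ?_, ?_⟩ ?_ (Q := fun m' => Frame {7, 8, 9, 10} m m' ∧ m' 9 0 = k ∧
          m' 8 0 = letterSum nu (k + 1) ∧
          ∀ q < letterSum nu (k + 1), ∀ I, m' 7 q < I ↔ q < letterSum nu I) ?_) ?_ ?_)
    · exact f₁.set (by simp) _ _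
    · rw [Mem.set_ne _ (by simp), h9]
    · rw [Mem.set_same]; rfl
    · rw [Mem.set_ne _ (by simp), h8, add_zero]
    · rw [Mem.set_ne _ (by simp)]; exact h7
    · rintro j hj m₂ ⟨f₂, h9, h10, h8, h7⟩
      refine ⟨?_, ?_⟩
      · simp only [Expr.eval, f₂ 2 (by simp), hm, h9, h10]; omega
      refine Does.step_write (by simp only [Expr.cost]; omega) (Does.step_incr
        (by simp only [Expr.cost]; omega) ((Does.incr ⟨?_, ?_, ?_, ?_, ?_⟩).mono
        (by simp only [Expr.cost]; omega) fun _ h => h))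
      · exact ((f₂.set (by simp) _ _).set (by simp) _ _).set (by simp) _ _
      · rw [Mem.set_ne _ (by simp), Mem.set_ne _ (by simp), Mem.set_ne _ (by simp), h9]
      · rw [Mem.set_same, Mem.set_ne _ (by simp), Mem.set_ne _ (by simp), h10]
      · rw [Mem.set_ne _ (by simp), Mem.set_same, Mem.set_ne _ (by simp), h8, add_assoc]
      · intro q hq I
        rw [Mem.set_ne _ (by simp), Mem.set_ne _ (by simp), Mem.set_idx, Expr.eval_var,
          Expr.eval_var, h8, h9]
        split_ifs with hqe
        · subst hqe
          constructor
          · intro hI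
            have := letterSum_mono nu (show k + 1 ≤ I from hI)
            rw [letterSum_succ] at this
            omega
          · intro hI
            by_contra hlt
            have := letterSum_mono nu (show I ≤ k by omega)
            omega
        · exact h7 q (by omega) I
    · rintro m₂ ⟨f₂, h9, h10, h8, h7⟩
      refine ⟨?_, f₂, h9, by rw [letterSum_succ, h8], by rw [letterSum_succ]; exact h7⟩
      simp only [Expr.eval, f₂ 2 (by simp), hm, h9, h10, Nat.sub_self]
    · simp only [Expr.cost]; omega
    · rintro m₂ ⟨f₂, h9, h8, h7⟩
      refine (Does.incr ⟨f₂.set (by simp) _ _, ?_, ?_, ?_⟩).mono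
        (by simp only [Expr.cost]; omega) fun _ h => h
      · rw [Mem.set_same, h9]
      · rw [Mem.set_ne _ (by simp), h8]
      · rw [Mem.set_ne _ (by simp)]; exact h7
  · rintro m₁ ⟨f₁, h9, h8, h7⟩
    rw [letterSum_colLen] at h8 h7
    refine ⟨?_, f₁, h8, h7, letterSum_le nu⟩
    rw [Expr.eval, Expr.eval_var, f₁ 2 (by simp), hm, h9]
    by_contra h
    exact lt_irrefl _ ((rowLen_ne_zero_iff nu _).mp h)
  · simp only [Expr.cost]; omega

/-- The arrays with the data of the instance. -/
structure Env (lam mu : YoungDiagram) (V : ℕ → ℕ) (N : ℕ) (m : Mem) : Prop where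
  lam_eq : m 0 = lam.rowLen
  mu_eq : m 1 = mu.rowLen
  ends : ∀ j ≤ lam.colLen 0, m 5 j = rowEnds lam mu j
  rows : m 6 0 = lam.colLen 0
  letters : m 7 = V
  size : m 8 0 = N

/-- The arrays that are changed by the generation of the tableaux. -/
def genVars : Finset ℕ := {3, 4, 11, 12, 13, 14, 15, 16, 17, 18, 19, 20, 21}

variable {V : ℕ → ℕ} {N : ℕ} {m m' : Mem}

theorem Env.frame (h : Env lam mu V N m) (hf : Frame genVars m m') : Env lam mu V N m' := by
  obtain ⟨h1, h2, h3, h4, h5, h6⟩ := h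
  refine ⟨?_, ?_, ?_, ?_, ?_, ?_⟩
  · rw [hf 0 (by simp [genVars]), h1]
  · rw [hf 1 (by simp [genVars]), h2]
  · rw [hf 5 (by simp [genVars])]; exact h3
  · rw [hf 6 (by simp [genVars]), h4]
  · rw [hf 7 (by simp [genVars]), h5]
  · rw [hf 8 (by simp [genVars]), h6]

/-- Reset the array `18` of row fillings. -/
def resetFill : Prog :=
  .seq (.assign 4 (.const 0)) (.loop (.sub (.var 6) (.var 4))
    (.seq (.write 18 (.var 4) (.read 1 (.var 4))) (.incr 4)))

theorem does_resetFill (h : Env lam mu V N m) :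
    Does resetFill m (50 * (lam.card + 1)) fun m' =>
      Frame {4, 18} m m' ∧ ∀ i < lam.colLen 0, m' 18 i = mu.rowLen i := by
  have hcl := colLen_le_card lam
  refine Does.step_assign (by simp only [Expr.cost]; omega) (Does.mono (Does.loop_const (T := 12)
    (fun k m' => Frame {4, 18} m m' ∧ m' 4 0 = k ∧ ∀ i < k, m' 18 i = mu.rowLen i) (lam.colLen 0)
    ⟨(Frame.refl _ _).set (by simp) _ _, ?_, fun i hi => absurd hi (Nat.not_lt_zero i)⟩ ?_ ?_) ?_
    fun _ h => h)
  · rw [Mem.set_same]; rfl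
  · rintro k hk m₁ ⟨f₁, h4, h18⟩
    have e₁ := h.frame (f₁.mono (by decide))
    refine ⟨by simp only [Expr.eval, e₁.rows, h4]; omega, Does.step_write
      (by simp only [Expr.cost]; omega) ((Does.incr ⟨?_, ?_, ?_⟩).mono
      (by simp only [Expr.cost]; omega) fun _ h => h)⟩
    · exact (f₁.set (by simp) _ _).set (by simp) _ _
    · rw [Mem.set_same, Mem.set_ne _ (by simp), h4]
    · intro i hi
      rw [Mem.set_ne _ (by simp), Mem.set_idx]
      simp only [Expr.eval, h4, e₁.mu_eq]
      split_ifs with he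
      · rw [he]
      · exact h18 i (by omega)
  · rintro m₁ ⟨f₁, h4, h18⟩
    have e₁ := h.frame (f₁.mono (by decide))
    exact ⟨by simp only [Expr.eval, e₁.rows, h4, Nat.sub_self], f₁, h18⟩
  · simp only [Expr.cost]; omega

/-- Compute the row fillings of the partial word of length `m 12 0` that starts at the index `m 13 0` of
the array `11`. -/
def replay : Prog :=
  .seq (.assign 19 (.const 0)) (.loop (.sub (.var 12) (.var 19))
    (.seq (.write 18 (.read 11 (.add (.var 13) (.var 19)))
      (.add (.read 18 (.read 11 (.add (.var 13) (.var 19)))) (.const 1))) (.incr 19)))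

/-- The table stores rows only; the partial shape of a word is recomputed in linear time when the
word is processed. -/
theorem does_replay {w : ℕ → ℕ} {e h : ℕ} (h12 : m 12 0 = e) (h13 : m 13 0 = h)
    (hw : ∀ q < e, m 11 (h + q) = w q) (hr : ∀ q < e, w q < lam.colLen 0)
    (h18 : ∀ i < lam.colLen 0, m 18 i = mu.rowLen i) :
    Does replay m (50 * (e + 1)) fun m' =>
      Frame {18, 19} m m' ∧ ∀ i < lam.colLen 0, m' 18 i = rowFill mu w e i := by
  refine Does.step_assign (by simp only [Expr.cost]; omega) (Does.mono (Does.loop_const (T := 30)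
    (fun k m' => Frame {18, 19} m m' ∧ m' 19 0 = k ∧
      ∀ i < lam.colLen 0, m' 18 i = rowFill mu w k i) e
    ⟨(Frame.refl _ _).set (by simp) _ _, ?_, ?_⟩ ?_ ?_) ?_ fun _ h => h)
  · rw [Mem.set_same]; rfl
  · intro i hi
    rw [Mem.set_ne _ (by simp), h18 i hi, rowFill_zero]
  · rintro k hk m₁ ⟨f₁, h19, h18⟩
    have a12 : m₁ 12 0 = e := by rw [f₁ 12 (by simp), h12]
    have a13 : m₁ 13 0 = h := by rw [f₁ 13 (by simp), h13]
    have aw : m₁ 11 (h + k) = w k := by rw [f₁ 11 (by simp), hw k hk]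
    refine ⟨by simp only [Expr.eval, a12, h19]; omega, Does.step_write
      (by simp only [Expr.cost]; omega) ((Does.incr ⟨?_, ?_, ?_⟩).mono
      (by simp only [Expr.cost]; omega) fun _ h => h)⟩
    · exact (f₁.set (by simp) _ _).set (by simp) _ _
    · rw [Mem.set_same, Mem.set_ne _ (by simp), h19]
    · intro i hi
      rw [Mem.set_ne _ (by simp), Mem.set_idx, rowFill_succ]
      simp only [Expr.eval, h19, a13, aw]
      split_ifs with he he' he'
      · rw [h18 _ (hr k hk), he']
      · exact absurd he.symm he'
      · exact absurd he'.symm he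
      · exact h18 i hi
  · rintro m₁ ⟨f₁, h19, h18⟩
    have a12 : m₁ 12 0 = e := by rw [f₁ 12 (by simp), h12]
    exact ⟨by simp only [Expr.eval, a12, h19, Nat.sub_self], f₁, h18⟩
  · simp only [Expr.cost]; omega

/-- Test whether the partial word can be extended by the row `m 20 0`; the result is `0` if it can. -/
def testAdd : Prog :=
  .seq (.assign 21 (.add (.sub (.const 1) (.sub (.read 0 (.var 20)) (.read 18 (.var 20))))
    (.sub (.const 1) (.sub (.add (.read 18 (.sub (.var 20) (.const 1))) (.sub (.const 1) (.var 20)))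
      (.read 18 (.var 20))))))
  (.ite (.var 12) (.ite (.add (.sub (.read 7 (.sub (.var 12) (.const 1))) (.read 7 (.var 12)))
      (.sub (.read 7 (.var 12)) (.read 7 (.sub (.var 12) (.const 1))))) .skip
    (.assign 21 (.add (.var 21)
      (.sub (.var 20) (.read 11 (.add (.var 13) (.sub (.var 12) (.const 1)))))))) .skip)

/-- The form computed by `testAdd`: `1 - (x - y)` vanishes exactly when `y < x`. For `r = 0` the
index `r - 1` is again `0`, and the summand `1 - r = 1` makes the comparison with the previous row
true. -/
theorem canAdd_iff {w : ℕ → ℕ} {e r : ℕ} : CanAdd lam mu V w e r ↔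
    ((1 - (lam.rowLen r - rowFill mu w e r)) +
      (1 - ((rowFill mu w e (r - 1) + (1 - r)) - rowFill mu w e r)) = 0 ∧
    (e ≠ 0 → V (e - 1) = V e → r ≤ w (e - 1))) := by
  constructor
  · rintro ⟨h1, h2, h3⟩
    refine ⟨?_, fun he => h3 (e - 1) (by omega)⟩
    rcases Nat.eq_zero_or_pos r with rfl | hr
    · simp only [Nat.zero_sub]; omega
    · have := h2 (r - 1) (by omega)
      omega
  · rintro ⟨h1, h2⟩
    refine ⟨by omega, ?_, ?_⟩
    · rintro r' rfl
      rw [Nat.add_sub_cancel] at h1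
      omega
    · rintro q' rfl
      exact h2 (by omega)

theorem does_testAdd (he : Env lam mu V N m) {w : ℕ → ℕ} {e h r : ℕ} (h12 : m 12 0 = e)
    (h13 : m 13 0 = h) (h20 : m 20 0 = r) (hr : r < lam.colLen 0)
    (hw : ∀ q < e, m 11 (h + q) = w q)
    (h18 : ∀ i < lam.colLen 0, m 18 i = rowFill mu w e i) :
    Does testAdd m 100 fun m' => Frame {21} m m' ∧ (m' 21 0 = 0 ↔ CanAdd lam mu V w e r) := by
  refine Does.step_assign (by simp only [Expr.cost]; omega) ?_
  set m₁ := m.set 21 0 (Expr.eval m _) with hm₁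
  have f₁ : Frame {21} m m₁ := (Frame.refl _ _).set (by simp) _ _
  have e₁ := he.frame (f₁.mono (by decide))
  have a12 : m₁ 12 0 = e := by rw [f₁ 12 (by simp), h12]
  have a13 : m₁ 13 0 = h := by rw [f₁ 13 (by simp), h13]
  have a20 : m₁ 20 0 = r := by rw [f₁ 20 (by simp), h20]
  have a21 : m₁ 21 0 = (1 - (lam.rowLen r - rowFill mu w e r)) +
      (1 - ((rowFill mu w e (r - 1) + (1 - r)) - rowFill mu w e r)) := by
    rw [hm₁, Mem.set_same]
    simp only [Expr.eval, h20, he.lam_eq, h18 r hr, h18 (r - 1) (by omega)]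
  rw [canAdd_iff, ← a21]
  refine (Does.ite (T := 50) (fun h0 => (Does.ite (T := 20) (fun h1 => ?_) fun h1 => ?_).mono
    (by simp only [Expr.cost]; omega) fun _ h => h) fun h0 => ?_).mono
    (by simp only [Expr.cost]; omega) fun _ h => h
  · simp only [Expr.eval, a12, e₁.letters] at h0 h1
    refine (Does.skip ⟨f₁, ?_⟩).mono (by omega) fun _ h => h
    exact ⟨fun h => ⟨h, fun _ hV => by omega⟩, fun h => h.1⟩
  · simp only [Expr.eval, a12, e₁.letters] at h0 h1
    refine (Does.assign ⟨f₁.set (by simp) _ _, ?_⟩).mono (by simp only [Expr.cost]; omega) fun _ h => h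
    rw [Mem.set_same]
    simp only [Expr.eval, a12, a13, a20, f₁ 11 (by simp), hw (e - 1) (by omega)]
    constructor
    · intro h; exact ⟨by omega, fun _ _ => by omega⟩
    · rintro ⟨h2, h3⟩
      have := h3 h0 (by omega)
      omega
  · rw [Expr.eval_var, a12] at h0
    refine (Does.skip ⟨f₁, ?_⟩).mono (by omega) fun _ h => h
    exact ⟨fun h => ⟨h, fun h' => absurd h0 h'⟩, fun h => h.1⟩

end RAM


namespace RAM

variable {lam mu nu : YoungDiagram} {V : ℕ → ℕ} {N : ℕ} {m m' : Mem}

/-! ### The list of words -/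

open Classical in
/-- The extensions of a partial word of length `e` by one of the rows `0, …, r - 1`. -/
noncomputable def extensions (lam mu : YoungDiagram) (V : ℕ → ℕ) (e r : ℕ) (w : ℕ → ℕ) :
    List (ℕ → ℕ) :=
  ((List.range r).filter fun i => CanAdd lam mu V w e i).map (Function.update w e)

/-- The list of the partial words of length `e`. -/
noncomputable def words (lam mu : YoungDiagram) (V : ℕ → ℕ) : ℕ → List (ℕ → ℕ)
  | 0 => [fun _ => 0]
  | e + 1 => (words lam mu V e).flatMap (extensions lam mu V e (lam.colLen 0))

theorem mem_extensions {e r : ℕ} {w w' : ℕ → ℕ} : w' ∈ extensions lam mu V e r w ↔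
    ∃ i < r, CanAdd lam mu V w e i ∧ Function.update w e i = w' := by
  simp [extensions, and_assoc]

theorem extensions_succ {e r : ℕ} {w : ℕ → ℕ} (h : CanAdd lam mu V w e r) :
    extensions lam mu V e (r + 1) w = extensions lam mu V e r w ++ [Function.update w e r] := by
  simp [extensions, List.range_succ, List.filter_append, h]

theorem extensions_succ_of_not {e r : ℕ} {w : ℕ → ℕ} (h : ¬ CanAdd lam mu V w e r) :
    extensions lam mu V e (r + 1) w = extensions lam mu V e r w := by
  simp [extensions, List.range_succ, List.filter_append, h]

theorem CanAdd.lt_colLen {w : ℕ → ℕ} {e r : ℕ} (h : CanAdd lam mu V w e r) : r < lam.colLen 0 :=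
  (rowLen_ne_zero_iff lam r).mp (by have := h.lt; omega)

theorem mem_words {e : ℕ} {w : ℕ → ℕ} : w ∈ words lam mu V e ↔ IsWord lam mu V e w := by
  induction e generalizing w with
  | zero =>
    rw [words, List.mem_singleton]
    refine ⟨?_, fun h => funext fun q => h.zero q (Nat.zero_le q)⟩
    rintro rfl
    exact ⟨fun q hq => absurd hq (Nat.not_lt_zero q), fun _ _ => rfl⟩
  | succ e ih =>
    simp only [words, List.mem_flatMap, mem_extensions, ih]
    constructor
    · rintro ⟨w', h, i, -, hi, rfl⟩
      exact h.update hi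
    · intro h
      have hc : CanAdd lam mu V (Function.update w e 0) e (w e) :=
        (h.step e (by omega)).congr fun q hq => by rw [Function.update_of_ne (by omega)]
      exact ⟨_, h.truncate, w e, hc.lt_colLen, hc, by simp⟩

/-- Words of length `e` vanish from the place `e` on, so an extension determines the word that it
came from. -/
theorem nodup_words (e : ℕ) : (words lam mu V e).Nodup := by
  induction e with
  | zero => exact List.nodup_singleton _
  | succ e ih =>
    rw [words, List.nodup_flatMap]
    refine ⟨fun w _ => ?_, ?_⟩
    · exact (List.nodup_range.filter _).map (Function.update_injective w e)
    · refine ih.pairwise_of_forall_ne fun w hw w' hw' hne => ?_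
      rw [Function.onFun, List.disjoint_left]
      intro x hx hx'
      obtain ⟨i, -, -, rfl⟩ := mem_extensions.mp hx
      obtain ⟨i', -, -, he⟩ := mem_extensions.mp hx'
      refine hne (funext fun q => ?_)
      rcases eq_or_ne q e with rfl | hq
      · rw [(mem_words.mp hw).zero q le_rfl, (mem_words.mp hw').zero q le_rfl]
      · have := congrFun he q
        rwa [Function.update_of_ne hq, Function.update_of_ne hq, eq_comm] at this

theorem length_words_le (hle : ∀ k, mu.rowLen k ≤ lam.rowLen k) {e : ℕ}
    (he : e ≤ (skewCells lam mu).card) : (words lam mu V e).length ≤ numSkewSYT lam mu := by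
  classical
  rw [← List.toFinset_card_of_nodup (nodup_words e)]
  exact card_words_le hle he _ fun w hw => mem_words.mp (List.mem_toFinset.mp hw)

/-! ### Tables of words -/

/-- The array `v` contains, from the index `b` on, the partial words of length `e` in the list `l`; every
word occupies `W` places. -/
def Table (v : ℕ → ℕ) (W b : ℕ) (l : List (ℕ → ℕ)) (e : ℕ) : Prop :=
  ∀ t w, l[t]? = some w → ∀ q < e, v (b + t * W + q) = w q

theorem Table.nil (v : ℕ → ℕ) (W b e : ℕ) : Table v W b [] e := fun t w h => by simp at h

theorem Table.congr {v v' : ℕ → ℕ} {W b e : ℕ} {l : List (ℕ → ℕ)} (h : Table v W b l e)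
    (he : e ≤ W) (hv : ∀ i < b + l.length * W, v' i = v i) : Table v' W b l e := by
  intro t w ht q hq
  have h1 := (List.getElem?_eq_some_iff.mp ht).1
  have h2 := Nat.mul_le_mul_right W (show t + 1 ≤ l.length from h1)
  rw [Nat.add_mul] at h2
  rw [hv _ (by omega), h t w ht q hq]

theorem Table.concat {v : ℕ → ℕ} {W b e : ℕ} {l : List (ℕ → ℕ)} {w : ℕ → ℕ} (h : Table v W b l e)
    (hw : ∀ q < e, v (b + l.length * W + q) = w q) : Table v W b (l ++ [w]) e := by
  intro t w' ht q hq
  rcases Nat.lt_or_ge t l.length with h1 | h1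
  · rw [List.getElem?_append_left h1] at ht
    exact h t w' ht q hq
  · have h2 := (List.getElem?_eq_some_iff.mp ht).1
    rw [List.length_append, List.length_singleton] at h2
    obtain rfl : t = l.length := by omega
    rw [List.getElem?_concat_length, Option.some_inj] at ht
    rw [hw q hq, ht]

/-- Append the extension of the current partial word by the row `m 20 0` to the table. -/
def push : Prog :=
  .seq (.assign 19 (.const 0)) (.seq (.loop (.sub (.var 12) (.var 19))
    (.seq (.write 11 (.add (.var 15) (.var 19)) (.read 11 (.add (.var 13) (.var 19)))) (.incr 19)))
  (.seq (.write 11 (.add (.var 15) (.var 12)) (.var 20))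
  (.seq (.assign 15 (.add (.var 15) (.add (.var 8) (.const 1)))) (.incr 16))))

/-- The source word ends before the destination `T`, so copying within the same array does not
disturb it. -/
theorem does_push {w : ℕ → ℕ} {e h r T k : ℕ} (h8 : m 8 0 = N) (h12 : m 12 0 = e) (h13 : m 13 0 = h)
    (h15 : m 15 0 = T) (h16 : m 16 0 = k) (h20 : m 20 0 = r) (hT : h + e ≤ T)
    (hw : ∀ q < e, m 11 (h + q) = w q) :
    Does push m (50 * (e + 1)) fun m' => Frame {11, 15, 16, 19} m m' ∧
      (∀ i < T, m' 11 i = m 11 i) ∧ (∀ q < e + 1, m' 11 (T + q) = Function.update w e r q) ∧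
      m' 15 0 = T + (N + 1) ∧ m' 16 0 = k + 1 := by
  refine Does.step_assign (by simp only [Expr.cost]; omega) (Does.step (Does.loop_const (T := 30)
    (fun k m' => Frame {11, 19} m m' ∧ m' 19 0 = k ∧ (∀ i < T, m' 11 i = m 11 i) ∧
      ∀ q < k, m' 11 (T + q) = w q) e ⟨?_, ?_, ?_, ?_⟩ ?_ (Q := fun m' => Frame {11, 19} m m' ∧
      (∀ i < T, m' 11 i = m 11 i) ∧ ∀ q < e, m' 11 (T + q) = w q) ?_) ?_ ?_)
  · exact (Frame.refl _ _).set (by simp) _ _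
  · rw [Mem.set_same]; rfl
  · intro i _; rw [Mem.set_ne _ (by simp)]
  · intro q hq; exact absurd hq (Nat.not_lt_zero q)
  · rintro q hq m₁ ⟨f₁, a19, alow, anew⟩
    have a12 : m₁ 12 0 = e := by rw [f₁ 12 (by simp), h12]
    have a13 : m₁ 13 0 = h := by rw [f₁ 13 (by simp), h13]
    have a15 : m₁ 15 0 = T := by rw [f₁ 15 (by simp), h15]
    refine ⟨by simp only [Expr.eval, a12, a19]; omega, Does.step_write
      (by simp only [Expr.cost]; omega) ((Does.incr ⟨?_, ?_, ?_, ?_⟩).mono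
      (by simp only [Expr.cost]; omega) fun _ h => h)⟩
    · exact (f₁.set (by simp) _ _).set (by simp) _ _
    · rw [Mem.set_same, Mem.set_ne _ (by simp), a19]
    · intro i hi
      rw [Mem.set_ne _ (by simp), Mem.set_idx, if_neg, alow i hi]
      simp only [Expr.eval, a15]; omega
    · intro q' hq'
      rw [Mem.set_ne _ (by simp), Mem.set_idx]
      simp only [Expr.eval, a15, a19, a13]
      split_ifs with he
      · obtain rfl : q' = q := by omega
        rw [alow _ (by omega), hw q' hq]
      · exact anew q' (by omega)
  · rintro m₁ ⟨f₁, a19, alow, anew⟩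
    have a12 : m₁ 12 0 = e := by rw [f₁ 12 (by simp), h12]
    exact ⟨by simp only [Expr.eval, a12, a19, Nat.sub_self], f₁, alow, anew⟩
  · simp only [Expr.cost]; omega
  · rintro m₁ ⟨f₁, alow, anew⟩
    have a8 : m₁ 8 0 = N := by rw [f₁ 8 (by simp), h8]
    have a12 : m₁ 12 0 = e := by rw [f₁ 12 (by simp), h12]
    have a15 : m₁ 15 0 = T := by rw [f₁ 15 (by simp), h15]
    have a16 : m₁ 16 0 = k := by rw [f₁ 16 (by simp), h16]
    have a20 : m₁ 20 0 = r := by rw [f₁ 20 (by simp), h20]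
    refine Does.step_write (by simp only [Expr.cost]; omega) (Does.step_assign
      (by simp only [Expr.cost]; omega) ((Does.incr ⟨?_, ?_, ?_, ?_, ?_⟩).mono
      (by simp only [Expr.cost]; omega) fun _ h => h))
    · exact (((f₁.mono (by decide)).set (by simp) _ _).set (by simp) _ _).set (by simp) _ _
    · intro i hi
      rw [Mem.set_ne _ (by simp), Mem.set_ne _ (by simp), Mem.set_idx, if_neg, alow i hi]
      simp only [Expr.eval, a15]; omega
    · intro q hq
      rw [Mem.set_ne _ (by simp), Mem.set_ne _ (by simp), Mem.set_idx]
      simp only [Expr.eval, a15, a12, a20]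
      split_ifs with he
      · obtain rfl : q = e := by omega
        rw [Function.update_self]
      · rw [Function.update_of_ne (by omega), anew q (by omega)]
    · rw [Mem.set_ne _ (by simp), Mem.set_same]
      simp only [Expr.eval]
      rw [Mem.set_ne _ (by simp), Mem.set_ne _ (by simp), a15, a8]
    · rw [Mem.set_same, Mem.set_ne _ (by simp), Mem.set_ne _ (by simp), a16]

/-- Append all the extensions of the current partial word to the table. -/
def extendAll : Prog :=
  .seq (.assign 20 (.const 0)) (.loop (.sub (.var 6) (.var 20))
    (.seq testAdd (.seq (.ite (.var 21) .skip push) (.incr 20))))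

theorem does_extendAll (he : Env lam mu V N m) {w : ℕ → ℕ} {e h T k : ℕ} (h12 : m 12 0 = e)
    (h13 : m 13 0 = h) (h15 : m 15 0 = T) (h16 : m 16 0 = k) (hT : h + e ≤ T) (heN : e < N)
    (hw : ∀ q < e, m 11 (h + q) = w q) (h18 : ∀ i < lam.colLen 0, m 18 i = rowFill mu w e i) :
    Does extendAll m (200 * (lam.card + 1) * (N + 1)) fun m' =>
      Frame {11, 15, 16, 19, 20, 21} m m' ∧ (∀ i < T, m' 11 i = m 11 i) ∧
      m' 15 0 = T + (extensions lam mu V e (lam.colLen 0) w).length * (N + 1) ∧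
      m' 16 0 = k + (extensions lam mu V e (lam.colLen 0) w).length ∧
      Table (m' 11) (N + 1) T (extensions lam mu V e (lam.colLen 0) w) (e + 1) := by
  have hcl := colLen_le_card lam
  refine Does.step_assign (by simp only [Expr.cost]; nlinarith) (Does.mono (Does.loop_const
    (T := 170 + 50 * N) (fun r m' =>
      Frame {11, 15, 16, 19, 20, 21} m m' ∧ (∀ i < T, m' 11 i = m 11 i) ∧ m' 20 0 = r ∧
      m' 15 0 = T + (extensions lam mu V e r w).length * (N + 1) ∧
      m' 16 0 = k + (extensions lam mu V e r w).length ∧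
      Table (m' 11) (N + 1) T (extensions lam mu V e r w) (e + 1)) (lam.colLen 0)
    ⟨?_, ?_, ?_, ?_, ?_, ?_⟩ ?_ ?_) ?_ fun _ h => h)
  · exact (Frame.refl _ _).set (by simp) _ _
  · intro i _; rw [Mem.set_ne _ (by simp)]
  · rw [Mem.set_same]; rfl
  · rw [Mem.set_ne _ (by simp), h15]; simp [extensions]
  · rw [Mem.set_ne _ (by simp), h16]; simp [extensions]
  · exact Table.nil _ _ _ _
  · rintro r hr m₁ ⟨f₁, alow, a20, a15, a16, atab⟩
    have e₁ := he.frame (f₁.mono (by decide))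
    have a12 : m₁ 12 0 = e := by rw [f₁ 12 (by simp), h12]
    have a13 : m₁ 13 0 = h := by rw [f₁ 13 (by simp), h13]
    refine ⟨by simp only [Expr.eval, e₁.rows, a20]; omega, ?_⟩
    refine Does.step (does_testAdd e₁ a12 a13 a20 hr (fun q hq => by rw [alow _ (by omega), hw q hq])
      (fun i hi => by rw [f₁ 18 (by simp), h18 i hi])) (by omega) ?_
    rintro m₂ ⟨f₂, hiff⟩
    have f₂' : Frame {11, 15, 16, 19, 20, 21} m m₂ := f₁.trans (f₂.mono (by decide))
    have b11 : m₂ 11 = m₁ 11 := f₂ 11 (by simp)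
    rw [← f₂ 15 (by simp)] at a15
    rw [← f₂ 16 (by simp)] at a16
    rw [← f₂ 20 (by simp)] at a20
    refine Does.step (T₁ := 3 + 50 * (e + 1)) (R := fun m' =>
      Frame {11, 15, 16, 19, 20, 21} m m' ∧ (∀ i < T, m' 11 i = m 11 i) ∧ m' 20 0 = r ∧
      m' 15 0 = T + (extensions lam mu V e (r + 1) w).length * (N + 1) ∧
      m' 16 0 = k + (extensions lam mu V e (r + 1) w).length ∧
      Table (m' 11) (N + 1) T (extensions lam mu V e (r + 1) w) (e + 1))
      ((Does.ite (T := 50 * (e + 1)) (fun hne => ?_) fun h0 => ?_).mono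
        (by simp only [Expr.cost]; omega) fun _ h => h) (by omega) ?_
    · rw [Expr.eval_var] at hne
      rw [extensions_succ_of_not fun hc => hne (hiff.mpr hc)]
      refine (Does.skip ⟨f₂', ?_, a20, a15, a16, ?_⟩).mono (by omega) fun _ h => h
      · rw [b11]; exact alow
      · rw [b11]; exact atab
    · rw [Expr.eval_var] at h0
      have hc := hiff.mp h0
      refine (does_push (w := w) (e := e) (h := h) (N := N) ?_ ?_ ?_ a15 a16 a20 (by omega) ?_).mono le_rfl ?_
      · rw [f₂ 8 (by simp), e₁.size]
      · rw [f₂ 12 (by simp), a12]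
      · rw [f₂ 13 (by simp), a13]
      · intro q hq; rw [b11, alow _ (by omega), hw q hq]
      · rintro m₃ ⟨f₃, blow, bnew, b15, b16⟩
        rw [extensions_succ hc, List.length_append, List.length_singleton]
        refine ⟨f₂'.trans (f₃.mono (by decide)), ?_, ?_, ?_, ?_, ?_⟩
        · intro i hi; rw [blow i (by omega), b11, alow i hi]
        · rw [f₃ 20 (by simp), a20]
        · rw [b15]; ring
        · rw [b16, add_assoc]
        · refine Table.concat (atab.congr (by omega) fun i hi => ?_) bnew
          rw [blow i hi, b11]
    · rintro m₃ ⟨f₃, c11, c20, c15, c16, ctab⟩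
      refine (Does.incr ⟨f₃.set (by simp) _ _, ?_, ?_, ?_, ?_, ?_⟩).mono (by omega) fun _ h => h
      · intro i hi; rw [Mem.set_ne _ (by simp), c11 i hi]
      · rw [Mem.set_same, c20]
      · rw [Mem.set_ne _ (by simp), c15]
      · rw [Mem.set_ne _ (by simp), c16]
      · rw [Mem.set_ne _ (by simp)]; exact ctab
  · rintro m₁ ⟨f₁, alow, a20, a15, a16, atab⟩
    have e₁ := he.frame (f₁.mono (by decide))
    exact ⟨by simp only [Expr.eval, e₁.rows, a20, Nat.sub_self], f₁, alow, a15, a16, atab⟩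
  · have h1 := Nat.mul_le_mul hcl (show 50 * N + 176 ≤ 200 * (N + 1) by omega)
    have h2 : 200 * (lam.card + 1) * (N + 1) = lam.card * (200 * (N + 1)) + 200 * (N + 1) := by ring
    simp only [Expr.cost]
    rw [show 170 + 50 * N + (1 + (1 + (1 + 1) + (1 + 1))) = 50 * N + 176 by ring]
    omega

end RAM


/-! ### Building the tables of partial words level by level. -/

namespace RAM

variable {lam mu nu : YoungDiagram} {V : ℕ → ℕ} {N : ℕ} {m m' : Mem}

/-- The current table, which starts at the index `b`, consists of the partial words of length `e`. -/
structure Level (lam mu : YoungDiagram) (V : ℕ → ℕ) (N e b : ℕ) (m : Mem) : Prop where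
  env : Env lam mu V N m
  length_eq : m 12 0 = e
  start : m 13 0 = b
  count : m 14 0 = (words lam mu V e).length
  table : Table (m 11) (N + 1) b (words lam mu V e) e

/-- Proceed to the next word of the table. -/
def nextWord : Prog := .seq (.assign 13 (.add (.var 13) (.add (.var 8) (.const 1)))) (.incr 17)

theorem does_nextWord {h t : ℕ} (h8 : m 8 0 = N) (h13 : m 13 0 = h) (h17 : m 17 0 = t) :
    Does nextWord m 20 fun m' => Frame {13, 17} m m' ∧ m' 13 0 = h + (N + 1) ∧ m' 17 0 = t + 1 := by
  refine Does.step_assign (by simp only [Expr.cost]; omega) ((Does.incr ⟨?_, ?_, ?_⟩).mono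
    (by simp only [Expr.cost]; omega) fun _ h => h)
  · exact ((Frame.refl _ _).set (by simp) _ _).set (by simp) _ _
  · rw [Mem.set_ne _ (by simp), Mem.set_same]
    simp only [Expr.eval, h8, h13]
  · rw [Mem.set_same, Mem.set_ne _ (by simp), h17]

/-- Replace the current table, of the partial words of length `e`, by the one for `e + 1`. -/
def extendTable : Prog :=
  .seq (.assign 16 (.const 0)) (.seq (.assign 17 (.const 0))
  (.seq (.loop (.sub (.var 14) (.var 17)) (.seq resetFill (.seq replay (.seq extendAll nextWord))))
  (.seq (.assign 14 (.var 16)) (.incr 12))))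

theorem take_succ_flatMap {α β : Type*} (f : α → List β) {l : List α} {t : ℕ} (ht : t < l.length) :
    (l.take (t + 1)).flatMap f = (l.take t).flatMap f ++ f l[t] := by
  rw [List.take_succ_eq_append_getElem ht, List.flatMap_append, List.flatMap_singleton]

theorem Table.append {v : ℕ → ℕ} {W b e : ℕ} {l l' : List (ℕ → ℕ)} (h : Table v W b l e)
    (h' : Table v W (b + l.length * W) l' e) : Table v W b (l ++ l') e := by
  intro t w ht q hq
  rcases Nat.lt_or_ge t l.length with h1 | h1
  · rw [List.getElem?_append_left h1] at ht
    exact h t w ht q hq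
  · rw [List.getElem?_append_right h1] at ht
    rw [← h' _ w ht q hq]
    obtain ⟨d, rfl⟩ := Nat.exists_eq_add_of_le h1
    rw [Nat.add_sub_cancel_left, Nat.add_mul]
    congr 1
    ring

/-- The new table is appended directly behind the old one, which stays intact while it is read.
After the last old word the pointer `13` stands at the start of the new table. -/
theorem does_extendTable {e b : ℕ} (hl : Level lam mu V N e b m)
    (h15 : m 15 0 = b + (words lam mu V e).length * (N + 1)) (heN : e < N) (hN : N ≤ lam.card) :
    Does extendTable m ((words lam mu V e).length * (400 * (lam.card + 1) ^ 2) + 30) fun m' =>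
      Frame genVars m m' ∧
      Level lam mu V N (e + 1) (b + (words lam mu V e).length * (N + 1)) m' ∧
      m' 15 0 = b + (words lam mu V e).length * (N + 1) +
        (words lam mu V (e + 1)).length * (N + 1) := by
  set l := words lam mu V e with hldef
  set b' := b + l.length * (N + 1) with hb'
  set ext := extensions lam mu V e (lam.colLen 0) with hext
  -- `394` instead of `400` leaves room for the `6` steps of the loop condition.
  have hcost : 50 * (lam.card + 1) + 50 * (e + 1) + 200 * (lam.card + 1) * (N + 1) + 20 ≤ 394 * (lam.card + 1) ^ 2 := by
    nlinarith
  refine Does.step_assign (by simp only [Expr.cost]; omega) (Does.step_assign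
    (by simp only [Expr.cost]; omega) (Does.step (Does.loop_const
    (T := 394 * (lam.card + 1) ^ 2) (fun t m' => Frame genVars m m' ∧ m' 12 0 = e ∧
      m' 13 0 = b + t * (N + 1) ∧ m' 14 0 = l.length ∧
      m' 15 0 = b' + ((l.take t).flatMap ext).length * (N + 1) ∧
      m' 16 0 = ((l.take t).flatMap ext).length ∧ m' 17 0 = t ∧
      (∀ i < b', m' 11 i = m 11 i) ∧
      Table (m' 11) (N + 1) b' ((l.take t).flatMap ext) (e + 1)) l.length
      ⟨?_, ?_, ?_, ?_, ?_, ?_, ?_, ?_, ?_⟩ ?_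
      (Q := fun m' => Frame genVars m m' ∧ m' 12 0 = e ∧ m' 13 0 = b' ∧
        m' 15 0 = b' + (l.flatMap ext).length * (N + 1) ∧ m' 16 0 = (l.flatMap ext).length ∧
        Table (m' 11) (N + 1) b' (l.flatMap ext) (e + 1)) ?_) ?_ ?_))
  · exact ((Frame.refl _ _).set (by simp [genVars]) _ _).set (by simp [genVars]) _ _
  · rw [Mem.set_ne _ (by simp), Mem.set_ne _ (by simp), hl.length_eq]
  · rw [Mem.set_ne _ (by simp), Mem.set_ne _ (by simp), hl.start]; simp
  · rw [Mem.set_ne _ (by simp), Mem.set_ne _ (by simp), hl.count]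
  · rw [Mem.set_ne _ (by simp), Mem.set_ne _ (by simp), h15]; simp
  · rw [Mem.set_ne _ (by simp), Mem.set_same]; simp [Expr.eval]
  · rw [Mem.set_same]; rfl
  · intro i _; rw [Mem.set_ne _ (by simp), Mem.set_ne _ (by simp)]
  · rw [List.take_zero, List.flatMap_nil]; exact Table.nil _ _ _ _
  · rintro t ht m₁ ⟨f₁, a12, a13, a14, a15, a16, a17, alow, atab⟩
    have e₁ := hl.env.frame f₁
    refine ⟨by simp only [Expr.eval, a14, a17]; omega, ?_⟩
    have hmul := Nat.mul_le_mul_right (N + 1) (show t + 1 ≤ l.length from ht)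
    rw [Nat.add_mul, one_mul] at hmul
    have hword : IsWord lam mu V e l[t] := mem_words.mp (List.getElem_mem ht)
    have hw₁ : ∀ q < e, m₁ 11 (b + t * (N + 1) + q) = l[t] q := fun q hq => by
      rw [alow _ (by omega)]
      exact hl.table t _ (List.getElem?_eq_getElem ht) q hq
    refine Does.step (does_resetFill e₁) (by omega) ?_
    rintro m₂ ⟨f₂, b18⟩
    have e₂ := e₁.frame (f₂.mono (by decide))
    have b11 : m₂ 11 = m₁ 11 := f₂ 11 (by simp)
    have b12 : m₂ 12 0 = e := by rw [f₂ 12 (by simp), a12]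
    have b13 : m₂ 13 0 = b + t * (N + 1) := by rw [f₂ 13 (by simp), a13]
    refine Does.step (does_replay (w := l[t]) b12 b13 (by rw [b11]; exact hw₁)
      (fun q hq => (hword.step q hq).lt_colLen) b18) (by omega) ?_
    rintro m₃ ⟨f₃, c18⟩
    have e₃ := e₂.frame (f₃.mono (by decide))
    have c11 : m₃ 11 = m₁ 11 := by rw [f₃ 11 (by simp), b11]
    have c12 : m₃ 12 0 = e := by rw [f₃ 12 (by simp), b12]
    have c13 : m₃ 13 0 = b + t * (N + 1) := by rw [f₃ 13 (by simp), b13]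
    refine Does.step (does_extendAll e₃ c12 c13 (by rw [f₃ 15 (by simp), f₂ 15 (by simp), a15])
      (by rw [f₃ 16 (by simp), f₂ 16 (by simp), a16]) (by omega) heN
      (by rw [c11]; exact hw₁) c18) (by omega) ?_
    rintro m₄ ⟨f₄, dlow, d15, d16, dtab⟩
    have e₄ := e₃.frame (f₄.mono (by decide))
    refine (does_nextWord e₄.size (by rw [f₄ 13 (by simp), c13])
      (by rw [f₄ 17 (by simp), f₃ 17 (by simp), f₂ 17 (by simp), a17])).mono (by omega) ?_
    rintro m₅ ⟨f₅, g13, g17⟩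
    rw [take_succ_flatMap _ ht, List.length_append]
    refine ⟨?_, ?_, ?_, ?_, ?_, ?_, g17, ?_, ?_⟩
    · exact (((f₁.trans (f₂.mono (by decide))).trans (f₃.mono (by decide))).trans
        (f₄.mono (by decide))).trans (f₅.mono (by decide))
    · rw [f₅ 12 (by simp), f₄ 12 (by simp), c12]
    · rw [g13]; ring
    · rw [f₅ 14 (by simp), f₄ 14 (by simp), f₃ 14 (by simp), f₂ 14 (by simp), a14]
    · rw [f₅ 15 (by simp), d15]; ring
    · rw [f₅ 16 (by simp), d16]
    · intro i hi; rw [f₅ 11 (by simp), dlow i (by omega), c11, alow i hi]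
    · rw [f₅ 11 (by simp)]
      refine Table.append (atab.congr (by omega) fun i hi => ?_) dtab
      rw [dlow i hi, c11]
  · rintro m₁ ⟨f₁, a12, a13, a14, a15, a16, a17, alow, atab⟩
    rw [List.take_length] at a15 a16 atab
    exact ⟨by simp only [Expr.eval, a14, a17, Nat.sub_self], f₁, a12, a13, a15, a16, atab⟩
  · simp only [Expr.cost]
    have := Nat.mul_le_mul_left l.length (show
      394 * (lam.card + 1) ^ 2 + (1 + (1 + (1 + 1) + (1 + 1))) ≤ 400 * (lam.card + 1) ^ 2 by nlinarith)
    omega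
  · rintro m₁ ⟨f₁, a12, a13, a15, a16, atab⟩
    have := Nat.mul_le_mul_left l.length (show
      394 * (lam.card + 1) ^ 2 + (1 + (1 + (1 + 1) + (1 + 1))) ≤ 400 * (lam.card + 1) ^ 2 by nlinarith)
    refine Does.step_assign (by simp only [Expr.cost]; omega) ((Does.incr ⟨?_, ⟨?_, ?_, ?_, ?_, ?_⟩, ?_⟩).mono
      (by simp only [Expr.cost]; omega) fun _ h => h)
    · exact (f₁.set (by simp [genVars]) _ _).set (by simp [genVars]) _ _
    · exact hl.env.frame ((f₁.set (by simp [genVars]) _ _).set (by simp [genVars]) _ _)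
    · rw [Mem.set_same, Mem.set_ne _ (by simp), a12]
    · rw [Mem.set_ne _ (by simp), Mem.set_ne _ (by simp), a13]
    · rw [Mem.set_ne _ (by simp), Mem.set_same, Expr.eval_var, a16]; rfl
    · rw [Mem.set_ne _ (by simp), Mem.set_ne _ (by simp)]; exact atab
    · rw [Mem.set_ne _ (by simp), Mem.set_ne _ (by simp), a15]; rfl

/-- Compute the table of all the words. -/
def allWords : Prog :=
  .seq (.assign 12 (.const 0)) (.seq (.assign 13 (.const 0)) (.seq (.assign 14 (.const 1))
  (.seq (.assign 15 (.add (.var 8) (.const 1)))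
  (.loop (.sub (.var 8) (.var 12)) extendTable))))

theorem does_allWords (he : Env lam mu V N m) (hN : N ≤ lam.card) {f : ℕ}
    (hf : ∀ e ≤ N, (words lam mu V e).length ≤ f) :
    Does allWords m (N * (f * (400 * (lam.card + 1) ^ 2) + 40) + 40) fun m' =>
      Frame genVars m m' ∧ ∃ b, Level lam mu V N N b m' := by
  refine Does.step_assign (by simp only [Expr.cost]; omega) (Does.step_assign
    (by simp only [Expr.cost]; omega) (Does.step_assign
    (by simp only [Expr.cost]; omega) (Does.step_assign
    (by simp only [Expr.cost]; omega) ?_)))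
  set m₀ := (((m.set 12 0 _).set 13 0 _).set 14 0 _).set 15 0 _ with hm₀
  have f₀ : Frame genVars m m₀ := ((((Frame.refl _ _).set (by simp [genVars]) _ _).set
    (by simp [genVars]) _ _).set (by simp [genVars]) _ _).set (by simp [genVars]) _ _
  refine Does.mono (Does.loop_const (T := f * (400 * (lam.card + 1) ^ 2) + 30)
    (fun e m' => Frame genVars m m' ∧ ∃ b, Level lam mu V N e b m' ∧
      m' 15 0 = b + (words lam mu V e).length * (N + 1)) N ⟨f₀, 0, ⟨he.frame f₀, ?_, ?_, ?_, ?_⟩, ?_⟩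
    ?_ ?_) ?_ fun _ h => h
  · rw [hm₀, Mem.set_ne _ (by simp), Mem.set_ne _ (by simp), Mem.set_ne _ (by simp), Mem.set_same]; rfl
  · rw [hm₀, Mem.set_ne _ (by simp), Mem.set_ne _ (by simp), Mem.set_same]; rfl
  · rw [hm₀, Mem.set_ne _ (by simp), Mem.set_same]; rfl
  · exact fun t w _ q hq => absurd hq (Nat.not_lt_zero q)
  · rw [hm₀, Mem.set_same]
    simp only [Expr.eval, words, List.length_singleton, zero_add, one_mul]
    rw [Mem.set_ne _ (by simp), Mem.set_ne _ (by simp), Mem.set_ne _ (by simp), he.size]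
  · rintro e heN m₁ ⟨f₁, b, hl, h15⟩
    refine ⟨by simp only [Expr.eval, hl.env.size, hl.length_eq]; omega,
      (does_extendTable hl h15 heN hN).mono ?_ ?_⟩
    · have := Nat.mul_le_mul_right (400 * (lam.card + 1) ^ 2) (hf e heN.le)
      omega
    · rintro m₂ ⟨f₂, hl', h15'⟩
      exact ⟨f₁.trans f₂, _, hl', h15'⟩
  · rintro m₁ ⟨f₁, b, hl, h15⟩
    exact ⟨by simp only [Expr.eval, hl.env.size, hl.length_eq, Nat.sub_self], f₁, b, hl⟩
  · simp only [Expr.cost]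
    rw [show f * (400 * (lam.card + 1) ^ 2) + 30 + (1 + (1 + (1 + 1) + (1 + 1))) =
      f * (400 * (lam.card + 1) ^ 2) + 36 by ring]
    have := Nat.mul_le_mul_left N (show f * (400 * (lam.card + 1) ^ 2) + 36 ≤
      f * (400 * (lam.card + 1) ^ 2) + 40 by omega)
    omega

end RAM


/-! ### Writing the tableaux of the complete words. -/

namespace RAM

variable {lam mu nu : YoungDiagram} {V c : ℕ → ℕ} {N : ℕ} {m m' : Mem}

/-- Write the entries of the tableau of the word that starts at the index `m 13 0` of the array `11` to
the output array. -/
def writeTableau : Prog :=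
  .seq (.assign 19 (.const 0)) (.loop (.sub (.var 8) (.var 19))
    (.seq (.assign 20 (.read 11 (.add (.var 13) (.var 19))))
    (.seq (.write outArr (.add (.read 5 (.var 20))
        (.sub (.read 18 (.var 20)) (.read 1 (.var 20)))) (.read 7 (.var 19)))
    (.seq (.write 18 (.var 20) (.add (.read 18 (.var 20)) (.const 1))) (.incr 19)))))

/-- The cell inserted at time `q` belongs to the `I`-th shape of the chain exactly when `q < c I`,
that is, when its letter is `< I`. -/
theorem entry_rowFill {w : ℕ → ℕ} (hV : LetterCount N V c) (h : IsWord lam mu V N w)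
    {S : SkewSSYT lam mu} (hS : S.toChain = fun I k => rowFill mu w (c I) k) {q : ℕ} (hq : q < N) :
    S.entry (w q) (rowFill mu w q (w q)) = V q := by
  have hc : (w q, rowFill mu w q (w q)) ∈ skewCells lam mu :=
    mem_skewCells.mpr ⟨Nat.le_add_right _ _, (h.step q hq).lt⟩
  refine eq_of_forall_gt_iff fun I => ?_
  rw [S.lt_iff_lt_toChain hc I, hS, hV.lt_iff q hq I]
  constructor
  · intro hlt
    by_contra hge
    exact absurd hlt (not_lt.mpr (rowFill_mono w (by omega) (w q)))
  · intro hlt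
    have := rowFill_mono (mu := mu) w (show q + 1 ≤ c I from hlt) (w q)
    rw [rowFill_succ, if_pos rfl] at this
    exact this

/-- Different cells have different places in the output array, so no entry written earlier is
overwritten. -/
theorem rowEnds_add_inj {i j i' j' : ℕ} (hj : mu.rowLen i ≤ j) (hj' : j < lam.rowLen i)
    (hk : mu.rowLen i' ≤ j') (hk' : j' < lam.rowLen i')
    (h : rowEnds lam mu i + (j - mu.rowLen i) = rowEnds lam mu i' + (j' - mu.rowLen i')) :
    i = i' ∧ j = j' := by
  have key : ∀ a b x y : ℕ, a < b → mu.rowLen a ≤ x → x < lam.rowLen a →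
      rowEnds lam mu a + (x - mu.rowLen a) < rowEnds lam mu b + y := by
    intro a b x y hab h1 h2
    have h3 := rowEnds_mono lam mu (show a + 1 ≤ b from hab)
    rw [rowEnds_succ] at h3
    omega
  rcases lt_trichotomy i i' with hlt | rfl | hlt
  · exact absurd h (key _ _ _ _ hlt hj hj').ne
  · omega
  · exact absurd h.symm (key _ _ _ _ hlt hk hk').ne

theorem does_writeTableau (he : Env lam mu V N m) {w : ℕ → ℕ} {h : ℕ}
    (hle : ∀ k, mu.rowLen k ≤ lam.rowLen k) (hV : LetterCount N V c) (hword : IsWord lam mu V N w)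
    (h13 : m 13 0 = h) (hw : ∀ q < N, m 11 (h + q) = w q)
    (h18 : ∀ i < lam.colLen 0, m 18 i = mu.rowLen i) :
    Does writeTableau m (50 * (N + 1)) fun m' => Frame {3, 18, 19, 20} m m' ∧
      ∀ S : SkewSSYT lam mu, S.toChain = (fun I k => rowFill mu w (c I) k) →
        Represents (m' outArr) S := by
  refine Does.step_assign (by simp only [Expr.cost]; omega) (Does.mono (Does.loop_const
    (T := 40) (fun q m' => Frame {3, 18, 19, 20} m m' ∧ m' 19 0 = q ∧
      (∀ i < lam.colLen 0, m' 18 i = rowFill mu w q i) ∧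
      ∀ S : SkewSSYT lam mu, S.toChain = (fun I k => rowFill mu w (c I) k) →
        ∀ i j, mu.rowLen i ≤ j → j < rowFill mu w q i →
          m' outArr (rowEnds lam mu i + (j - mu.rowLen i)) = S.entry i j) N
    ⟨?_, ?_, ?_, ?_⟩ ?_ ?_) ?_ fun _ h => h)
  · exact (Frame.refl _ _).set (by simp) _ _
  · rw [Mem.set_same]; rfl
  · intro i hi; rw [Mem.set_ne _ (by simp), h18 i hi, rowFill_zero]
  · intro S _ i j h1 h2
    rw [rowFill_zero] at h2
    omega
  · rintro q hq m₁ ⟨f₁, a19, a18, aout⟩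
    have e₁ := he.frame (f₁.mono (by decide))
    have a11 : m₁ 11 (h + q) = w q := by rw [f₁ 11 (by simp), hw q hq]
    have a13 : m₁ 13 0 = h := by rw [f₁ 13 (by simp), h13]
    have hadd := hword.step q hq
    have hr := hadd.lt_colLen
    refine ⟨by simp only [Expr.eval, e₁.size, a19]; omega,
      Does.step_assign (by simp only [Expr.cost]; omega) ?_⟩
    generalize hm₂ : m₁.set 20 0 (Expr.eval m₁ _) = m₂
    have f₂ : Frame {20} m₁ m₂ := by rw [← hm₂]; exact (Frame.refl _ _).set (by simp) _ _
    have b20 : m₂ 20 0 = w q := by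
      rw [← hm₂, Mem.set_same]; simp only [Expr.eval, a13, a19, a11]
    have b18 : m₂ 18 (w q) = rowFill mu w q (w q) := by rw [f₂ 18 (by simp), a18 _ hr]
    have b5 : m₂ 5 (w q) = rowEnds lam mu (w q) := by rw [f₂ 5 (by simp), e₁.ends _ hr.le]
    have b1 : m₂ 1 = mu.rowLen := by rw [f₂ 1 (by simp), e₁.mu_eq]
    have b7 : m₂ 7 = V := by rw [f₂ 7 (by simp), e₁.letters]
    have b19 : m₂ 19 0 = q := by rw [f₂ 19 (by simp), a19]
    refine Does.step_write (by simp only [Expr.cost]; omega) ?_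
    generalize hm₃ : m₂.set outArr (Expr.eval m₂ _) (Expr.eval m₂ _) = m₃
    have f₃ : Frame {3} m₂ m₃ := by rw [← hm₃]; exact (Frame.refl _ _).set (by simp [outArr]) _ _
    have f₃' : Frame {3, 18, 19, 20} m m₃ :=
      (f₁.trans (f₂.mono (by decide))).trans (f₃.mono (by decide))
    have c20 : m₃ 20 0 = w q := by rw [f₃ 20 (by simp), b20]
    refine Does.step_write (by simp only [Expr.cost]; omega) ((Does.incr ⟨?_, ?_, ?_, ?_⟩).mono
      (by simp only [Expr.cost]; omega) fun _ h => h)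
    · exact (f₃'.set (by simp) _ _).set (by simp) _ _
    · rw [Mem.set_same, Mem.set_ne _ (by simp), f₃ 19 (by simp), b19]
    · intro i hi
      rw [Mem.set_ne _ (by simp), Mem.set_idx, rowFill_succ]
      simp only [Expr.eval, c20, f₃ 18 (by simp), b18]
      split_ifs with h1 h2 h2
      · rw [h1]
      · exact absurd h1.symm h2
      · exact absurd h2.symm h1
      · rw [f₂ 18 (by simp), a18 i hi]; rfl
    · intro S hS i j h1 h2
      rw [Mem.set_ne _ (by simp [outArr]), Mem.set_ne _ (by simp [outArr]), ← hm₃, Mem.set_idx]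
      simp only [Expr.eval, b20, b18, b5, b1, b7, b19]
      have hj : j < lam.rowLen i := h2.trans_le (rowFill_le hle hword.step hq i)
      split_ifs with hp
      · obtain ⟨rfl, rfl⟩ := rowEnds_add_inj h1 hj (Nat.le_add_right _ _) hadd.lt hp
        exact (entry_rowFill hV hword hS hq).symm
      · rw [f₂ outArr (by simp [outArr])]
        refine aout S hS i j h1 ?_
        rw [rowFill_succ] at h2
        split_ifs at h2 with hi
        · subst hi
          rcases Nat.lt_succ_iff_lt_or_eq.mp h2 with h3 | rfl
          · exact h3
          · exact absurd rfl hp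
        · exact h2
  · rintro m₁ ⟨f₁, a19, a18, aout⟩
    have e₁ := he.frame (f₁.mono (by decide))
    refine ⟨by simp only [Expr.eval, e₁.size, a19, Nat.sub_self], f₁, fun S hS i j hc => ?_⟩
    have hij := mem_skewCells.mp hc
    refine aout S hS i j hij.1 ?_
    have := (S.lt_iff_lt_toChain hc (S.entry i j + 1)).mp (Nat.lt_succ_self _)
    rw [hS] at this
    exact this.trans_le (rowFill_mono w (hV.le _) i)
  · simp only [Expr.cost]; omega

theorem Emits.emit {Q : List (ℕ → ℕ) → Mem → Prop} (h : Q [m outArr] m) : Emits .emit m 1 Q :=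
  ⟨_, _, _, .emit m, le_rfl, h⟩

/-- Output the tableaux of all the words of the table. -/
def writeAll : Prog :=
  .seq (.assign 17 (.const 0)) (.loop (.sub (.var 14) (.var 17))
    (.seq resetFill (.seq writeTableau (.seq .emit nextWord))))

theorem emits_writeAll {b : ℕ} (hl : Level lam mu V N N b m) (hN : N ≤ lam.card)
    (hle : ∀ k, mu.rowLen k ≤ lam.rowLen k) (hV : LetterCount N V c) :
    Emits writeAll m ((words lam mu V N).length * (200 * (lam.card + 1)) + 20) fun out _ =>
      List.Forall₂ (fun v w => ∀ S : SkewSSYT lam mu,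
        S.toChain = (fun I k => rowFill mu w (c I) k) → Represents v S) out (words lam mu V N) := by
  set l := words lam mu V N with hldef
  refine Emits.mono (Does.seq_emits (Does.assign (Emits.loop (T := fun _ => 150 * (lam.card + 1))
    (fun t o m' => Frame genVars m m' ∧ (∀ i, m' 11 i = m 11 i) ∧ m' 13 0 = b + t * (N + 1) ∧
      m' 14 0 = l.length ∧ m' 17 0 = t ∧
      List.Forall₂ (fun v w => ∀ S : SkewSSYT lam mu,
        S.toChain = (fun I k => rowFill mu w (c I) k) → Represents v S) o (l.take t)) l.length
    ⟨?_, ?_, ?_, ?_, ?_, ?_⟩ ?_ ?_))) ?_ fun _ _ h => h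
  · exact (Frame.refl _ _).set (by simp [genVars]) _ _
  · intro i; rw [Mem.set_ne _ (by simp)]
  · rw [Mem.set_ne _ (by simp), hl.start]; simp
  · rw [Mem.set_ne _ (by simp), hl.count]
  · rw [Mem.set_same]; rfl
  · rw [List.take_zero]; exact List.Forall₂.nil
  · rintro t ht o m₁ ⟨f₁, a11, a13, a14, a17, ao⟩
    have e₁ := hl.env.frame f₁
    refine ⟨by simp only [Expr.eval, a14, a17]; omega, ?_⟩
    have hword : IsWord lam mu V N l[t] := mem_words.mp (List.getElem_mem ht)
    refine Emits.mono (Does.seq_emits ((does_resetFill e₁).mono le_rfl fun m₂ h₂ =>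
      Does.seq_emits ((does_writeTableau (w := l[t]) (h := b + t * (N + 1)) (c := c)
        (e₁.frame (h₂.1.mono (by decide))) hle hV hword ?_ ?_ h₂.2).mono le_rfl fun m₃ h₃ =>
        Emits.seq (Emits.emit (Emits.mono (does_nextWord (N := N) (h := b + t * (N + 1)) (t := t)
          ?_ ?_ ?_) le_rfl ?_))))) ?_ fun _ _ h => h
    · rw [h₂.1 13 (by simp), a13]
    · intro q hq
      rw [h₂.1 11 (by simp), a11]
      exact hl.table t _ (List.getElem?_eq_getElem ht) q hq
    · rw [h₃.1 8 (by simp), h₂.1 8 (by simp), e₁.size]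
    · rw [h₃.1 13 (by simp), h₂.1 13 (by simp), a13]
    · rw [h₃.1 17 (by simp), h₂.1 17 (by simp), a17]
    · rintro o' m₄ ⟨rfl, f₄, b13, b17⟩
      refine ⟨?_, ?_, ?_, ?_, b17, ?_⟩
      · exact ((f₁.trans (h₂.1.mono (by decide))).trans (h₃.1.mono (by decide))).trans
          (f₄.mono (by decide))
      · intro i; rw [f₄ 11 (by simp), h₃.1 11 (by simp), h₂.1 11 (by simp), a11]
      · rw [b13]; ring
      · rw [f₄ 14 (by simp), h₃.1 14 (by simp), h₂.1 14 (by simp), a14]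
      · rw [List.take_succ_eq_append_getElem ht, List.append_nil]
        exact List.rel_append ao (List.Forall₂.cons h₃.2 List.Forall₂.nil)
    · omega
  · rintro o m₁ ⟨f₁, a11, a13, a14, a17, ao⟩
    rw [List.take_length] at ao
    exact ⟨by simp only [Expr.eval, a14, a17, Nat.sub_self], ao⟩
  · have := Nat.mul_le_mul_left l.length (show
      150 * (lam.card + 1) + (1 + (1 + (1 + 1) + (1 + 1))) ≤ 200 * (lam.card + 1) by omega)
    simp only [Expr.cost, Finset.sum_const, Finset.card_range, smul_eq_mul]
    omega

end RAM


/-! ### The complete generator and the final time bounds. -/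

namespace RAM

variable {lam mu nu : YoungDiagram} {N : ℕ} {m m' : Mem}

/-- Generate all the tableaux of a shape `lam/mu` and a type `nu`. -/
def genTableaux : Prog :=
  .seq (rowEndsProg 4 5 6) (.seq lettersProg
    (.ite (.add (.sub (.read 5 (.var 6)) (.var 8)) (.sub (.var 8) (.read 5 (.var 6)))) .skip
      (.seq allWords writeAll)))

theorem Emits.ite {e : Expr} {p q : Prog} {m : Mem} {T : ℕ} {Q : List (ℕ → ℕ) → Mem → Prop}
    (h1 : e.eval m ≠ 0 → Emits p m T Q) (h2 : e.eval m = 0 → Emits q m T Q) :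
    Emits (.ite e p q) m (1 + e.cost + T) Q := by
  by_cases he : e.eval m = 0
  · obtain ⟨o, t, m', hr, ht, hq⟩ := h2 he
    exact ⟨o, _, m', .ite_false he hr, by omega, hq⟩
  · obtain ⟨o, t, m', hr, ht, hq⟩ := h1 he
    exact ⟨o, _, m', .ite_true he hr, by omega, hq⟩

theorem rowEnds_colLen (lam mu : YoungDiagram) :
    rowEnds lam mu (lam.colLen 0) = (skewCells lam mu).card := by
  have h := SkewSSYT.card_filter_skewCells (lam := lam) (mu := mu) le_rfl fun _ _ => True
  simp only [Finset.filter_true, Nat.card_Ico] at h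
  rw [h]
  refine Finset.sum_subset (Finset.range_mono (colLen_le_card lam)) fun i _ hi => ?_
  have := (rowLen_ne_zero_iff lam i).not.mpr (by simpa using hi)
  omega

theorem rowSum_toChain {S : SkewSSYT lam mu} (hle : ∀ k, mu.rowLen k ≤ lam.rowLen k)
    (hS : S.HasType nu.rowLen) (I : ℕ) :
    rowSum lam.card S.toChain I = mu.card + letterSum nu I := by
  have hc := S.stripChain_toChain hle (SkewSSYT.entry_lt_of_hasType hS
    (N := nu.card) fun i hi => YoungDiagram.rowLen_eq_zero hi)
  have hcard : mu.card ≤ lam.card := by have := card_skewCells_add hle; omega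
  induction I with
  | zero => rw [rowSum, hc.bot, YoungDiagram.sum_rowLen hcard]; rfl
  | succ I ih =>
    rw [← content_add hc.lace, ih, letterSum_succ, ← S.entryCount_eq le_rfl, hS I]
    ring

/-- The words give the list of all the tableaux. -/
theorem exists_list_tableaux {V : ℕ → ℕ} (hle : ∀ k, mu.rowLen k ≤ lam.rowLen k)
    (hN : mu.card + nu.card = lam.card) (hV : LetterCount nu.card V (letterSum nu))
    {out : List (ℕ → ℕ)} (hout : List.Forall₂ (fun v w => ∀ S : SkewSSYT lam mu,
      S.toChain = (fun I k => rowFill mu w (letterSum nu I) k) → Represents v S) out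
        (words lam mu V nu.card)) :
    ∃ L : List (SkewSSYTOfType lam mu nu), L.Nodup ∧ (∀ T, T ∈ L) ∧
      List.Forall₂ (fun v T => Represents v T.1) out L := by
  have hex : ∀ w : {w // w ∈ words lam mu V nu.card}, ∃ T : SkewSSYTOfType lam mu nu,
      T.1.toChain = fun I k => rowFill mu w.1 (letterSum nu I) k := by
    rintro ⟨w, hw⟩
    have hw := mem_words.mp hw
    obtain ⟨S, hS⟩ := exists_tableau_of_word hle hN hV hw
    refine ⟨⟨S, ?_⟩, hS⟩
    simpa only [letterSum_succ, Nat.add_sub_cancel_left] using hasType_of_toChain_eq hN hV hw hS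
  choose tab htab using hex
  refine ⟨(words lam mu V nu.card).attach.map tab, ?_, ?_, ?_⟩
  · refine (List.nodup_attach.mpr (nodup_words _)).map fun w w' h => Subtype.ext ?_
    refine word_injective hV (mem_words.mp w.2) (mem_words.mp w'.2) fun I k => ?_
    have h1 := htab w
    rw [h, htab w'] at h1
    exact (congrFun (congrFun h1 I) k).symm
  · intro T
    obtain ⟨w, hw, h⟩ := exists_word hN hV (T.1.stripChain_toChain hle
      (SkewSSYT.entry_lt_of_hasType T.2 (N := nu.card) fun i hi => YoungDiagram.rowLen_eq_zero hi))
      (rowSum_toChain hle T.2)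
    refine List.mem_map.mpr ⟨⟨w, mem_words.mpr hw⟩, List.mem_attach _ _, Subtype.ext ?_⟩
    refine SkewSSYT.ext_toChain ?_
    rw [htab]
    funext I k
    exact h I k
  · rw [← List.attach_map_subtype_val (words lam mu V nu.card), List.forall₂_map_right_iff] at hout
    rw [List.forall₂_map_right_iff]
    exact hout.imp fun v w h => h _ (htab w)

theorem le_mul_cube {f n : ℕ} (hf : 0 < f) (hn : 0 < n) :
    1 ≤ f * n ^ 3 ∧ n ≤ f * n ^ 3 ∧ f * n ≤ f * n ^ 3 ∧ f * n ^ 2 ≤ f * n ^ 3 := by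
  have h1 : f * n ^ 2 ≤ f * n ^ 3 := Nat.mul_le_mul_left f (Nat.pow_le_pow_right hn (by omega))
  have h2 : f * n ≤ f * n ^ 3 := Nat.mul_le_mul_left f (Nat.le_self_pow (by omega) n)
  have h3 : n ≤ f * n := Nat.le_mul_of_pos_left n hf
  exact ⟨by omega, by omega, h2, h1⟩

/-- The preliminary comparison of |λ/μ| with |ν| also decides whether μ is contained in λ, which the
word construction presupposes. -/
theorem emits_genTableaux (hpos : 0 < lam.card) (hc : mu.card + nu.card = lam.card) :
    Emits genTableaux (input lam mu nu) (4000 * (numSkewSYT lam mu * lam.card ^ 3)) fun out _ =>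
      out.length ≤ numSkewSYT lam mu ∧ ∃ L : List (SkewSSYTOfType lam mu nu), L.Nodup ∧
        (∀ T, T ∈ L) ∧ List.Forall₂ (fun v T => Represents v T.1) out L := by
  have hf := numSkewSYT_pos lam mu
  have hN : nu.card ≤ lam.card := by omega
  set f := numSkewSYT lam mu with hfdef
  have hT : 40 * (lam.card + 1) + (100 * (nu.card + 1) + (30 + ((nu.card *
      (f * (400 * (lam.card + 1) ^ 2) + 40) + 40) + (f * (200 * (lam.card + 1)) + 20)))) ≤
      4000 * (f * lam.card ^ 3) := by
    obtain ⟨h1, h2, h3, h4⟩ := le_mul_cube hf hpos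
    generalize lam.card = n at *
    have h5 : (n + 1) ^ 2 ≤ 4 * n ^ 2 := by nlinarith
    have h6 := Nat.mul_le_mul hN (Nat.add_le_add_right (Nat.mul_le_mul_left f
      (Nat.mul_le_mul_left 400 h5)) 40)
    have h7 : n * (f * (400 * (4 * n ^ 2)) + 40) = 1600 * (f * n ^ 3) + 40 * n := by ring
    have h8 : f * (200 * (n + 1)) ≤ 400 * (f * n) :=
      (Nat.mul_le_mul_left f (show 200 * (n + 1) ≤ 400 * n by omega)).trans (by linarith)
    omega
  refine Emits.mono (Does.seq_emits ((does_rowEndsProg (lam := lam) (mu := mu) (by omega) (by omega)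
    (by omega) (by simp [input]) (by simp [input])).mono le_rfl fun m₁ h₁ => Does.seq_emits
    ((does_lettersProg (nu := nu) ?_).mono le_rfl fun m₂ h₂ => ((Emits.ite (T :=
      (nu.card * (f * (400 * (lam.card + 1) ^ 2) + 40) + 40) + (f * (200 * (lam.card + 1)) + 20))
      ?_ ?_).mono (T' := 30 + ((nu.card * (f * (400 * (lam.card + 1) ^ 2) + 40) + 40) +
        (f * (200 * (lam.card + 1)) + 20))) (by simp only [Expr.cost]; omega) fun _ _ h => h))))
      hT fun _ _ h => h
  · rw [h₁.1 2 (by simp)]; simp [input]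
  all_goals
    obtain ⟨f₁, hends, hrows⟩ := h₁
    obtain ⟨f₂, h8, hV⟩ := h₂
    have a6 : m₂ 6 0 = lam.colLen 0 := by rw [f₂ 6 (by simp), hrows]
    have a5 : ∀ j ≤ lam.colLen 0, m₂ 5 j = rowEnds lam mu j := by
      rw [f₂ 5 (by simp)]; exact hends
    simp only [Expr.eval, a6, a5 _ le_rfl, h8, rowEnds_colLen]
    intro htest
  -- A skew shape whose size differs from |ν| has no tableau of type ν, so the empty output is
  -- correct.
  · refine Emits.mono (Does.skip (Q := fun _ => True) trivial) (by omega) ?_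
    rintro out m' ⟨rfl, -⟩
    refine ⟨Nat.zero_le _, [], List.nodup_nil, fun T => ?_, List.Forall₂.nil⟩
    have h1 := SkewSSYT.card_skewCells_of_hasType T.2 (N := nu.card)
      fun i hi => YoungDiagram.rowLen_eq_zero hi
    rw [YoungDiagram.sum_rowLen le_rfl] at h1
    omega
  · have hcard : (skewCells lam mu).card = nu.card := by omega
    have hle := rowLen_le_of_card_skewCells hc hcard
    have henv : Env lam mu (m₂ 7) nu.card m₂ := by
      refine ⟨?_, ?_, a5, a6, rfl, h8⟩
      · rw [f₂ 0 (by simp), f₁ 0 (by simp)]; simp [input]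
      · rw [f₂ 1 (by simp), f₁ 1 (by simp)]; simp [input]
    have hlen : ∀ e ≤ nu.card, (words lam mu (m₂ 7) e).length ≤ f := fun e he =>
      length_words_le hle (by omega)
    refine Does.seq_emits ((does_allWords henv hN hlen).mono le_rfl ?_)
    rintro m₃ ⟨-, b, hl⟩
    refine (emits_writeAll hl hN hle hV).mono ?_ fun out _ hout => ⟨?_, ?_⟩
    · exact Nat.add_le_add_right (Nat.mul_le_mul_right _ (hlen _ le_rfl)) _
    · rw [hout.length_eq]; exact hlen _ le_rfl
    · exact exists_list_tableaux hle hc hV hout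

/-- The bound of (1) would only give f n⁵ here. Instead the O(f n³) steps of the generation are
added to the O(f n²) steps for testing at most f outputs. -/
theorem computesLR_genTableaux (hpos : 0 < lam.card) (hc : mu.card + nu.card = lam.card) :
    ComputesLR (countOutputs genTableaux) lam mu nu (6000 * (numSkewSYT lam mu * lam.card ^ 3)) := by
  obtain ⟨out, t, m, hrun, ht, hlen, L, h1, h2, h3⟩ := emits_genTableaux hpos hc
  obtain ⟨o, s, m', h4, h5, h6⟩ := computesLR_countOutputs hc hrun h1 h2 h3
  refine ⟨o, s, m', h4, h5.trans ?_, h6⟩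
  have hf := numSkewSYT_pos lam mu
  obtain ⟨h7, h8, h9, h10⟩ := le_mul_cube hf hpos
  generalize numSkewSYT lam mu = f at *
  generalize lam.card = n at *
  have h11 : (n + 1) ^ 2 ≤ 4 * n ^ 2 := by nlinarith
  have h12 := Nat.mul_le_mul hlen (Nat.mul_le_mul_left 200 h11)
  have h13 : f * (200 * (4 * n ^ 2)) = 800 * (f * n ^ 2) := by ring
  omega

end RAM

theorem proposition4p4 :
    (∃ C : ℕ, ∀ G : RAM.Prog, ∃ P : RAM.Prog, ∀ (lam mu nu : YoungDiagram) (t : ℕ),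
      0 < lam.card → mu.card + nu.card = lam.card →
      RAM.GeneratesSSYT G lam mu nu t →
      RAM.ComputesLR P lam mu nu (C * (t * lam.card ^ 2))) ∧
    (∃ (C : ℕ) (P : RAM.Prog), ∀ lam mu nu : YoungDiagram,
      0 < lam.card → mu.card + nu.card = lam.card →
      RAM.ComputesLR P lam mu nu (C * (numSkewSYT lam mu * lam.card ^ 3))) :=
  ⟨⟨1000, fun G => ⟨RAM.countOutputs G, fun _ _ _ _ => RAM.computesLR_of_generatesSSYT⟩⟩,
    6000, RAM.countOutputs RAM.genTableaux, fun _ _ _ => RAM.computesLR_genTableaux⟩
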